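/- **Setting.** Let $d,\delta\ge 1$. For every $x\in\mathbb R^d$ let $P(x,\cdot)=\mathcal L(Z\mid X=x)$ be the conditional law of a real random variable $Z$ given $X=x$ ($P$ is a Markov kernel), let $f(x)=\mathbb E(Z\mid X=x)$, and suppose that $f$ has a unique global maximizer $\theta\in\mathbb R^d$; put $\mu=f(\theta)$. Let $(a_n)_{n\ge1}$, $(c_n)_{n\ge1}$ be positive nonrandom sequences and $(e_1,\dots,e_d)$ the canonical basis of $\mathbb R^d$. From random starting values $\theta_1,\mu_1$ define, for $n\ge1$, $$\theta_{n+1}=\theta_n+\frac{a_n}{2c_n}\bigl(Z(\theta_n+c_ne_i)-Z(\theta_n-c_ne_i)\bigr)_{1\le i\le d},\qquad \bar\theta_n=\frac{\sum_{k=1}^n c_k^2\theta_k}{\sum_{k=1}^n c_k^2},$$ $$\mu_{n+1}=\Bigl(1-\frac1n\Bigr)\mu_n+\frac1n\cdot\frac1\delta\sum_{i=1}^{\delta}Z_i(\bar\theta_n).$$ Let $\mathcal G_n$ be the $\sigma$-field generated by $\theta_1$ and by the observation errors (each observation minus the value of $f$ at its point of observation) of all observations made at the steps $1,\dots,n-1$.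 Conditionally on $\mathcal G_n$, each of the $2d+\delta$ observations made at step $n$ has law $P(x,\cdot)$, where $x$ is its point of observation. Write $(v_n)\in\mathcal{GS}(r)$ if $v_n>0$ for all $n\ge 1$ and $\lim_n n(1-v_{n-1}/v_n)=r$, and put $s_n=\sum_{k=1}^n a_k$. **Assumptions.** (A1) $\theta_n\to\theta$ a.s. (A2) $f$ is three times continuously differentiable in a neighborhood of $\theta$, and $D^2f(\theta)$ is negative definite with largest eigenvalue $-L<0$. (A3) Conditionally on $\mathcal G_n$, the $2d+\delta$ observation errors of step $n$ are independent. For some $\sigma>0$, $\operatorname{Var}(Z\mid X=x)=\sigma^2$ for all $x$, and for some $m>2$, $\sup_x\mathbb E(|Z|^m\mid X=x)<\infty$. (A4) There are $\alpha\in(\max\{1/2,2/m\},1]$ and $\tau\in(0,\alpha/2)$ with $(a_n)\in\mathcal{GS}(-\alpha)$ and $(c_n)\in\mathcal{GS}(-\tau)$; $\lim_n na_n$ exists in $\bigl(\max\{\tfrac{1-2\tau}{2L},\tfrac{2\tau}{L}\},\infty\bigr]$; $\lim_n \sqrt n\,a_n\log(s_n)/c_n^2=0$ and $\lim_n nc_n^8=0$.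 (A5) $\displaystyle\lim_n\frac{na_n}{\log s_n}=\infty,\qquad \lim_n\frac{\sum_{k=1}^n a_k\log s_k}{\sqrt{\sum_{k=1}^n c_k^2}}=0,\qquad \lim_n na_n^2c_n^{-6}=\infty.$ **Theorem.** Assume (A1)–(A5), and let $R=\frac16\bigl(\frac{\partial^3 f}{\partial x_i^3}(\theta)\bigr)_{1\le i\le d}$. All convergences are joint, in distribution. (1) If $nc_n^6\to\infty$, then $$\begin{pmatrix}c_n^{-2}(\bar\theta_n-\theta)\\ \sqrt n(\mu_n-\mu)\end{pmatrix}\xrightarrow{\mathcal D}\begin{pmatrix}-\frac{1-2\tau}{1-4\tau}[D^2f(\theta)]^{-1}R\\ \mathcal Z'\end{pmatrix},\qquad \mathcal Z'\sim\mathcal N(0,\sigma^2/\delta).$$ (2) If $nc_n^6\to0$, then $$\begin{pmatrix}\sqrt{nc_n^2}(\bar\theta_n-\theta)\\ \sqrt n(\mu_n-\mu)\end{pmatrix}\xrightarrow{\mathcal D}\mathcal N\!\left(0,\begin{pmatrix}\frac{(1-2\tau)\sigma^2}{2}[D^2f(\theta)]^{-2}&0\\0&\sigma^2/\delta\end{pmatrix}\right).$$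 (3) If $nc_n^6\to\gamma_1$ with $0<\gamma_1<\infty$, then $$\begin{pmatrix}\sqrt{nc_n^2}(\bar\theta_n-\theta)\\ \sqrt n(\mu_n-\mu)\end{pmatrix}\xrightarrow{\mathcal D}\mathcal N\!\left(\begin{pmatrix}-2\sqrt{\gamma_1}\,[D^2f(\theta)]^{-1}R\\0\end{pmatrix},\begin{pmatrix}\frac{\sigma^2}{3}[D^2f(\theta)]^{-2}&0\\0&\sigma^2/\delta\end{pmatrix}\right).$$ In particular, in every case the limit of $\sqrt n(\mu_n-\mu)$ is $\mathcal N(0,\sigma^2/\delta)$ and is independent of the limit of the normalized error of $\bar\theta_n$. -/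

import Mathlib

open MeasureTheory ProbabilityTheory Filter Topology

noncomputable section

namespace KWB

/-- The class `𝒢𝒮(r)` of (Galambos–Seneta) regularly varying sequences: positive sequences
`(v_n)_{n ≥ 1}` with `n (1 - v_{n-1} / v_n) → r`. All sequences here start at `n = 1`;
their value at `0` plays no role. -/
def GS (r : ℝ) (v : ℕ → ℝ) : Prop :=
  (∀ n, 1 ≤ n → 0 < v n) ∧
    Tendsto (fun n : ℕ => (n : ℝ) * (1 - v (n - 1) / v n)) atTop (𝓝 r)

section Regression

variable {d : ℕ}

/-- The regression function `f(x) = 𝔼(Z | X = x)`, where `P x` is the conditional law of `Z`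
given `X = x`. -/
def regression (P : Kernel (EuclideanSpace ℝ (Fin d)) ℝ) (x : EuclideanSpace ℝ (Fin d)) : ℝ :=
  ∫ z, z ∂(P x)

/-- The `i`-th vector of the canonical basis of `ℝ^d`. -/
def basisVec (i : Fin d) : EuclideanSpace ℝ (Fin d) := EuclideanSpace.single i 1

/-- The Hessian matrix `D²f(x) = (∂²f/∂x_i∂x_j (x))_{i,j}`. -/
def hessian (f : EuclideanSpace ℝ (Fin d) → ℝ) (x : EuclideanSpace ℝ (Fin d)) :
    Matrix (Fin d) (Fin d) ℝ :=
  Matrix.of fun i j => iteratedFDeriv ℝ 2 f x ![basisVec i, basisVec j]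

/-- The vector `R = (1/6) (∂³f/∂x_i³ (x))_i`. -/
def thirdOrderBias (f : EuclideanSpace ℝ (Fin d) → ℝ) (x : EuclideanSpace ℝ (Fin d)) :
    Fin d → ℝ :=
  fun i => (1 / 6) * iteratedFDeriv ℝ 3 f x (fun _ => basisVec i)

/-- `f` has the unique global maximizer `θ`, is `C³` in a neighborhood of `θ`, and `D²f(θ)` is
negative definite with largest eigenvalue `-L`. -/
structure IsRegularMaximizer (f : EuclideanSpace ℝ (Fin d) → ℝ) (θ : EuclideanSpace ℝ (Fin d))
    (L : ℝ) : Prop where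
  unique_max : ∀ x, x ≠ θ → f x < f θ
  contDiffAt : ContDiffAt ℝ 3 f θ
  negDef : (-(hessian f θ)).PosDef
  max_eigenvalue :
    IsGreatest {r : ℝ | Module.End.HasEigenvalue (Matrix.toLin' (hessian f θ)) r} (-L)

/-- The conditional laws have constant variance `σ² > 0` and, with `m > 2`, moments of order `m`
that are bounded uniformly in `x`. -/
structure HasUniformNoise (P : Kernel (EuclideanSpace ℝ (Fin d)) ℝ) (σ m : ℝ) : Prop where
  sigma_pos : 0 < σ
  two_lt : 2 < m
  variance_eq : ∀ x, Var[id; P x] = σ ^ 2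
  moment_lt_top : (⨆ x, ∫⁻ z, ‖z‖ₑ ^ m ∂(P x)) < ⊤

end Regression

section Algorithm

variable {d δ : ℕ} {Ω : Type*}

/-- Labels of the `2d + δ` observations made at each step: `inl i` for the observation at
`θ_n + c_n e_i`, `inr (inl i)` for the one at `θ_n - c_n e_i`, and `inr (inr k)` for the `k`-th
observation at the averaged point. -/
abbrev Label (d δ : ℕ) : Type := Fin d ⊕ Fin d ⊕ Fin δ

/-- The weighted average `(∑_{k=1}^n c_k²)⁻¹ ∑_{k=1}^n c_k² θ_k`. -/
def average (c : ℕ → ℝ) (Θ : ℕ → Ω → EuclideanSpace ℝ (Fin d)) (n : ℕ) (ω : Ω) :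
    EuclideanSpace ℝ (Fin d) :=
  (∑ k ∈ Finset.Icc 1 n, c k ^ 2)⁻¹ • ∑ k ∈ Finset.Icc 1 n, c k ^ 2 • Θ k ω

/-- The point at which the observation with a given label is made at step `n`. -/
def queryPoint (c : ℕ → ℝ) (Θ : ℕ → Ω → EuclideanSpace ℝ (Fin d)) (n : ℕ) :
    Label d δ → Ω → EuclideanSpace ℝ (Fin d)
  | Sum.inl i, ω => Θ n ω + c n • basisVec i
  | Sum.inr (Sum.inl i), ω => Θ n ω - c n • basisVec i
  | Sum.inr (Sum.inr _), ω => average c Θ n ω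

/-- The observation errors `Z - f(point of observation)`. -/
def noise (f : EuclideanSpace ℝ (Fin d) → ℝ) (c : ℕ → ℝ)
    (Θ : ℕ → Ω → EuclideanSpace ℝ (Fin d)) (Z : ℕ → Label d δ → Ω → ℝ)
    (n : ℕ) (j : Label d δ) (ω : Ω) : ℝ :=
  Z n j ω - f (queryPoint c Θ n j ω)

/-- The `σ`-field of the past at step `n`: it is generated by the observation errors of the
steps `1, …, n - 1` and by the starting point `θ_1` (which contributes nothing if `θ_1` is
deterministic). -/
@[reducible] def history (f : EuclideanSpace ℝ (Fin d) → ℝ) (c : ℕ → ℝ)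
    (Θ : ℕ → Ω → EuclideanSpace ℝ (Fin d)) (Z : ℕ → Label d δ → Ω → ℝ) (n : ℕ) :
    MeasurableSpace Ω :=
  MeasurableSpace.comap (Θ 1) inferInstance ⊔
    ⨆ k ∈ Finset.Ico 1 n, ⨆ j : Label d δ,
      MeasurableSpace.comap (noise f c Θ Z k j) inferInstance

/-- The Kiefer–Wolfowitz–Blum approximation `Y_n` of the gradient at `θ_n`. -/
def gradientEstimate (c : ℕ → ℝ) (Z : ℕ → Label d δ → Ω → ℝ) (n : ℕ) (ω : Ω) :
    EuclideanSpace ℝ (Fin d) :=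
  (1 / (2 * c n)) •
    WithLp.toLp 2 (fun i : Fin d => Z n (Sum.inl i) ω - Z n (Sum.inr (Sum.inl i)) ω)

/-- The mean of the `δ` observations made at the averaged point at step `n`. -/
def valueEstimate (Z : ℕ → Label d δ → Ω → ℝ) (n : ℕ) (ω : Ω) : ℝ :=
  (1 / (δ : ℝ)) * ∑ k : Fin δ, Z n (Sum.inr (Sum.inr k)) ω

/-- `Θ` and `M` are produced from the observations `Z` by
`θ_{n+1} = θ_n + a_n Y_n` and `μ_{n+1} = (1 - 1/n) μ_n + (1/n) Ȳ_n`, `n ≥ 1`. -/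
structure IsAlgorithm [MeasurableSpace Ω] (a c : ℕ → ℝ)
    (Θ : ℕ → Ω → EuclideanSpace ℝ (Fin d)) (M : ℕ → Ω → ℝ)
    (Z : ℕ → Label d δ → Ω → ℝ) : Prop where
  measurable_init : Measurable (Θ 1)
  measurable_init' : Measurable (M 1)
  measurable_obs : ∀ n j, Measurable (Z n j)
  step : ∀ n, 1 ≤ n → ∀ ω, Θ (n + 1) ω = Θ n ω + a n • gradientEstimate c Z n ω
  step' : ∀ n : ℕ, 1 ≤ n → ∀ ω,
    M (n + 1) ω = (1 - 1 / (n : ℝ)) * M n ω + (1 / (n : ℝ)) * valueEstimate Z n ω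

/-- The finite family `X` of real random variables is independent conditionally on `m`. -/
def CondIndepFamily {ι : Type*} [Fintype ι] [MeasurableSpace Ω] (Pr : Measure Ω)
    (m : MeasurableSpace Ω) (X : ι → Ω → ℝ) : Prop :=
  ∀ B : ι → Set ℝ, (∀ j, MeasurableSet (B j)) →
    Pr⟦⋂ j, X j ⁻¹' B j | m⟧ =ᵐ[Pr] fun ω => ∏ j, (Pr⟦X j ⁻¹' B j | m⟧) ω

/-- The sampling scheme: given the past, each observation made at step `n` has the conditional
law of `Z` given `X = x`, `x` being the point of observation, and the errors of the `2d + δ`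
observations made at step `n` are independent. -/
structure IsSampling [MeasurableSpace Ω] (Pr : Measure Ω)
    (P : Kernel (EuclideanSpace ℝ (Fin d)) ℝ) (c : ℕ → ℝ)
    (Θ : ℕ → Ω → EuclideanSpace ℝ (Fin d)) (Z : ℕ → Label d δ → Ω → ℝ) : Prop where
  law : ∀ n, 1 ≤ n → ∀ (j : Label d δ) (B : Set ℝ), MeasurableSet B →
    Pr⟦Z n j ⁻¹' B | history (regression P) c Θ Z n⟧
      =ᵐ[Pr] fun ω => (P (queryPoint c Θ n j ω)).real B
  condIndep : ∀ n, 1 ≤ n →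
    CondIndepFamily Pr (history (regression P) c Θ Z n) (noise (regression P) c Θ Z n)

end Algorithm

/-- The partial sums `s_n = a_1 + ⋯ + a_n`. -/
def partialSum (a : ℕ → ℝ) (n : ℕ) : ℝ := ∑ k ∈ Finset.Icc 1 n, a k

/-- The conditions on the step sizes of the basic algorithm, when the step size of the recursion
for the size of the maximum is `1/n`. -/
structure StepConditions (a c : ℕ → ℝ) (m L α τ : ℝ) : Prop where
  alpha_gt : max (1 / 2) (2 / m) < α
  alpha_le : α ≤ 1
  a_mem : GS (-α) a
  tau_pos : 0 < τ
  tau_lt : τ < α / 2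
  c_mem : GS (-τ) c
  lim_na : ∃ l : EReal, Tendsto (fun n : ℕ => (((n : ℝ) * a n : ℝ) : EReal)) atTop (𝓝 l) ∧
    ((max ((1 - 2 * τ) / (2 * L)) (2 * τ / L) : ℝ) : EReal) < l
  lim_a_log : Tendsto
    (fun n : ℕ => Real.sqrt n * a n * Real.log (partialSum a n) / c n ^ 2) atTop (𝓝 0)
  lim_c_eight : Tendsto (fun n : ℕ => (n : ℝ) * c n ^ 8) atTop (𝓝 0)

/-- The additional conditions on the step sizes that are required by the averaging. -/
structure AveragingConditions (a c : ℕ → ℝ) : Prop where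
  slow : Tendsto (fun n : ℕ => (n : ℝ) * a n / Real.log (partialSum a n)) atTop atTop
  sum_small : Tendsto
    (fun n : ℕ => (∑ k ∈ Finset.Icc 1 n, a k * Real.log (partialSum a k)) /
      Real.sqrt (∑ k ∈ Finset.Icc 1 n, c k ^ 2)) atTop (𝓝 0)
  ratio : Tendsto (fun n : ℕ => (n : ℝ) * a n ^ 2 / c n ^ 6) atTop atTop

end KWB

end

/-! Write `H = D²f(θ)`, `S_n = ∑ c_k²`, and let `η_k` be the vector of half differences of the
observation errors at `θ_k ± c_k e_i`. Near `θ` the symmetric difference quotients have a third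
order expansion, so that one step of the algorithm reads `θ_{k+1} - θ_k = a_k (H(θ_k - θ) + c_k² R +
e_k + c_k⁻¹ η_k)`. Multiplying by `c_k² / a_k`, summing, and applying Abel's summation to the left
side gives the identity `hessianCLM_weightSum_smul`: `H S_n (θ̄_n - θ) = ρ_n - ∑ c_k η_k - (∑ c_k⁴)
R`. The step sizes `a_k` survive only in `ρ_n`. The noise sum has covariance `(σ²/2) S_n` times the
identity and the bias is deterministic. Both are dominated by `G_n = ∑ (c_k k^{-1/2} + c_k⁴)`, and
`c_k⁴` is the factor `√(k c_k⁶)` times `c_k k^{-1/2}`; hence the three regimes of `n c_n⁶`.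

The remainder `ρ_n` is `o(G_n)` in probability (`probZero_remainder`). This rests on the mean square
rate `a_n / c_n² + c_n⁴` of `θ_n - θ`. Since the convergence of `θ_n` is only assumed almost surely,
that rate is proved on events on which the iterates stay close to `θ` (`exists_setIntegral_sq_le`);
these have probability close to `1`, which is the meaning of `LocalMeanBound`.

For the maximum, `n μ_{n+1}` is the sum over `k ≤ n` of `f(θ̄_k)` and an averaged error. As `f(θ̄_k)
- f(θ)` is quadratic in `θ̄_k - θ`, the bias disappears once `∑ ‖θ̄_k - θ‖² = o(√n)` in probability
(`probZero_average_sq`), which follows from the same identity, term by term.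

There remain the two noise sums. Conditional variances are constant, so the characteristic function
of a linear combination of errors with deterministic weights can be followed step by step
(`tendsto_integral_cexp_sum`). The gradient and the value use disjoint sets of observations; the sum
of squared weights therefore has no cross term, and the joint limit is a product. Lévy's theorem and
Slutsky's lemma conclude (`AveragingSetting.tendstoInDistribution`). -/

noncomputable section

namespace KWB

/-! ### Partial sums and regularly varying sequences. -/

section

lemma partialSum_zero (v : ℕ → ℝ) : partialSum v 0 = 0 := by simp [partialSum]

lemma partialSum_succ (v : ℕ → ℝ) (n : ℕ) :
    partialSum v (n + 1) = partialSum v n + v (n + 1) := by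
  simp [partialSum, Finset.sum_Icc_succ_top]

lemma partialSum_eq_range (v : ℕ → ℝ) (n : ℕ) :
    partialSum v n = ∑ i ∈ Finset.range n, v (i + 1) := by
  induction n with
  | zero => simp [partialSum_zero]
  | succ n ih => rw [partialSum_succ, ih, Finset.sum_range_succ]

lemma partialSum_mono_of_le {u v : ℕ → ℝ} (h : ∀ n, 1 ≤ n → u n ≤ v n) (n : ℕ) :
    partialSum u n ≤ partialSum v n :=
  Finset.sum_le_sum fun k hk => h k (Finset.mem_Icc.1 hk).1

lemma partialSum_nonneg {v : ℕ → ℝ} (h : ∀ n, 1 ≤ n → 0 ≤ v n) (n : ℕ) : 0 ≤ partialSum v n :=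
  Finset.sum_nonneg fun k hk => h k (Finset.mem_Icc.1 hk).1

lemma partialSum_pos {v : ℕ → ℝ} (h : ∀ n, 1 ≤ n → 0 < v n) {n : ℕ} (hn : 1 ≤ n) :
    0 < partialSum v n :=
  Finset.sum_pos (fun k hk => h k (Finset.mem_Icc.1 hk).1) ⟨1, by simp [hn]⟩

lemma partialSum_const_mul (C : ℝ) (v : ℕ → ℝ) (n : ℕ) :
    partialSum (fun k => C * v k) n = C * partialSum v n := by
  simp [partialSum, Finset.mul_sum]

lemma partialSum_add (u v : ℕ → ℝ) (n : ℕ) :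
    partialSum (fun k => u k + v k) n = partialSum u n + partialSum v n := by
  simp [partialSum, Finset.sum_add_distrib]

/-- A comparison of Stolz–Cesàro type; the shift by one turns sums over `1, …, n` into sums over
`range n`. -/
lemma isLittleO_partialSum {u v : ℕ → ℝ} (h : u =o[atTop] v) (hv : ∀ n, 1 ≤ n → 0 ≤ v n)
    (hs : Tendsto (partialSum v) atTop atTop) : partialSum u =o[atTop] partialSum v := by
  have h1 : (fun n => u (n + 1)) =o[atTop] fun n => v (n + 1) :=
    h.comp_tendsto (tendsto_add_atTop_nat 1)
  have e1 := funext (partialSum_eq_range u)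
  have e2 := funext (partialSum_eq_range v)
  rw [e2] at hs
  rw [e1, e2]
  exact h1.sum_range (fun n => hv _ (by omega)) hs

/-- An eventual bound by a positive sequence holds everywhere after increasing the constant. -/
lemma exists_forall_le_of_isBigO {u v : ℕ → ℝ} (h : u =O[atTop] v) (hv : ∀ n, 1 ≤ n → 0 < v n) :
    ∃ C, 0 < C ∧ ∀ n, 1 ≤ n → |u n| ≤ C * v n := by
  obtain ⟨C, hC, hb⟩ := h.exists_pos
  rw [Asymptotics.isBigOWith_iff] at hb
  obtain ⟨N, hN⟩ := eventually_atTop.1 hb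
  refine ⟨C + ∑ k ∈ Finset.range N, |u k| / |v k|, ?_, fun n hn => ?_⟩
  · have : 0 ≤ ∑ k ∈ Finset.range N, |u k| / |v k| := Finset.sum_nonneg fun _ _ => by positivity
    linarith
  · have hnn : 0 ≤ ∑ k ∈ Finset.range N, |u k| / |v k| := Finset.sum_nonneg fun _ _ => by positivity
    have hvn := hv n hn
    rcases le_or_gt N n with h | h
    · have := hN n h
      rw [Real.norm_eq_abs, Real.norm_eq_abs, abs_of_pos hvn] at this
      nlinarith
    · have : |u n| / |v n| ≤ ∑ k ∈ Finset.range N, |u k| / |v k| :=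
        Finset.single_le_sum (f := fun k => |u k| / |v k|) (fun _ _ => by positivity)
          (Finset.mem_range.2 h)
      rw [abs_of_pos hvn, div_le_iff₀ hvn] at this
      nlinarith

lemma partialSum_isBigO {u v : ℕ → ℝ} (h : u =O[atTop] v) (hv : ∀ n, 1 ≤ n → 0 < v n) :
    partialSum u =O[atTop] partialSum v := by
  obtain ⟨C, hC, hb⟩ := exists_forall_le_of_isBigO h hv
  refine Asymptotics.IsBigO.of_bound C (Eventually.of_forall fun n => ?_)
  rw [Real.norm_eq_abs, Real.norm_eq_abs,
    abs_of_nonneg (partialSum_nonneg (fun k hk => (hv k hk).le) n), ← partialSum_const_mul]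
  exact (Finset.abs_sum_le_sum_abs _ _).trans (partialSum_mono_of_le hb n)

namespace GS

variable {r s : ℝ} {u v : ℕ → ℝ}

lemma pos (h : GS r v) {n : ℕ} (hn : 1 ≤ n) : 0 < v n := h.1 n hn

lemma tendsto_ratio (h : GS r v) : Tendsto (fun n => v (n - 1) / v n) atTop (𝓝 1) := by
  have h1 : Tendsto (fun n : ℕ => (n : ℝ)⁻¹ * ((n : ℝ) * (1 - v (n - 1) / v n))) atTop
      (𝓝 (0 * r)) := tendsto_inv_atTop_nhds_zero_nat.mul h.2
  have h2 := h1.const_sub 1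
  rw [zero_mul, sub_zero] at h2
  refine h2.congr' ?_
  filter_upwards [eventually_ge_atTop 1] with n hn
  have : (n : ℝ) ≠ 0 := by positivity
  field_simp
  ring

/-- With primes for the preceding terms, `1 - u'v'/(uv) = (1 - u'/u) + (u'/u)(1 - v'/v)`, and `u'/u
→ 1`. -/
lemma mul (hu : GS r u) (hv : GS s v) : GS (r + s) (fun n => u n * v n) := by
  refine ⟨fun n hn => mul_pos (hu.pos hn) (hv.pos hn), ?_⟩
  have := hu.2.add (hu.tendsto_ratio.mul hv.2)
  rw [one_mul] at this
  refine this.congr' ?_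
  filter_upwards [eventually_ge_atTop 1] with n hn
  have h1 := (hu.pos hn).ne'
  have h2 := (hv.pos hn).ne'
  field_simp
  ring

lemma inv (hv : GS r v) : GS (-r) (fun n => (v n)⁻¹) := by
  refine ⟨fun n hn => inv_pos.2 (hv.pos hn), ?_⟩
  have := (hv.2.neg).mul (hv.tendsto_ratio.inv₀ one_ne_zero)
  rw [inv_one, mul_one] at this
  refine this.congr' ?_
  filter_upwards [eventually_ge_atTop 2] with n hn
  have h1 := (hv.pos (n := n) (by omega)).ne'
  have h2 := (hv.pos (n := n - 1) (by omega)).ne'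
  field_simp
  ring

lemma div (hu : GS r u) (hv : GS s v) : GS (r - s) (fun n => u n / v n) := by
  simpa [div_eq_mul_inv, sub_eq_add_neg] using hu.mul hv.inv

lemma pow (hv : GS r v) (k : ℕ) : GS (k * r) (fun n => v n ^ k) := by
  induction k with
  | zero => exact ⟨fun n _ => by simp, by simp⟩
  | succ k ih =>
    have := ih.mul hv
    push_cast
    simpa [pow_succ, add_mul] using this

/-- The limit is minus the derivative of `(1 - x)^s` at `0`, taken along `x = 1/n`. -/
lemma rpow_nat (s : ℝ) : GS s (fun n : ℕ => (n : ℝ) ^ s) := by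
  refine ⟨fun n hn => by positivity, ?_⟩
  have hd : HasDerivAt (fun x : ℝ => (1 - x) ^ s) (-s) 0 := by
    have h0 : HasDerivAt (fun x : ℝ => 1 - x) (-1) 0 := by
      simpa using (hasDerivAt_id (0 : ℝ)).const_sub 1
    have := h0.rpow_const (p := s) (Or.inl (by norm_num))
    simpa using this
  have h1 := hd.tendsto_slope_zero
  have h2 : Tendsto (fun n : ℕ => (n : ℝ)⁻¹) atTop (𝓝[≠] 0) := by
    refine tendsto_nhdsWithin_iff.2 ⟨tendsto_inv_atTop_nhds_zero_nat, ?_⟩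
    filter_upwards [eventually_ge_atTop 1] with n hn
    have : (0 : ℝ) < n := by positivity
    exact (inv_pos.2 this).ne'
  have h3 := (h1.comp h2).neg
  rw [neg_neg] at h3
  refine h3.congr' ?_
  filter_upwards [eventually_ge_atTop 1] with n hn
  have hn0 : (0 : ℝ) < n := by positivity
  simp only [Function.comp, inv_inv, zero_add, sub_zero, Real.one_rpow, smul_eq_mul]
  rw [← Real.div_rpow (by positivity) hn0.le]
  have : (((n - 1 : ℕ) : ℝ) / n) = 1 - (n : ℝ)⁻¹ := by
    rw [Nat.cast_sub hn]; field_simp; simp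
  rw [this]; ring

lemma nat : GS 1 (fun n : ℕ => (n : ℝ)) := by simpa using rpow_nat 1

/-- The increments of `n v_n` are `(1 + r + o(1)) v_n`. -/
lemma tendsto_increment (h : GS r v) :
    Tendsto (fun n : ℕ => ((n : ℝ) * v n - ((n - 1 : ℕ) : ℝ) * v (n - 1)) / v n) atTop
      (𝓝 (r + 1)) := by
  refine (h.2.add h.tendsto_ratio).congr' ?_
  filter_upwards [eventually_ge_atTop 1] with n hn
  have := (h.pos hn).ne'
  rw [Nat.cast_sub hn]
  field_simp
  push_cast
  ring

lemma mul_eq_partialSum (v : ℕ → ℝ) (n : ℕ) :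
    (n : ℝ) * v n = partialSum (fun n => (n : ℝ) * v n - ((n - 1 : ℕ) : ℝ) * v (n - 1)) n := by
  induction n with
  | zero => simp [partialSum_zero]
  | succ n ih => rw [partialSum_succ, ← ih]; simp

lemma increment_isBigO (h : GS r v) :
    (fun n : ℕ => (n : ℝ) * v n - ((n - 1 : ℕ) : ℝ) * v (n - 1)) =O[atTop] v := by
  have := h.tendsto_increment.isBigO_one ℝ
  have h2 := this.mul (Asymptotics.isBigO_refl v atTop)
  refine (h2.congr' ?_ ?_)
  · filter_upwards [eventually_ge_atTop 1] with n hn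
    have := (h.pos hn).ne'
    field_simp
  · filter_upwards with n; simp

lemma mul_isBigO_partialSum (h : GS r v) :
    (fun n : ℕ => (n : ℝ) * v n) =O[atTop] partialSum v := by
  rw [funext (mul_eq_partialSum v)]
  exact partialSum_isBigO h.increment_isBigO fun n hn => h.pos hn

/-- Since `r + 1 > 0`, the increments of `n v_n` are eventually positive; so `v_n` is eventually at
least a multiple of `1/n`, and the harmonic series diverges. -/
lemma tendsto_partialSum_atTop (h : GS r v) (hr : -1 < r) :
    Tendsto (partialSum v) atTop atTop := by
  have h1 := h.tendsto_increment.eventually (lt_mem_nhds (show 0 < r + 1 by linarith))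
  obtain ⟨N, hN⟩ := eventually_atTop.1 (h1.and (eventually_ge_atTop 1))
  have hmono : ∀ n, N ≤ n → (N : ℝ) * v N ≤ n * v n := by
    intro n hn
    induction n, hn using Nat.le_induction with
    | base => exact le_rfl
    | succ n hn ih =>
      have h2 := (hN (n + 1) (by omega)).1
      have h3 := h.pos (n := n + 1) (by omega)
      rw [lt_div_iff₀ h3] at h2
      simp only [Nat.add_sub_cancel, zero_mul] at h2
      linarith
  have hN1 := (hN N le_rfl).2
  have hκ : 0 < (N : ℝ) * v N := by have := h.pos hN1; positivity
  have hdiv : ¬ Summable fun i : ℕ => v (i + 1) := by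
    intro hs
    have hs' : Summable v := (summable_nat_add_iff 1).1 hs
    have : Summable fun n : ℕ => ((N : ℝ) * v N) * (n : ℝ)⁻¹ := by
      refine Summable.of_norm_bounded_eventually_nat hs' ?_
      filter_upwards [eventually_ge_atTop N] with n hn
      have hn0 : (0 : ℝ) < n := by
        have : 1 ≤ n := by omega
        positivity
      rw [Real.norm_of_nonneg (by positivity), ← div_eq_mul_inv, div_le_iff₀ hn0, mul_comm (v n)]
      exact hmono n hn
    have := (summable_mul_left_iff hκ.ne').1 this
    exact Real.not_summable_natCast_inv this
  have := (not_summable_iff_tendsto_nat_atTop_of_nonneg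
    (fun n => (h.pos (n := n + 1) (by omega)).le)).1 hdiv
  rwa [funext (partialSum_eq_range v)]

/-- Karamata's theorem for sequences of class `𝒢𝒮(r)`, `r > -1`. -/
lemma tendsto_mul_div_partialSum (h : GS r v) (hr : -1 < r) :
    Tendsto (fun n : ℕ => (n : ℝ) * v n / partialSum v n) atTop (𝓝 (r + 1)) := by
  -- The increments of `n v_n` differ from `(r + 1) v_n` by `o(v_n)`. Summation telescopes the left
  -- part and gives `n v_n - (r + 1) ∑ v_k = o(∑ v_k)`.
  have h1 : (fun n : ℕ => ((n : ℝ) * v n - ((n - 1 : ℕ) : ℝ) * v (n - 1)) - (r + 1) * v n)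
      =o[atTop] v := by
    refine (Asymptotics.isLittleO_iff_tendsto' ?_).2 ?_
    · filter_upwards [eventually_ge_atTop 1] with n hn h0
      exact absurd h0 (h.pos hn).ne'
    · have := h.tendsto_increment.sub_const (r + 1)
      rw [sub_self] at this
      refine this.congr' ?_
      filter_upwards [eventually_ge_atTop 1] with n hn
      have := (h.pos hn).ne'
      field_simp
  have h2 := isLittleO_partialSum h1 (fun n hn => (h.pos hn).le) (h.tendsto_partialSum_atTop hr)
  have h3 := (h2.tendsto_div_nhds_zero).add_const (r + 1)
  rw [zero_add] at h3
  refine h3.congr' ?_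
  filter_upwards [eventually_ge_atTop 1] with n hn
  have h4 : partialSum (fun n : ℕ => ((n : ℝ) * v n - ((n - 1 : ℕ) : ℝ) * v (n - 1))
      - (r + 1) * v n) n = n * v n - (r + 1) * partialSum v n := by
    rw [mul_eq_partialSum v n, ← partialSum_const_mul]
    simp only [partialSum, ← Finset.sum_sub_distrib]
  have h5 := (partialSum_pos (fun n hn => h.pos hn) hn).ne'
  rw [h4]
  field_simp
  ring

/-- Eventually `v` decreases, losing at least `(-r/2) v_{n+1}/(n+1)` at each step. A positive limit
`ℓ` would make the total loss at least `(-r/2) ℓ` times a divergent harmonic sum. -/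
lemma tendsto_zero (h : GS r v) (hr : r < 0) : Tendsto v atTop (𝓝 0) := by
  have h1 := h.2.eventually (gt_mem_nhds (show r < r / 2 by linarith))
  obtain ⟨N, hN⟩ := eventually_atTop.1 (h1.and (eventually_ge_atTop 1))
  have hstep : ∀ n, N ≤ n → v (n + 1) - (r / 2) * (v (n + 1) / (n + 1)) ≤ v n := by
    intro n hn
    have h2 := (hN (n + 1) (by omega)).1
    have h3 := h.pos (n := n + 1) (by omega)
    simp only [Nat.add_sub_cancel] at h2
    have hn0 : (0 : ℝ) < n + 1 := by positivity
    push_cast at h2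
    have h4 : ((n : ℝ) + 1) * (v (n + 1) - v n) < r / 2 * v (n + 1) := by
      have h5 : ((n : ℝ) + 1) * (1 - v n / v (n + 1)) * v (n + 1) < r / 2 * v (n + 1) :=
        mul_lt_mul_of_pos_right h2 h3
      have h6 : ((n : ℝ) + 1) * (1 - v n / v (n + 1)) * v (n + 1)
        = ((n : ℝ) + 1) * (v (n + 1) - v n) := by field_simp
      linarith
    have h7 : v (n + 1) - v n ≤ r / 2 * v (n + 1) / (n + 1) := by
      rw [le_div_iff₀ hn0]; linarith
    rw [mul_div_assoc] at h7
    linarith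
  have hpos : ∀ n, N ≤ n → 0 < v n := fun n hn => h.pos ((hN N le_rfl).2.trans hn)
  set w : ℕ → ℝ := fun n => v (n + N) with hw
  have hanti : Antitone w := antitone_nat_of_succ_le fun n => by
    have h2 := hstep (n + N) (by omega)
    have h3 := hpos (n + N + 1) (by omega)
    have h4 : 0 ≤ (-r / 2) * (v (n + N + 1) / ((n + N : ℕ) + 1)) := by
      have : 0 ≤ -r / 2 := by linarith
      positivity
    have h5 : w (n + 1) = v (n + N + 1) := by simp only [hw]; congr 1; omega
    rw [h5]
    show _ ≤ v (n + N)
    linarith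
  have hbdd : BddBelow (Set.range w) := ⟨0, by rintro _ ⟨n, rfl⟩; exact (hpos _ (by omega)).le⟩
  have hlim := tendsto_atTop_ciInf hanti hbdd
  set ℓ := ⨅ n, w n
  have hℓ : ∀ n, ℓ ≤ w n := fun n => ciInf_le hbdd n
  have hℓ0 : 0 ≤ ℓ := le_ciInf fun n => (hpos _ (by omega)).le
  rcases hℓ0.eq_or_lt with h0 | h0
  · rw [← h0] at hlim
    exact (tendsto_add_atTop_iff_nat N).1 hlim
  exfalso
  have hsum : ∀ m, (-r / 2) * ℓ * ∑ i ∈ Finset.range m, ((i + N + 1 : ℕ) : ℝ)⁻¹ ≤ w 0 - w m := by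
    intro m
    induction m with
    | zero => simp
    | succ m ih =>
      rw [Finset.sum_range_succ, mul_add]
      have h2 := hstep (m + N) (by omega)
      have h5 : w (m + 1) = v (m + N + 1) := by simp only [hw]; congr 1; omega
      have h6 : ℓ ≤ v (m + N + 1) := h5 ▸ hℓ (m + 1)
      have h7 : (-r / 2) * ℓ * ((m + N + 1 : ℕ) : ℝ)⁻¹
          ≤ (-r / 2) * (v (m + N + 1) / ((m + N : ℕ) + 1)) := by
        rw [mul_assoc]
        refine mul_le_mul_of_nonneg_left ?_ (by linarith)
        rw [div_eq_mul_inv]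
        push_cast
        gcongr
      have h8 : w m = v (m + N) := rfl
      linarith
  have hs : Summable fun i : ℕ => ((i + N + 1 : ℕ) : ℝ)⁻¹ := by
    have hc : 0 < (-r / 2) * ℓ := by
      have : 0 < -r / 2 := by linarith
      positivity
    refine summable_of_sum_range_le (c := w 0 / ((-r / 2) * ℓ)) (fun _ => by positivity) fun m => ?_
    rw [le_div_iff₀ hc, mul_comm]
    exact (hsum m).trans (by have := hℓ m; linarith)
  have : Summable fun i : ℕ => ((i + (N + 1) : ℕ) : ℝ)⁻¹ := hs
  exact Real.not_summable_natCast_inv ((summable_nat_add_iff (f := fun n : ℕ => (n : ℝ)⁻¹) (N + 1)).1 this)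

lemma tendsto_atTop (h : GS r v) (hr : 0 < r) : Tendsto v atTop atTop := by
  have h1 := h.inv.tendsto_zero (by linarith)
  have h2 : Tendsto (fun n => (v n)⁻¹) atTop (𝓝[>] 0) := by
    refine tendsto_nhdsWithin_iff.2 ⟨h1, ?_⟩
    filter_upwards [eventually_ge_atTop 1] with n hn using inv_pos.2 (h.pos hn)
  refine (tendsto_inv_nhdsGT_zero.comp h2).congr fun n => by simp

lemma isLittleO_rpow (h : GS r v) (hs : r < s) : v =o[Filter.atTop] fun n : ℕ => (n : ℝ) ^ s := by
  refine (Asymptotics.isLittleO_iff_tendsto' ?_).2 ((h.div (rpow_nat s)).tendsto_zero (by linarith))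
  filter_upwards [eventually_ge_atTop 1] with n hn h0
  exact absurd h0 ((rpow_nat s).pos hn).ne'

lemma rpow_isLittleO (h : GS r v) (hs : s < r) : (fun n : ℕ => (n : ℝ) ^ s) =o[Filter.atTop] v := by
  refine (Asymptotics.isLittleO_iff_tendsto' ?_).2 (((rpow_nat s).div h).tendsto_zero (by linarith))
  filter_upwards [eventually_ge_atTop 1] with n hn h0
  exact absurd h0 (h.pos hn).ne'

end GS

end

/-! ### The rates of the proof and first consequences of the step size conditions. -/

section

/-- The mean square rate of `θ_n - θ`. -/
def errRate (a c : ℕ → ℝ) (n : ℕ) : ℝ := a n / c n ^ 2 + c n ^ 4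

/-- The terms of the sequence to which the remainders of the averaged error are compared. -/
def driftRate (c : ℕ → ℝ) (n : ℕ) : ℝ := c n * (n : ℝ) ^ (-(1 / 2) : ℝ) + c n ^ 4

/-- The weights `∑_{k=1}^n c_k²` of the average. -/
def weightSum (c : ℕ → ℝ) (n : ℕ) : ℝ := partialSum (fun k => c k ^ 2) n

/-- The consequences of the conditions on the step sizes that are used in the proof. -/
structure Rates (a c : ℕ → ℝ) (τ : ℝ) : Prop where
  a_pos : ∀ n, 1 ≤ n → 0 < a n
  c_pos : ∀ n, 1 ≤ n → 0 < c n
  c_mem : GS (-τ) c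
  tau_le : τ ≤ 1 / 4
  a_zero : Tendsto a atTop (𝓝 0)
  c_zero : Tendsto c atTop (𝓝 0)
  weightSum_atTop : Tendsto (weightSum c) atTop atTop
  weightSum_equiv : Tendsto (fun n : ℕ => (n : ℝ) * c n ^ 2 / weightSum c n) atTop (𝓝 (1 - 2 * τ))
  drift_isLittleO :
    (fun n : ℕ => c n ^ 2 / a n / n * Real.sqrt (errRate a c n)) =o[atTop] driftRate c
  quad_isLittleO :
    partialSum (fun n => c n ^ 2 * errRate a c n) =o[atTop] partialSum (driftRate c)
  driftSum_atTop : Tendsto (partialSum (driftRate c)) atTop atTop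
  mul_driftRate : (fun n : ℕ => n * driftRate c n) =O[atTop] partialSum (driftRate c)
  driftSum_div : (fun n : ℕ => partialSum (driftRate c) n / weightSum c n)
    =o[atTop] fun n : ℕ => (n : ℝ) ^ (-(1 / 4) : ℝ)
  inv_weightSum : (fun n => (weightSum c n)⁻¹) =o[atTop] fun n : ℕ => (n : ℝ) ^ (-(1 / 2) : ℝ)
  errRate_succ : (fun n => errRate a c (n + 1)) =O[atTop] errRate a c
  errRate_le : ∀ l : ℝ, 0 < l → ∀ᶠ n in atTop, (1 - l * a n) * errRate a c n ≤ errRate a c (n + 1)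
  gain_diff : (fun n => c n ^ 2 / a n - c (n - 1) ^ 2 / a (n - 1))
    =O[atTop] fun n : ℕ => c n ^ 2 / a n / n
  smoothing : Tendsto (fun n : ℕ => (n : ℝ) ^ (-(1 / 4) : ℝ) * ∑ j ∈ Finset.Icc 1 n,
    c j ^ 2 * errRate a c j * Real.sqrt (∑ k ∈ Finset.Icc j n, (weightSum c k ^ 2)⁻¹))
    atTop (𝓝 0)

lemma errRate_pos {a c : ℕ → ℝ} {n : ℕ} (ha : 0 < a n) (hc : 0 < c n) : 0 < errRate a c n := by
  unfold errRate; positivity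

lemma driftRate_pos {c : ℕ → ℝ} {n : ℕ} (hn : 1 ≤ n) (hc : 0 < c n) : 0 < driftRate c n := by
  unfold driftRate
  have : (0 : ℝ) < n := by positivity
  positivity

variable {a c : ℕ → ℝ} {m L α τ : ℝ}

lemma tendsto_partialSum_of_le_mul {κ : ℝ} (hκ : 0 < κ) (ha : ∀ n, 1 ≤ n → 0 < a n)
    (h : ∀ᶠ n : ℕ in atTop, κ ≤ n * a n) : Tendsto (partialSum a) atTop atTop := by
  have hdiv : ¬ Summable fun i : ℕ => a (i + 1) := by
    intro hs
    have hs' : Summable a := (summable_nat_add_iff 1).1 hs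
    have : Summable fun n : ℕ => κ * (n : ℝ)⁻¹ := by
      refine Summable.of_norm_bounded_eventually_nat hs' ?_
      filter_upwards [h, eventually_ge_atTop 1] with n hn h1
      have hn0 : (0 : ℝ) < n := by positivity
      rw [Real.norm_of_nonneg (by positivity), ← div_eq_mul_inv, div_le_iff₀ hn0, mul_comm (a n)]
      exact hn
    exact Real.not_summable_natCast_inv ((summable_mul_left_iff hκ.ne').1 this)
  have := (not_summable_iff_tendsto_nat_atTop_of_nonneg
    (fun n => (ha (n + 1) (by omega)).le)).1 hdiv
  rwa [funext (partialSum_eq_range a)]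

namespace StepConditions

lemma tendsto_partialSum (h : StepConditions a c m L α τ) (hL : 0 < L) :
    Tendsto (partialSum a) atTop atTop := by
  obtain ⟨l, hl, hlt⟩ := h.lim_na
  have hκ : 0 < 2 * τ / L := by have := h.tau_pos; positivity
  refine tendsto_partialSum_of_le_mul hκ h.a_mem.1 ?_
  filter_upwards [hl.eventually (lt_mem_nhds hlt)] with n hn
  exact (le_max_right _ _).trans (EReal.coe_lt_coe_iff.1 hn).le

lemma tendsto_mul_a (h : StepConditions a c m L α τ) (hA : AveragingConditions a c) (hL : 0 < L) :
    Tendsto (fun n : ℕ => (n : ℝ) * a n) atTop atTop := by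
  have h1 := Real.tendsto_log_atTop.comp (h.tendsto_partialSum hL)
  refine (hA.slow.atTop_mul_atTop₀ h1).congr' ?_
  filter_upwards [h1.eventually_gt_atTop 0] with n hn
  simp only [Function.comp] at hn ⊢
  field_simp

lemma tau_lt_half (h : StepConditions a c m L α τ) : τ < 1 / 2 := by
  have := h.tau_lt; have := h.alpha_le; linarith

/-- The inverse of `√n c_n²` is `√n a_n log s_n / c_n²`, which tends to `0`, divided by `n a_n log
s_n`, which tends to infinity. -/
lemma tendsto_sqrt_mul (h : StepConditions a c m L α τ) (hA : AveragingConditions a c)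
    (hL : 0 < L) : Tendsto (fun n : ℕ => Real.sqrt n * c n ^ 2) atTop atTop := by
  have h1 := Real.tendsto_log_atTop.comp (h.tendsto_partialSum hL)
  have h2 := (h.tendsto_mul_a hA hL).atTop_mul_atTop₀ h1
  have h3 := h.lim_a_log.mul h2.inv_tendsto_atTop
  rw [zero_mul] at h3
  have h4 : Tendsto (fun n : ℕ => (Real.sqrt n * c n ^ 2)⁻¹) atTop (𝓝[>] 0) := by
    refine tendsto_nhdsWithin_iff.2 ⟨h3.congr' ?_, ?_⟩
    · filter_upwards [h1.eventually_gt_atTop 0, eventually_ge_atTop 1] with n hn hn1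
      have h5 := (h.a_mem.pos hn1).ne'
      have h6 := (h.c_mem.pos hn1).ne'
      have h7 : (0 : ℝ) < n := by positivity
      have h8 : Real.sqrt n ≠ 0 := (Real.sqrt_pos.2 h7).ne'
      have h9 : (n : ℝ) = Real.sqrt n ^ 2 := (Real.sq_sqrt h7.le).symm
      simp only [Function.comp, Pi.inv_apply] at hn ⊢
      have h10 := hn.ne'
      nth_rewrite 2 [h9]
      field_simp
    · filter_upwards [eventually_ge_atTop 1] with n hn1
      have h6 := h.c_mem.pos hn1
      have h7 : (0 : ℝ) < n := by positivity
      have h8 := Real.sqrt_pos.2 h7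
      have h9 : (0 : ℝ) < (Real.sqrt n * c n ^ 2)⁻¹ := by positivity
      exact h9
  exact (tendsto_inv_nhdsGT_zero.comp h4).congr fun n => by simp

/-- The sequence `√n c_n²` has index `1/2 - 2τ`, and it would tend to `0` if this were negative. -/
lemma tau_le (h : StepConditions a c m L α τ) (hA : AveragingConditions a c)
    (hL : 0 < L) : τ ≤ 1 / 4 := by
  by_contra! hlt
  have h1 := ((GS.rpow_nat (1 / 2)).mul (h.c_mem.pow 2)).tendsto_zero
    (by push_cast; linarith)
  have h2 := h.tendsto_sqrt_mul hA hL
  refine not_tendsto_nhds_of_tendsto_atTop h2 0 (h1.congr fun n => ?_)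
  rw [Real.sqrt_eq_rpow]

end StepConditions

lemma sqrt_errRate_le {n : ℕ} (ha : 0 < a n) (hc : 0 < c n) :
    Real.sqrt (errRate a c n) ≤ Real.sqrt (a n) / c n + c n ^ 2 := by
  have h1 := Real.sq_sqrt ha.le
  have h2 := Real.sqrt_nonneg (a n)
  rw [Real.sqrt_le_iff]
  refine ⟨by positivity, ?_⟩
  unfold errRate
  have h3 : a n / c n ^ 2 = (Real.sqrt (a n) / c n) ^ 2 := by rw [div_pow, h1]
  have : 0 ≤ Real.sqrt (a n) / c n * c n ^ 2 := by positivity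
  rw [h3]
  nlinarith

lemma GS.isBigO_sub {r : ℝ} {v : ℕ → ℝ} (h : GS r v) :
    (fun n => v n - v (n - 1)) =O[atTop] fun n : ℕ => v n / n := by
  have h1 := (h.2.isBigO_one ℝ).mul (Asymptotics.isBigO_refl (fun n : ℕ => v n / n) atTop)
  refine h1.congr' ?_ (by simp)
  filter_upwards [eventually_ge_atTop 1] with n hn
  have h2 := (h.pos hn).ne'
  have h3 : (n : ℝ) ≠ 0 := by positivity
  field_simp

lemma GS.isBigO_succ {r : ℝ} {v : ℕ → ℝ} (h : GS r v) : (fun n => v (n + 1)) =O[atTop] v := by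
  have h1 := ((h.tendsto_ratio.inv₀ one_ne_zero).comp (tendsto_add_atTop_nat 1)).isBigO_one ℝ
  refine (h1.mul (Asymptotics.isBigO_refl v atTop)).congr' ?_ (by simp)
  filter_upwards [eventually_ge_atTop 1] with n hn
  have h2 := (h.pos hn).ne'
  simp [h2]

/-- A sequence of class `𝒢𝒮` eventually loses at most the factor `1 - l a_n` at step `n`, if
`n a_n → ∞`. -/
lemma GS.eventually_le_succ {r : ℝ} {v : ℕ → ℝ} (h : GS r v) {a : ℕ → ℝ}
    (ha : Tendsto (fun n : ℕ => (n : ℝ) * a n) atTop atTop) {l : ℝ} (hl : 0 < l) :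
    ∀ᶠ n in atTop, (1 - l * a n) * v n ≤ v (n + 1) := by
  have h1 := (h.2.comp (tendsto_add_atTop_nat 1)).eventually (lt_mem_nhds (sub_one_lt r))
  -- The ratio `x = v_n / v_{n+1}` exceeds `1` by at most `|r - 1|/(n + 1)`, and `l a_n` outweighs
  -- this as soon as `n a_n` is large.
  filter_upwards [h1, ha.eventually_ge_atTop (2 * |r - 1| / l), eventually_ge_atTop 1]
    with n hn hna hn1
  have hv := h.pos hn1
  have hv' := h.pos (n := n + 1) (by omega)
  have hn0 : (1 : ℝ) ≤ n := by exact_mod_cast hn1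
  simp only [Function.comp, Nat.add_sub_cancel] at hn
  push_cast at hn
  set x := v n / v (n + 1) with hx
  have hxv : v n = x * v (n + 1) := by rw [hx]; field_simp
  have hx0 : 0 < x := by positivity
  rw [div_le_iff₀ hl] at hna
  have hr := neg_abs_le (r - 1)
  have hr0 := abs_nonneg (r - 1)
  have e1 : (n + 1) * x ≤ (n + 1) + |r - 1| := by nlinarith
  have e2 : l * a n * (n + 1) ≥ |r - 1| := by nlinarith
  rw [hxv, ← mul_assoc]
  refine mul_le_of_le_one_left hv'.le ?_
  rcases le_or_gt (1 - l * a n) 0 with h0 | h0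
  · nlinarith
  · have e3 : (1 - l * a n) * ((n + 1) * x) ≤ (1 - l * a n) * ((n + 1) + |r - 1|) :=
      mul_le_mul_of_nonneg_left e1 h0.le
    have e4 : (1 - l * a n) * ((n + 1) + |r - 1|) ≤ n + 1 := by
      have : 0 ≤ l * a n := by
        by_contra! hneg
        nlinarith
      nlinarith
    have hn1' : (0 : ℝ) < n + 1 := by positivity
    have : (n + 1) * ((1 - l * a n) * x) ≤ (n + 1) * 1 := by linarith
    exact le_of_mul_le_mul_left this hn1'

end

/-! ### Comparison of the orders of magnitude of the error terms. -/

section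

variable {a c : ℕ → ℝ} {m L α τ : ℝ}

lemma rpow_neg_half_eq (n : ℕ) : (n : ℝ) ^ (-(1 / 2) : ℝ) = (Real.sqrt n)⁻¹ := by
  rw [Real.rpow_neg (by positivity), Real.sqrt_eq_rpow]

lemma isLittleO_of_tendsto_mul {u : ℕ → ℝ} {s : ℝ}
    (h : Tendsto (fun n : ℕ => (n : ℝ) ^ s * u n) atTop (𝓝 0)) :
    u =o[atTop] fun n : ℕ => (n : ℝ) ^ (-s) := by
  refine (Asymptotics.isLittleO_iff_tendsto' ?_).2 (h.congr' ?_)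
  · filter_upwards [eventually_ge_atTop 1] with n hn h0
    have : (0 : ℝ) < n := by positivity
    exact absurd h0 (by positivity)
  · filter_upwards [eventually_ge_atTop 1] with n hn
    have : (0 : ℝ) < n := by positivity
    rw [Real.rpow_neg this.le]
    field_simp

lemma isLittleO_mul_of_tendsto_zero {u v : ℕ → ℝ} (h : Tendsto u atTop (𝓝 0)) :
    (fun n => u n * v n) =o[atTop] v := by
  have := (Asymptotics.isLittleO_one_iff ℝ |>.2 h).mul_isBigO (Asymptotics.isBigO_refl v atTop)
  simpa using this

namespace StepConditions

lemma weightSum_atTop (h : StepConditions a c m L α τ) : Tendsto (weightSum c) atTop atTop :=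
  (h.c_mem.pow 2).tendsto_partialSum_atTop (by push_cast; linarith [h.tau_lt_half])

lemma weightSum_equiv (h : StepConditions a c m L α τ) :
    Tendsto (fun n : ℕ => (n : ℝ) * c n ^ 2 / weightSum c n) atTop (𝓝 (1 - 2 * τ)) := by
  have := (h.c_mem.pow 2).tendsto_mul_div_partialSum (by push_cast; linarith [h.tau_lt_half])
  have e : 1 - 2 * τ = ((2 : ℕ) : ℝ) * -τ + 1 := by push_cast; ring
  rw [e]
  exact this

lemma c_zero (h : StepConditions a c m L α τ) : Tendsto c atTop (𝓝 0) :=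
  h.c_mem.tendsto_zero (by linarith [h.tau_pos])

lemma a_zero (h : StepConditions a c m L α τ) : Tendsto a atTop (𝓝 0) :=
  h.a_mem.tendsto_zero (by have := le_max_left (1 / 2) (2 / m); linarith [h.alpha_gt])

/-- The two terms come from different conditions: `√n a_n / c_n² → 0` since even its product with
`log s_n → ∞` vanishes, and `√n c_n⁴` is the square root of `n c_n⁸`. -/
lemma errRate_isLittleO (h : StepConditions a c m L α τ) (hL : 0 < L) :
    errRate a c =o[atTop] fun n : ℕ => (n : ℝ) ^ (-(1 / 2) : ℝ) := by
  refine isLittleO_of_tendsto_mul ?_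
  have h1 := Real.tendsto_log_atTop.comp (h.tendsto_partialSum hL)
  have h2 := h.lim_a_log.mul h1.inv_tendsto_atTop
  have h3 := (Real.continuous_sqrt.tendsto 0).comp h.lim_c_eight
  rw [Real.sqrt_zero] at h3
  have h4 := h2.add h3
  rw [zero_mul, zero_add] at h4
  refine h4.congr' ?_
  filter_upwards [h1.eventually_gt_atTop 0, eventually_ge_atTop 1] with n hn hn1
  have h5 := h.c_mem.pos hn1
  have h6 : (0 : ℝ) < n := by positivity
  simp only [Function.comp, Pi.inv_apply] at hn ⊢
  have h10 := hn.ne'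
  have h7 : Real.sqrt (n * c n ^ 8) = Real.sqrt n * c n ^ 4 := by
    rw [Real.sqrt_mul h6.le, show c n ^ 8 = (c n ^ 4) ^ 2 by ring, Real.sqrt_sq (by positivity)]
  rw [h7, ← Real.sqrt_eq_rpow]
  unfold errRate
  field_simp

/-- By `√(errRate) ≤ √a_n / c_n + c_n²`, the two terms of `driftRate` appear with the factors `(n
a_n)^{-1/2}` and `(n a_n)⁻¹`, both of which vanish. -/
lemma drift_isLittleO (h : StepConditions a c m L α τ) (hA : AveragingConditions a c)
    (hL : 0 < L) :
    (fun n : ℕ => c n ^ 2 / a n / n * Real.sqrt (errRate a c n)) =o[atTop] driftRate c := by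
  have h1 := (h.tendsto_mul_a hA hL).inv_tendsto_atTop
  have h2 := (Real.continuous_sqrt.tendsto 0).comp h1
  rw [Real.sqrt_zero] at h2
  have h3 := h2.add h1
  rw [zero_add] at h3
  refine Asymptotics.IsBigO.trans_isLittleO ?_ (isLittleO_mul_of_tendsto_zero h3 (v := driftRate c))
  refine Asymptotics.IsBigO.of_bound 1 ?_
  filter_upwards [eventually_ge_atTop 1] with n hn1
  have hc := h.c_mem.pos hn1
  have ha := h.a_mem.pos hn1
  have hn : (0 : ℝ) < n := by positivity
  have hsa := Real.sqrt_pos.2 ha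
  have hsn := Real.sqrt_pos.2 hn
  have hg := driftRate_pos hn1 hc
  simp only [Function.comp, Pi.inv_apply]
  rw [Real.norm_of_nonneg (by positivity), Real.norm_of_nonneg (by positivity), one_mul]
  calc c n ^ 2 / a n / n * Real.sqrt (errRate a c n)
      ≤ c n ^ 2 / a n / n * (Real.sqrt (a n) / c n + c n ^ 2) := by
        gcongr; exact sqrt_errRate_le ha hc
    _ = (Real.sqrt (n * a n))⁻¹ * (c n * (n : ℝ) ^ (-(1 / 2) : ℝ)) + (n * a n)⁻¹ * c n ^ 4 := by
        rw [rpow_neg_half_eq, Real.sqrt_mul hn.le]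
        have e1 : a n = Real.sqrt (a n) ^ 2 := (Real.sq_sqrt ha.le).symm
        have e2 : (n : ℝ) = Real.sqrt n ^ 2 := (Real.sq_sqrt hn.le).symm
        set x := Real.sqrt (a n)
        set y := Real.sqrt (n : ℝ)
        rw [e1, e2]
        field_simp
    _ ≤ (Real.sqrt (n * a n))⁻¹ * driftRate c n + (n * a n)⁻¹ * driftRate c n := by
        unfold driftRate
        gcongr
        · have : 0 < c n ^ 4 := by positivity
          linarith
        · have : 0 < c n * (n : ℝ) ^ (-(1 / 2) : ℝ) := by positivity
          linarith
    _ = _ := by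
        rw [Real.sqrt_inv]; ring

lemma c_mul_rpow_mem (h : StepConditions a c m L α τ) :
    GS (-τ + -(1 / 2)) fun n : ℕ => c n * (n : ℝ) ^ (-(1 / 2) : ℝ) :=
  h.c_mem.mul (GS.rpow_nat _)

lemma driftRate_nonneg (h : StepConditions a c m L α τ) (n : ℕ) (hn : 1 ≤ n) :
    0 ≤ driftRate c n := (driftRate_pos hn (h.c_mem.pos hn)).le

lemma driftSum_eq (c : ℕ → ℝ) (n : ℕ) : partialSum (driftRate c) n =
    partialSum (fun n : ℕ => c n * (n : ℝ) ^ (-(1 / 2) : ℝ)) n + partialSum (fun n => c n ^ 4) n :=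
  partialSum_add _ _ n

lemma le_driftSum_left (h : StepConditions a c m L α τ) (n : ℕ) :
    partialSum (fun n : ℕ => c n * (n : ℝ) ^ (-(1 / 2) : ℝ)) n ≤ partialSum (driftRate c) n := by
  rw [driftSum_eq]
  have := partialSum_nonneg (fun n hn => ((h.c_mem.pow 4).pos hn).le) n
  linarith

lemma le_driftSum_right (h : StepConditions a c m L α τ) (n : ℕ) :
    partialSum (fun n => c n ^ 4) n ≤ partialSum (driftRate c) n := by
  rw [driftSum_eq]
  have := partialSum_nonneg (fun n hn => (h.c_mul_rpow_mem.pos hn).le) n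
  linarith

lemma driftSum_atTop (h : StepConditions a c m L α τ) :
    Tendsto (partialSum (driftRate c)) atTop atTop :=
  tendsto_atTop_mono h.le_driftSum_left
    (h.c_mul_rpow_mem.tendsto_partialSum_atTop (by linarith [h.tau_lt_half]))

lemma left_isBigO (h : StepConditions a c m L α τ) :
    partialSum (fun n : ℕ => c n * (n : ℝ) ^ (-(1 / 2) : ℝ)) =O[atTop] partialSum (driftRate c) :=
  Asymptotics.IsBigO.of_bound 1 (Eventually.of_forall fun n => by
    rw [Real.norm_of_nonneg (partialSum_nonneg (fun n hn => (h.c_mul_rpow_mem.pos hn).le) n),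
      Real.norm_of_nonneg (partialSum_nonneg h.driftRate_nonneg n), one_mul]
    exact h.le_driftSum_left n)

lemma right_isBigO (h : StepConditions a c m L α τ) :
    partialSum (fun n => c n ^ 4) =O[atTop] partialSum (driftRate c) :=
  Asymptotics.IsBigO.of_bound 1 (Eventually.of_forall fun n => by
    rw [Real.norm_of_nonneg (partialSum_nonneg (fun n hn => ((h.c_mem.pow 4).pos hn).le) n),
      Real.norm_of_nonneg (partialSum_nonneg h.driftRate_nonneg n), one_mul]
    exact h.le_driftSum_right n)

lemma mul_driftRate (h : StepConditions a c m L α τ) :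
    (fun n : ℕ => n * driftRate c n) =O[atTop] partialSum (driftRate c) := by
  have h1 := h.c_mul_rpow_mem.mul_isBigO_partialSum.trans h.left_isBigO
  have h2 := (h.c_mem.pow 4).mul_isBigO_partialSum.trans h.right_isBigO
  refine (h1.add h2).congr_left fun n => ?_
  unfold driftRate; ring

/-- Karamata's theorem makes `√S_n` comparable with `√n c_n = n · c_n n^{-1/2}`, which is dominated
by the partial sums of `c_k k^{-1/2}`. So `driftRate` accounts for the standard deviation of the
noise sum. -/
lemma sqrt_weightSum (h : StepConditions a c m L α τ) :
    (fun n => Real.sqrt (weightSum c n)) =O[atTop] partialSum (driftRate c) := by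
  refine Asymptotics.IsBigO.trans ?_ (h.c_mul_rpow_mem.mul_isBigO_partialSum.trans h.left_isBigO)
  have hτ := h.tau_lt_half
  have h0 : 0 < (1 - 2 * τ) / 2 := by linarith
  have h1 := h.weightSum_equiv.eventually (lt_mem_nhds (show (1 - 2 * τ) / 2 < 1 - 2 * τ by linarith))
  refine Asymptotics.IsBigO.of_bound (Real.sqrt ((1 - 2 * τ) / 2)⁻¹) ?_
  filter_upwards [h1, eventually_ge_atTop 1] with n hn hn1
  have hc := h.c_mem.pos hn1
  have hnp : (0 : ℝ) < n := by positivity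
  have hS : 0 < weightSum c n := partialSum_pos (fun k hk => (h.c_mem.pow 2).pos hk) hn1
  rw [lt_div_iff₀ hS] at hn
  rw [Real.norm_of_nonneg (Real.sqrt_nonneg _), Real.norm_of_nonneg (by positivity),
    rpow_neg_half_eq]
  have e : (n : ℝ) * (c n * (Real.sqrt n)⁻¹) = Real.sqrt (n * c n ^ 2) := by
    have e2 : (n : ℝ) = Real.sqrt n ^ 2 := (Real.sq_sqrt hnp.le).symm
    have := Real.sqrt_pos.2 hnp
    rw [Real.sqrt_mul hnp.le, Real.sqrt_sq hc.le]
    nth_rewrite 1 [e2]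
    field_simp
  rw [e, ← Real.sqrt_mul (by positivity)]
  refine Real.sqrt_le_sqrt ?_
  rw [inv_mul_eq_div, le_div_iff₀ h0]
  linarith

/-- The summand is `a_n + c_n⁶`. The sum of the `a_k` is `o(√S_n)` because `log s_k ≥ 1` eventually
in `AveragingConditions.sum_small`; and `c_n⁶ = c_n² c_n⁴` is `o(c_n⁴)`. -/
lemma quad_isLittleO (h : StepConditions a c m L α τ) (hA : AveragingConditions a c)
    (hL : 0 < L) :
    partialSum (fun n => c n ^ 2 * errRate a c n) =o[atTop] partialSum (driftRate c) := by
  have e : ∀ n, 1 ≤ n → c n ^ 2 * errRate a c n = a n + c n ^ 2 * c n ^ 4 := fun n hn => by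
    have := (h.c_mem.pos hn).ne'
    unfold errRate; field_simp
  have e' : partialSum (fun n => c n ^ 2 * errRate a c n)
      = fun n => partialSum a n + partialSum (fun n => c n ^ 2 * c n ^ 4) n := by
    ext n
    rw [← partialSum_add]
    exact Finset.sum_congr rfl fun k hk => e k (Finset.mem_Icc.1 hk).1
  rw [e']
  refine Asymptotics.IsLittleO.add ?_ ?_
  · refine Asymptotics.IsLittleO.trans_isBigO ?_ h.sqrt_weightSum
    have hlog := Real.tendsto_log_atTop.comp (h.tendsto_partialSum hL)
    obtain ⟨N, hN⟩ := eventually_atTop.1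
      ((hlog.eventually_ge_atTop 1).and (eventually_ge_atTop 1))
    set T : ℕ → ℝ := partialSum fun k => a k * Real.log (partialSum a k) with hT
    have hle : ∀ n, N ≤ n → partialSum a n ≤ T n + (partialSum a N - T N) := by
      intro n hn
      induction n, hn using Nat.le_induction with
      | base => linarith
      | succ n hn ih =>
        rw [hT, partialSum_succ, partialSum_succ, ← hT]
        have h1 := (hN (n + 1) (by omega)).1
        simp only [Function.comp] at h1
        have h2 := h.a_mem.pos (n := n + 1) (by omega)
        nlinarith
    have hTo : T =o[atTop] fun n => Real.sqrt (weightSum c n) := by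
      refine (Asymptotics.isLittleO_iff_tendsto' ?_).2 hA.sum_small
      filter_upwards [h.weightSum_atTop.eventually_gt_atTop 0] with n hn h0
      exact absurd h0 (Real.sqrt_pos.2 hn).ne'
    have hco : (fun _ : ℕ => partialSum a N - T N) =o[atTop]
        fun n => Real.sqrt (weightSum c n) := by
      refine Asymptotics.isLittleO_const_left.2 (Or.inr ?_)
      refine tendsto_norm_atTop_atTop.comp (Real.tendsto_sqrt_atTop.comp h.weightSum_atTop)
    refine Asymptotics.IsBigO.trans_isLittleO ?_ (hTo.add hco)
    refine Asymptotics.IsBigO.of_bound 1 ?_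
    filter_upwards [eventually_ge_atTop N] with n hn
    have h0 := partialSum_nonneg (fun k hk => (h.a_mem.pos hk).le) n
    have := hle n hn
    rw [Real.norm_of_nonneg h0, Real.norm_of_nonneg (h0.trans this), one_mul]
    exact this
  · refine isLittleO_partialSum ?_ h.driftRate_nonneg h.driftSum_atTop
    have h1 : Tendsto (fun n => c n ^ 2) atTop (𝓝 0) := by simpa using h.c_zero.pow 2
    refine (isLittleO_mul_of_tendsto_zero h1 (v := fun n => c n ^ 4)).trans_isBigO ?_
    refine Asymptotics.IsBigO.of_bound 1 ?_
    filter_upwards [eventually_ge_atTop 1] with n hn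
    have hg := driftRate_pos hn (h.c_mem.pos hn)
    have hc := h.c_mem.pos hn
    rw [Real.norm_of_nonneg (by positivity), Real.norm_of_nonneg hg.le, one_mul]
    have := h.c_mul_rpow_mem.pos hn
    unfold driftRate
    linarith

lemma isBigO_weightSum (h : StepConditions a c m L α τ) :
    (fun n : ℕ => (n : ℝ) * c n ^ 2) =O[atTop] weightSum c :=
  (h.c_mem.pow 2).mul_isBigO_partialSum

lemma inv_weightSum_isBigO (h : StepConditions a c m L α τ) :
    (fun n => (weightSum c n)⁻¹) =O[atTop] fun n : ℕ => ((n : ℝ) * c n ^ 2)⁻¹ := by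
  refine h.isBigO_weightSum.inv_rev ?_
  filter_upwards [eventually_ge_atTop 1] with n hn h0
  have := h.c_mem.pos hn
  have hn0 : (0 : ℝ) < n := by positivity
  exact absurd h0 (by positivity)

lemma inv_weightSum (h : StepConditions a c m L α τ) (hA : AveragingConditions a c) (hL : 0 < L) :
    (fun n => (weightSum c n)⁻¹) =o[atTop] fun n : ℕ => (n : ℝ) ^ (-(1 / 2) : ℝ) := by
  refine h.inv_weightSum_isBigO.trans_isLittleO (isLittleO_of_tendsto_mul ?_)
  refine (h.tendsto_sqrt_mul hA hL).inv_tendsto_atTop.congr' ?_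
  filter_upwards [eventually_ge_atTop 1] with n hn
  have := h.c_mem.pos hn
  have hn0 : (0 : ℝ) < n := by positivity
  have e2 : (n : ℝ) = Real.sqrt n ^ 2 := (Real.sq_sqrt hn0.le).symm
  have := Real.sqrt_pos.2 hn0
  rw [← Real.sqrt_eq_rpow, Pi.inv_apply]
  nth_rewrite 3 [e2]
  field_simp

/-- For the part `c_k k^{-1/2}` the quotient is of order `1/(√n c_n)`, and `n^{1/4}` times this is
the square root of `1/(√n c_n²) → 0`. -/
lemma driftSum_div (h : StepConditions a c m L α τ) (hA : AveragingConditions a c) (hL : 0 < L) :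
    (fun n : ℕ => partialSum (driftRate c) n / weightSum c n)
      =o[atTop] fun n : ℕ => (n : ℝ) ^ (-(1 / 4) : ℝ) := by
  have hτ := h.tau_le hA hL
  have e : (fun n : ℕ => partialSum (driftRate c) n / weightSum c n) = fun n =>
      partialSum (fun n : ℕ => c n * (n : ℝ) ^ (-(1 / 2) : ℝ)) n * (weightSum c n)⁻¹
        + partialSum (fun n => c n ^ 4) n * (weightSum c n)⁻¹ := by
    ext n; rw [driftSum_eq]; ring
  rw [e]
  refine Asymptotics.IsLittleO.add ?_ ?_
  · have h1 : partialSum (fun n : ℕ => c n * (n : ℝ) ^ (-(1 / 2) : ℝ)) =O[atTop]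
        fun n : ℕ => (n : ℝ) * (c n * (n : ℝ) ^ (-(1 / 2) : ℝ)) := by
      have h2 := (h.c_mul_rpow_mem.tendsto_mul_div_partialSum (by linarith)).inv₀
        (by linarith)
      have h3 := (h2.isBigO_one ℝ).mul (Asymptotics.isBigO_refl
        (fun n : ℕ => (n : ℝ) * (c n * (n : ℝ) ^ (-(1 / 2) : ℝ))) atTop)
      refine h3.congr' ?_ (by simp)
      filter_upwards [eventually_ge_atTop 1] with n hn
      have := h.c_mul_rpow_mem.pos hn
      have hn0 : (0 : ℝ) < n := by positivity
      rw [inv_div, div_mul_cancel₀]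
      positivity
    refine (h1.mul h.inv_weightSum_isBigO).trans_isLittleO (isLittleO_of_tendsto_mul ?_)
    have h5 := (Real.continuous_sqrt.tendsto 0).comp (h.tendsto_sqrt_mul hA hL).inv_tendsto_atTop
    rw [Real.sqrt_zero] at h5
    refine h5.congr' ?_
    filter_upwards [eventually_ge_atTop 1] with n hn
    have hc := h.c_mem.pos hn
    have hn0 : (0 : ℝ) < n := by positivity
    have hq : (0 : ℝ) < (n : ℝ) ^ (1 / 4 : ℝ) := by positivity
    have e1 : Real.sqrt n = ((n : ℝ) ^ (1 / 4 : ℝ)) ^ 2 := by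
      rw [Real.sqrt_eq_rpow, ← Real.rpow_natCast, ← Real.rpow_mul hn0.le]; norm_num
    have e2 : (n : ℝ) = ((n : ℝ) ^ (1 / 4 : ℝ)) ^ 4 := by
      rw [← Real.rpow_natCast, ← Real.rpow_mul hn0.le]; norm_num
    simp only [Function.comp, Pi.inv_apply]
    rw [Real.sqrt_inv, rpow_neg_half_eq, e1]
    set x := (n : ℝ) ^ (1 / 4 : ℝ)
    rw [← mul_pow, Real.sqrt_sq (by positivity), e2]
    field_simp
  · have hmem : GS (2 * -τ + -(1 / 4)) fun n : ℕ => c n ^ 2 * (n : ℝ) ^ (-(1 / 4) : ℝ) := by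
      have := (h.c_mem.pow 2).mul (GS.rpow_nat (-(1 / 4)))
      push_cast at this
      exact this
    have h1 : (fun n => c n ^ 4) =o[atTop] fun n : ℕ => c n ^ 2 * (n : ℝ) ^ (-(1 / 4) : ℝ) := by
      have h2 : (fun n => c n ^ 2) =o[atTop] fun n : ℕ => (n : ℝ) ^ (-(1 / 4) : ℝ) := by
        refine isLittleO_of_tendsto_mul ?_
        have h3 := (Real.continuous_sqrt.tendsto 0).comp h.lim_c_eight
        rw [Real.sqrt_zero] at h3
        replace h3 := (Real.continuous_sqrt.tendsto 0).comp h3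
        rw [Real.sqrt_zero] at h3
        refine h3.congr' ?_
        filter_upwards [eventually_ge_atTop 1] with n hn
        have hc := h.c_mem.pos hn
        have hn0 : (0 : ℝ) < n := by positivity
        have e2 : (n : ℝ) = ((n : ℝ) ^ (1 / 4 : ℝ)) ^ 4 := by
          rw [← Real.rpow_natCast, ← Real.rpow_mul hn0.le]; norm_num
        simp only [Function.comp]
        have hx : (0 : ℝ) < (n : ℝ) ^ (1 / 4 : ℝ) := by positivity
        set x := (n : ℝ) ^ (1 / 4 : ℝ)
        rw [e2, show x ^ 4 * c n ^ 8 = ((x * c n ^ 2) ^ 2) ^ 2 by ring,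
          Real.sqrt_sq (by positivity), Real.sqrt_sq (by positivity)]
      refine ((Asymptotics.isBigO_refl (fun n => c n ^ 2) atTop).mul_isLittleO h2).congr_left ?_
      intro n; ring
    have h2 := isLittleO_partialSum h1 (fun n hn => (hmem.pos hn).le)
      (hmem.tendsto_partialSum_atTop (by linarith))
    have h3 : partialSum (fun n : ℕ => c n ^ 2 * (n : ℝ) ^ (-(1 / 4) : ℝ)) =O[atTop]
        fun n : ℕ => (n : ℝ) * (c n ^ 2 * (n : ℝ) ^ (-(1 / 4) : ℝ)) := by
      have h2 := (hmem.tendsto_mul_div_partialSum (by linarith)).inv₀ (by linarith)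
      have h3 := (h2.isBigO_one ℝ).mul (Asymptotics.isBigO_refl
        (fun n : ℕ => (n : ℝ) * (c n ^ 2 * (n : ℝ) ^ (-(1 / 4) : ℝ))) atTop)
      refine h3.congr' ?_ (by simp)
      filter_upwards [eventually_ge_atTop 1] with n hn
      have := hmem.pos hn
      have hn0 : (0 : ℝ) < n := by positivity
      rw [inv_div, div_mul_cancel₀]
      positivity
    refine ((h2.trans_isBigO h3).mul_isBigO h.inv_weightSum_isBigO).congr' (by simp) ?_
    filter_upwards [eventually_ge_atTop 1] with n hn
    have hc := h.c_mem.pos hn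
    have hn0 : (0 : ℝ) < n := by positivity
    field_simp

end StepConditions

end

/-! ### The estimate for smoothed quadratic errors, and the collection of all rates. -/

section

variable {a c : ℕ → ℝ} {m L α τ : ℝ}

lemma summable_rpow_succ {ε : ℝ} (hε : 0 < ε) (s : Finset ℕ) :
    ∑ k ∈ s, (k : ℝ) ^ (-1 - ε) ≤ ∑' k : ℕ, (k : ℝ) ^ (-1 - ε) :=
  (Real.summable_nat_rpow.2 (by linarith)).sum_le_tsum s fun k _ => by positivity

/-- The bound of `S_k⁻²` is split as `k^{3ε} · k^{1-2q} · k^{-1-ε}`: the first factor is at most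
`n^{4ε}`, the second at most `j^{1-2q}` since `q ≥ 1/2`, and the third is summable. -/
lemma sqrt_sum_inv_sq_le {S : ℕ → ℝ} {q ε κ : ℝ} (hq : 1 / 2 ≤ q) (hε : 0 < ε) (hκ : 0 < κ)
    (hS : ∀ n : ℕ, 1 ≤ n → κ * (n : ℝ) ^ (q - ε) ≤ S n) :
    ∃ K, 0 < K ∧ ∀ j n : ℕ, 1 ≤ j → j ≤ n →
      Real.sqrt (∑ k ∈ Finset.Icc j n, (S k ^ 2)⁻¹)
        ≤ K * (n : ℝ) ^ (2 * ε) * (j : ℝ) ^ (1 / 2 - q) := by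
  set Z := ∑' k : ℕ, (k : ℝ) ^ (-1 - ε)
  have hZ : 0 ≤ Z := tsum_nonneg fun k => by positivity
  refine ⟨Real.sqrt (Z + 1) / κ, by positivity, fun j n hj hjn => ?_⟩
  have hj0 : (0 : ℝ) < j := by positivity
  have hn0 : (0 : ℝ) < n := by
    have : 1 ≤ n := hj.trans hjn
    positivity
  rw [Real.sqrt_le_iff]
  refine ⟨by positivity, ?_⟩
  have hterm : ∀ k ∈ Finset.Icc j n, (S k ^ 2)⁻¹
      ≤ (κ ^ 2)⁻¹ * ((n : ℝ) ^ (4 * ε) * (j : ℝ) ^ (1 - 2 * q)) * (k : ℝ) ^ (-1 - ε) := by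
    intro k hk
    obtain ⟨h1, h2⟩ := Finset.mem_Icc.1 hk
    have hk0 : (0 : ℝ) < k := by
      have : 1 ≤ k := hj.trans h1
      positivity
    have h3 := hS k (hj.trans h1)
    have h4 : (S k ^ 2)⁻¹ ≤ ((κ * (k : ℝ) ^ (q - ε)) ^ 2)⁻¹ := by gcongr
    have h5 : ((κ * (k : ℝ) ^ (q - ε)) ^ 2)⁻¹
        = (κ ^ 2)⁻¹ * ((k : ℝ) ^ (3 * ε) * (k : ℝ) ^ (1 - 2 * q)) * (k : ℝ) ^ (-1 - ε) := by
      rw [mul_pow, mul_inv, mul_assoc, ← Real.rpow_add hk0, ← Real.rpow_add hk0,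
        ← Real.rpow_natCast (_ ^ (q - ε)), ← Real.rpow_mul hk0.le, ← Real.rpow_neg hk0.le]
      congr 2
      push_cast; ring
    have h6 : (k : ℝ) ^ (1 - 2 * q) ≤ (j : ℝ) ^ (1 - 2 * q) :=
      Real.rpow_le_rpow_of_nonpos hj0 (by exact_mod_cast h1) (by linarith)
    have h7 : (k : ℝ) ^ (3 * ε) ≤ (n : ℝ) ^ (4 * ε) := by
      have hk1 : (1 : ℝ) ≤ k := by exact_mod_cast hj.trans h1
      calc (k : ℝ) ^ (3 * ε) ≤ (k : ℝ) ^ (4 * ε) :=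
            Real.rpow_le_rpow_of_exponent_le hk1 (by linarith)
        _ ≤ _ := Real.rpow_le_rpow hk0.le (by exact_mod_cast h2) (by linarith)
    rw [h5] at h4
    refine h4.trans ?_
    gcongr
  refine (Finset.sum_le_sum hterm).trans ?_
  rw [← Finset.mul_sum]
  have h8 := summable_rpow_succ hε (Finset.Icc j n)
  have e : (Real.sqrt (Z + 1) / κ * (n : ℝ) ^ (2 * ε) * (j : ℝ) ^ (1 / 2 - q)) ^ 2
      = (κ ^ 2)⁻¹ * ((n : ℝ) ^ (4 * ε) * (j : ℝ) ^ (1 - 2 * q)) * (Z + 1) := by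
    rw [mul_pow, mul_pow, div_pow, Real.sq_sqrt (by positivity), ← Real.rpow_natCast (_ ^ (2 * ε)),
      ← Real.rpow_natCast (_ ^ (1 / 2 - q)), ← Real.rpow_mul hn0.le, ← Real.rpow_mul hj0.le,
      show 2 * ε * ((2 : ℕ) : ℝ) = 4 * ε by push_cast; ring,
      show (1 / 2 - q) * ((2 : ℕ) : ℝ) = 1 - 2 * q by push_cast; ring]
    ring
  rw [e]
  gcongr
  linarith

namespace StepConditions

/-- Up to powers with exponent `ε`, the `j`-th term is `j^{-2τ} · j^{-1/2} · j^{1/2-(1-2τ)} = j⁻¹`.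
The sum thus grows more slowly than `n^{1/4}`. -/
lemma smoothing (h : StepConditions a c m L α τ) (hA : AveragingConditions a c) (hL : 0 < L) :
    Tendsto (fun n : ℕ => (n : ℝ) ^ (-(1 / 4) : ℝ) * ∑ j ∈ Finset.Icc 1 n,
      c j ^ 2 * errRate a c j * Real.sqrt (∑ k ∈ Finset.Icc j n, (weightSum c k ^ 2)⁻¹))
      atTop (𝓝 0) := by
  -- The losses add up to `n^{4ε}`; any `ε < 1/16` would do, and `ε = 1/20` leaves the factor
  -- `n^{-1/20}`.
  have hτ := h.tau_le hA hL
  set ε : ℝ := 1 / 20 with hε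
  have hS0 : ∀ n, 1 ≤ n → 0 < weightSum c n := fun n hn =>
    partialSum_pos (fun k hk => (h.c_mem.pow 2).pos hk) hn
  -- lower bound of the sums of the weights
  have hlow : (fun n : ℕ => (n : ℝ) ^ (1 - 2 * τ - ε)) =O[atTop] weightSum c := by
    have h1 : GS (1 + 2 * -τ) fun n : ℕ => (n : ℝ) * c n ^ 2 := by
      have := GS.nat.mul (h.c_mem.pow 2)
      push_cast at this; exact this
    exact (h1.rpow_isLittleO (by norm_num [hε]; linarith)).isBigO.trans h.isBigO_weightSum
  obtain ⟨C₁, hC₁, hlow⟩ := exists_forall_le_of_isBigO hlow hS0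
  obtain ⟨K, hK, hφ⟩ := sqrt_sum_inv_sq_le (S := weightSum c) (q := 1 - 2 * τ) (ε := ε)
    (κ := C₁⁻¹) (by linarith) (by norm_num [hε]) (by positivity) fun n hn => by
      have := hlow n hn
      rw [abs_of_nonneg (by positivity)] at this
      rwa [inv_mul_le_iff₀ hC₁]
  have hc2 : (fun n => c n ^ 2) =O[atTop] fun n : ℕ => (n : ℝ) ^ (-2 * τ + ε) := by
    refine ((h.c_mem.pow 2).isLittleO_rpow ?_).isBigO
    push_cast; norm_num [hε]
  obtain ⟨C₂, hC₂, hcv⟩ := exists_forall_le_of_isBigO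
    (hc2.mul (h.errRate_isLittleO hL).isBigO) fun n hn => by
      have : (0 : ℝ) < n := by positivity
      positivity
  set Z := ∑' k : ℕ, (k : ℝ) ^ (-1 - ε)
  have hbound : ∀ n : ℕ, 1 ≤ n → ∑ j ∈ Finset.Icc 1 n,
      c j ^ 2 * errRate a c j * Real.sqrt (∑ k ∈ Finset.Icc j n, (weightSum c k ^ 2)⁻¹)
      ≤ C₂ * K * Z * (n : ℝ) ^ (4 * ε) := by
    intro n hn
    have hn0 : (0 : ℝ) < n := by positivity
    calc _ ≤ ∑ j ∈ Finset.Icc 1 n, C₂ * K * (n : ℝ) ^ (4 * ε) * (j : ℝ) ^ (-1 - ε) := by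
          refine Finset.sum_le_sum fun j hj => ?_
          obtain ⟨h1, h2⟩ := Finset.mem_Icc.1 hj
          have hj0 : (0 : ℝ) < j := by positivity
          have h3 := (le_abs_self _).trans (hcv j h1)
          have h4 := hφ j n h1 h2
          refine (mul_le_mul h3 h4 (Real.sqrt_nonneg _) (by positivity)).trans ?_
          have h5 : (j : ℝ) ^ (2 * ε) ≤ (n : ℝ) ^ (2 * ε) :=
            Real.rpow_le_rpow hj0.le (by exact_mod_cast h2) (by norm_num [hε])
          have h6 : (j : ℝ) ^ (-2 * τ + ε) * (j : ℝ) ^ (-(1 / 2) : ℝ)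
              * (j : ℝ) ^ (1 / 2 - (1 - 2 * τ)) = (j : ℝ) ^ (2 * ε) * (j : ℝ) ^ (-1 - ε) := by
            rw [← Real.rpow_add hj0, ← Real.rpow_add hj0, ← Real.rpow_add hj0]
            congr 1; ring
          have h7 : (n : ℝ) ^ (4 * ε) = (n : ℝ) ^ (2 * ε) * (n : ℝ) ^ (2 * ε) := by
            rw [← Real.rpow_add hn0]; congr 1; ring
          calc _ = C₂ * K * (n : ℝ) ^ (2 * ε) * ((j : ℝ) ^ (-2 * τ + ε) *
                (j : ℝ) ^ (-(1 / 2) : ℝ) * (j : ℝ) ^ (1 / 2 - (1 - 2 * τ))) := by ring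
            _ = C₂ * K * (n : ℝ) ^ (2 * ε) * ((j : ℝ) ^ (2 * ε) * (j : ℝ) ^ (-1 - ε)) := by
                rw [h6]
            _ ≤ C₂ * K * (n : ℝ) ^ (2 * ε) * ((n : ℝ) ^ (2 * ε) * (j : ℝ) ^ (-1 - ε)) := by
                gcongr
            _ = _ := by rw [h7]; ring
      _ = C₂ * K * (n : ℝ) ^ (4 * ε) * ∑ j ∈ Finset.Icc 1 n, (j : ℝ) ^ (-1 - ε) := by
          rw [Finset.mul_sum]
      _ ≤ C₂ * K * (n : ℝ) ^ (4 * ε) * Z := by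
          gcongr
          exact summable_rpow_succ (by norm_num [hε]) _
      _ = _ := by ring
  have hlim : Tendsto (fun n : ℕ => C₂ * K * Z * (n : ℝ) ^ (-(1 / 20) : ℝ)) atTop (𝓝 0) := by
    have := ((GS.rpow_nat (-(1 / 20))).tendsto_zero (by norm_num)).const_mul (C₂ * K * Z)
    simpa using this
  refine squeeze_zero' ?_ ?_ hlim
  · filter_upwards with n
    refine mul_nonneg (by positivity) (Finset.sum_nonneg fun j hj => ?_)
    have h1 := (Finset.mem_Icc.1 hj).1
    have := errRate_pos (h.a_mem.pos h1) (h.c_mem.pos h1)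
    positivity
  · filter_upwards [eventually_ge_atTop 1] with n hn
    have hn0 : (0 : ℝ) < n := by positivity
    calc _ ≤ (n : ℝ) ^ (-(1 / 4) : ℝ) * (C₂ * K * Z * (n : ℝ) ^ (4 * ε)) := by
          gcongr; exact hbound n hn
      _ = C₂ * K * Z * ((n : ℝ) ^ (-(1 / 4) : ℝ) * (n : ℝ) ^ (4 * ε)) := by ring
      _ = _ := by
          rw [← Real.rpow_add hn0]; norm_num [hε]

lemma errRate_mem (h : StepConditions a c m L α τ) :
    GS (-α - 2 * -τ) (fun n => a n / c n ^ 2) ∧ GS (4 * -τ) (fun n => c n ^ 4) := by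
  have h1 := h.a_mem.div (h.c_mem.pow 2)
  have h2 := h.c_mem.pow 4
  push_cast at h1 h2
  exact ⟨h1, h2⟩

lemma errRate_succ (h : StepConditions a c m L α τ) :
    (fun n => errRate a c (n + 1)) =O[atTop] errRate a c := by
  obtain ⟨h1, h2⟩ := h.errRate_mem
  have le1 : ∀ n, 1 ≤ n → a n / c n ^ 2 ≤ errRate a c n := fun n hn => by
    have := h2.pos hn; unfold errRate; linarith
  have le2 : ∀ n, 1 ≤ n → c n ^ 4 ≤ errRate a c n := fun n hn => by
    have := h1.pos hn; unfold errRate; linarith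
  refine Asymptotics.IsBigO.add (h1.isBigO_succ.trans ?_) (h2.isBigO_succ.trans ?_)
  · refine Asymptotics.IsBigO.of_bound 1 ?_
    filter_upwards [eventually_ge_atTop 1] with n hn
    rw [Real.norm_of_nonneg (h1.pos hn).le, one_mul]
    exact (le1 n hn).trans (le_abs_self _)
  · refine Asymptotics.IsBigO.of_bound 1 ?_
    filter_upwards [eventually_ge_atTop 1] with n hn
    rw [Real.norm_of_nonneg (h2.pos hn).le, one_mul]
    exact (le2 n hn).trans (le_abs_self _)

lemma errRate_le (h : StepConditions a c m L α τ) (hA : AveragingConditions a c) (hL : 0 < L)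
    (l : ℝ) (hl : 0 < l) :
    ∀ᶠ n in atTop, (1 - l * a n) * errRate a c n ≤ errRate a c (n + 1) := by
  obtain ⟨h1, h2⟩ := h.errRate_mem
  filter_upwards [h1.eventually_le_succ (h.tendsto_mul_a hA hL) hl,
    h2.eventually_le_succ (h.tendsto_mul_a hA hL) hl] with n e1 e2
  unfold errRate
  rw [mul_add]
  exact add_le_add e1 e2

lemma rates (h : StepConditions a c m L α τ) (hA : AveragingConditions a c) (hL : 0 < L) :
    Rates a c τ where
  a_pos := h.a_mem.1
  c_pos := h.c_mem.1
  c_mem := h.c_mem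
  tau_le := h.tau_le hA hL
  a_zero := h.a_zero
  c_zero := h.c_zero
  weightSum_atTop := h.weightSum_atTop
  weightSum_equiv := h.weightSum_equiv
  drift_isLittleO := h.drift_isLittleO hA hL
  quad_isLittleO := h.quad_isLittleO hA hL
  driftSum_atTop := h.driftSum_atTop
  mul_driftRate := h.mul_driftRate
  driftSum_div := h.driftSum_div hA hL
  inv_weightSum := h.inv_weightSum hA hL
  errRate_succ := h.errRate_succ
  errRate_le := h.errRate_le hA hL
  gain_diff := ((h.c_mem.pow 2).div h.a_mem).isBigO_sub
  smoothing := h.smoothing hA hL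

end StepConditions

end

/-! ### Taylor expansions with uniform remainders. -/

section

section Taylor
variable {E : Type*} [NormedAddCommGroup E] [NormedSpace ℝ E]

/-- The derivative is Lipschitz near `θ`, so on the ball of radius `‖x - θ‖` it differs from its
value at `θ` by a multiple of `‖x - θ‖`; the mean value inequality supplies the second factor. -/
lemma exists_quadratic_remainder {F : Type*} [NormedAddCommGroup F] [NormedSpace ℝ F]
    {g : E → F} {θ : E} (hg : ContDiffAt ℝ 2 g θ) :
    ∃ C r : ℝ, 0 ≤ C ∧ 0 < r ∧ ∀ x, ‖x - θ‖ ≤ r →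
      ‖g x - g θ - fderiv ℝ g θ (x - θ)‖ ≤ C * ‖x - θ‖ ^ 2 := by
  have h1 : ContDiffAt ℝ 1 (fderiv ℝ g) θ := hg.fderiv_right (by norm_num)
  obtain ⟨K, t, ht, hK⟩ := h1.exists_lipschitzOnWith
  have h2 : ∀ᶠ y in 𝓝 θ, ContDiffAt ℝ 2 g y := hg.eventually (by simp)
  obtain ⟨r, hr, hball⟩ := Metric.nhds_basis_closedBall.mem_iff.1 (inter_mem ht h2)
  refine ⟨K, r, K.2, hr, fun x hx => ?_⟩
  have hsub : Metric.closedBall θ ‖x - θ‖ ⊆ Metric.closedBall θ r :=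
    Metric.closedBall_subset_closedBall hx
  have := (convex_closedBall θ ‖x - θ‖).norm_image_sub_le_of_norm_fderiv_le' (𝕜 := ℝ)
    (f := g) (φ := fderiv ℝ g θ) (C := K * ‖x - θ‖) (x := θ) (y := x)
    (fun y hy => by
      have h3 : ContDiffAt ℝ 2 g y := (hball (hsub hy)).2
      exact h3.differentiableAt (by norm_num))
    (fun y hy => by
      have h3 := hK.dist_le_mul y (hball (hsub hy)).1 θ (mem_of_mem_nhds ht)
      rw [dist_eq_norm] at h3
      refine h3.trans ?_
      gcongr
      exact Metric.mem_closedBall.1 hy)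
    (by simp) (by simp [dist_eq_norm])
  refine this.trans (le_of_eq ?_)
  ring

lemma abs_le_mul_of_hasDerivAt {u u' : ℝ → ℝ} {b C : ℝ}
    (hu : ∀ s ∈ Set.Icc 0 b, HasDerivAt u (u' s) s) (h0 : u 0 = 0)
    (hC : ∀ s ∈ Set.Icc 0 b, |u' s| ≤ C) {s : ℝ} (hs : s ∈ Set.Icc 0 b) : |u s| ≤ C * b := by
  have h := (convex_Icc 0 b).norm_image_sub_le_of_norm_hasDerivWithin_le
    (f := u) (f' := u') (C := C) (fun x hx => (hu x hx).hasDerivWithinAt) hC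
    (show (0 : ℝ) ∈ Set.Icc 0 b from ⟨le_rfl, hs.1.trans hs.2⟩) hs
  rw [h0, sub_zero, sub_zero, Real.norm_eq_abs, Real.norm_of_nonneg hs.1] at h
  have hC0 : 0 ≤ C := (abs_nonneg _).trans (hC s hs)
  exact h.trans (mul_le_mul_of_nonneg_left hs.2 hC0)

lemma hasDerivAt_iteratedFDeriv_line {f : E → ℝ} {x e : E} {t : ℝ} {k : ℕ} {n : ℕ}
    (hf : ContDiffAt ℝ n f (x + t • e)) (hk : k < n) :
    HasDerivAt (fun s : ℝ => iteratedFDeriv ℝ k f (x + s • e) fun _ => e)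
      (iteratedFDeriv ℝ (k + 1) f (x + t • e) fun _ => e) t := by
  have hd : DifferentiableAt ℝ (iteratedFDeriv ℝ k f) (x + t • e) :=
    hf.differentiableAt_iteratedFDeriv (by exact_mod_cast hk)
  have hl : HasDerivAt (fun s : ℝ => x + s • e) e t := by
    simpa using ((hasDerivAt_id t).smul_const e).const_add x
  have h1 : DifferentiableAt ℝ (fun y => iteratedFDeriv ℝ k f y fun _ => e) (x + t • e) :=
    hd.continuousMultilinear_apply_const _
  have h2 := h1.hasFDerivAt.comp_hasDerivAt t hl
  rw [hd.iteratedFDeriv_succ_apply_left']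
  exact h2

/-- Third order expansion of symmetric difference quotients, uniformly near a point. -/
lemma exists_symmetric_quotient_expansion {f : E → ℝ} {θ : E} (hf : ContDiffAt ℝ 3 f θ) {e : E}
    (he : ‖e‖ = 1) {ε : ℝ} (hε : 0 < ε) :
    ∃ r, 0 < r ∧ ∀ x, ‖x - θ‖ ≤ r → ∀ c, 0 < c → c ≤ r →
      |1 / (2 * c) * (f (x + c • e) - f (x - c • e)) - fderiv ℝ f x e
        - c ^ 2 * ((1 / 6) * iteratedFDeriv ℝ 3 f θ fun _ => e)| ≤ ε * c ^ 2 := by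
  set F : ℕ → E → ℝ := fun k y => iteratedFDeriv ℝ k f y fun _ => e with hF
  have hcont : ContinuousAt (F 3) θ := by
    have h1 : ContDiffAt ℝ 0 (iteratedFDeriv ℝ 3 f) θ :=
      hf.iteratedFDeriv_right (i := 3) (m := 0) (by norm_num)
    have h2 := h1.continuousAt
    exact ((ContinuousMultilinearMap.apply ℝ (fun _ : Fin 3 => E) ℝ
      (fun _ => e)).continuous.continuousAt).comp h2
  have h2 : ∀ᶠ y in 𝓝 θ, ContDiffAt ℝ 3 f y := hf.eventually (by simp)
  have h3 : ∀ᶠ y in 𝓝 θ, |F 3 y - F 3 θ| < ε := by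
    have := hcont.eventually (Metric.ball_mem_nhds (F 3 θ) hε)
    exact this
  obtain ⟨r, hr, hball⟩ := Metric.nhds_basis_closedBall.mem_iff.1 (inter_mem h2 h3)
  -- Half of the radius is left for `x - θ` and half for `s • e`.
  refine ⟨r / 2, by positivity, fun x hx c hc hcr => ?_⟩
  have hmem : ∀ s : ℝ, |s| ≤ c → x + s • e ∈ Metric.closedBall θ r := by
    intro s hs
    rw [Metric.mem_closedBall, dist_eq_norm]
    calc ‖x + s • e - θ‖ = ‖(x - θ) + s • e‖ := by congr 1; abel
      _ ≤ ‖x - θ‖ + ‖s • e‖ := norm_add_le _ _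
      _ ≤ r / 2 + r / 2 := by
          rw [norm_smul, he, mul_one]
          exact add_le_add hx (hs.trans hcr)
      _ = r := by ring
  have hder : ∀ k, k < 3 → ∀ s : ℝ, |s| ≤ c →
      HasDerivAt (fun t : ℝ => F k (x + t • e)) (F (k + 1) (x + s • e)) s := fun k hk s hs =>
    hasDerivAt_iteratedFDeriv_line (n := 3) (hball (hmem s hs)).1 hk
  have hder' : ∀ k, k < 3 → ∀ s : ℝ, |s| ≤ c →
      HasDerivAt (fun t : ℝ => F k (x + (-t) • e)) (-F (k + 1) (x + (-s) • e)) s := by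
    intro k hk s hs
    have := (hder k hk (-s) (by rwa [abs_neg])).scomp s (hasDerivAt_neg s)
    simpa [Function.comp_def] using this
  have hicc : ∀ s ∈ Set.Icc 0 c, |s| ≤ c := fun s hs => by rw [abs_of_nonneg hs.1]; exact hs.2
  set K := F 3 θ with hK
  -- The bound `2ε` for the third derivatives at `x ± s e` is integrated three times from `0`, each
  -- time at the cost of a factor `c`. The symmetric combinations remove the terms of even order.
  have b2 : ∀ s ∈ Set.Icc 0 c, |F 2 (x + s • e) - F 2 (x + (-s) • e) - 2 * s * K| ≤ 2 * ε * c := by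
    intro s hs
    refine abs_le_mul_of_hasDerivAt (b := c)
      (u := fun s => F 2 (x + s • e) - F 2 (x + (-s) • e) - 2 * s * K)
      (u' := fun s => F 3 (x + s • e) - -F 3 (x + (-s) • e) - 2 * 1 * K) ?_ (by simp) ?_ hs
    · intro t ht
      exact ((hder 2 (by norm_num) t (hicc t ht)).sub (hder' 2 (by norm_num) t (hicc t ht))).sub
        (((hasDerivAt_id t).const_mul 2).mul_const K)
    · intro t ht
      have e1 : |F 3 (x + t • e) - F 3 θ| < ε := (hball (hmem t (hicc t ht))).2
      have e2 : |F 3 (x + (-t) • e) - F 3 θ| < ε :=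
        (hball (hmem (-t) (by rw [abs_neg]; exact hicc t ht))).2
      rw [abs_lt] at e1 e2
      rw [abs_le]
      constructor <;> linarith [e1.1, e1.2, e2.1, e2.2]
  have b1 : ∀ s ∈ Set.Icc 0 c,
      |F 1 (x + s • e) + F 1 (x + (-s) • e) - 2 * F 1 x - s ^ 2 * K| ≤ 2 * ε * c * c := by
    intro s hs
    refine abs_le_mul_of_hasDerivAt (b := c)
      (u := fun s => F 1 (x + s • e) + F 1 (x + (-s) • e) - 2 * F 1 x - s ^ 2 * K)
      (u' := fun s => F 2 (x + s • e) + -F 2 (x + (-s) • e) - (2 * s) * K) ?_ ?_ ?_ hs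
    · intro t ht
      have hp : HasDerivAt (fun t : ℝ => t ^ 2) (2 * t) t := by simpa using hasDerivAt_pow 2 t
      exact (((hder 1 (by norm_num) t (hicc t ht)).add
        (hder' 1 (by norm_num) t (hicc t ht))).sub_const _).sub (hp.mul_const K)
    · simp; ring
    · intro t ht
      simpa [sub_eq_add_neg] using b2 t ht
  have b0 : |F 0 (x + c • e) - F 0 (x + (-c) • e) - 2 * c * F 1 x - c ^ 3 / 3 * K|
      ≤ 2 * ε * c * c * c := by
    refine abs_le_mul_of_hasDerivAt (b := c)
      (u := fun s => F 0 (x + s • e) - F 0 (x + (-s) • e) - 2 * s * F 1 x - s ^ 3 / 3 * K)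
      (u' := fun s => F 1 (x + s • e) - -F 1 (x + (-s) • e) - 2 * 1 * F 1 x - s ^ 2 * K)
      ?_ (by simp) ?_ ⟨hc.le, le_rfl⟩
    · intro t ht
      have hp : HasDerivAt (fun t : ℝ => t ^ 3 / 3) (t ^ 2) t := by
        refine ((hasDerivAt_pow 3 t).div_const 3).congr_deriv ?_
        norm_num
      exact (((hder 0 (by norm_num) t (hicc t ht)).sub (hder' 0 (by norm_num) t (hicc t ht))).sub
        (((hasDerivAt_id t).const_mul 2).mul_const (F 1 x))).sub (hp.mul_const K)
    · intro t ht
      have := b1 t ht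
      simpa using this
  have hF0 : ∀ y, F 0 y = f y := fun y => by simp [hF]
  have hF1 : F 1 x = fderiv ℝ f x e := by simp [hF]
  rw [hF0, hF0, hF1] at b0
  have e1 : 1 / (2 * c) * (f (x + c • e) - f (x - c • e)) - fderiv ℝ f x e - c ^ 2 * (1 / 6 * K)
      = 1 / (2 * c) * (f (x + c • e) - f (x + (-c) • e) - 2 * c * fderiv ℝ f x e - c ^ 3 / 3 * K) := by
    rw [neg_smul, ← sub_eq_add_neg]
    field_simp
    ring
  rw [e1, abs_mul, abs_of_pos (by positivity)]
  calc _ ≤ 1 / (2 * c) * (2 * ε * c * c * c) := by gcongr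
    _ = ε * c ^ 2 := by field_simp

end Taylor

end

/-! ### The regression function near its maximizer. -/

section

variable {d : ℕ}

/-- The symmetric difference quotient approximation of the gradient. -/
def diffQuotient (f : EuclideanSpace ℝ (Fin d) → ℝ) (c : ℝ) (x : EuclideanSpace ℝ (Fin d)) :
    EuclideanSpace ℝ (Fin d) :=
  (1 / (2 * c)) • WithLp.toLp 2
    (fun i : Fin d => f (x + c • basisVec i) - f (x - c • basisVec i))

/-- The linear map given by the Hessian matrix. -/
def hessianCLM (f : EuclideanSpace ℝ (Fin d) → ℝ) (x : EuclideanSpace ℝ (Fin d)) :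
    EuclideanSpace ℝ (Fin d) →L[ℝ] EuclideanSpace ℝ (Fin d) :=
  Matrix.toEuclideanCLM (𝕜 := ℝ) (hessian f x)

/-- The vector `thirdOrderBias` as an element of the Euclidean space. -/
def biasVec (f : EuclideanSpace ℝ (Fin d) → ℝ) (x : EuclideanSpace ℝ (Fin d)) :
    EuclideanSpace ℝ (Fin d) := WithLp.toLp 2 (thirdOrderBias f x)

lemma norm_basisVec (i : Fin d) : ‖(basisVec i : EuclideanSpace ℝ (Fin d))‖ = 1 := by
  simp [basisVec]

lemma eq_sum_smul_basisVec (v : EuclideanSpace ℝ (Fin d)) : v = ∑ i, v i • basisVec i := by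
  ext j
  simp [basisVec, Pi.single_apply]

lemma norm_le_of_abs_coord_le {v : EuclideanSpace ℝ (Fin d)} {B : ℝ} (hB : ∀ i, |v i| ≤ B) :
    ‖v‖ ≤ d * B := by
  rw [eq_sum_smul_basisVec v]
  refine (norm_sum_le _ _).trans ?_
  refine (Finset.sum_le_sum fun i _ => ?_).trans_eq (b := ∑ _i : Fin d, B) (by simp)
  rw [norm_smul, norm_basisVec, mul_one]
  exact hB i

variable {f : EuclideanSpace ℝ (Fin d) → ℝ} {θ : EuclideanSpace ℝ (Fin d)} {L : ℝ}

namespace IsRegularMaximizer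

lemma isLocalMax (h : IsRegularMaximizer f θ L) : IsLocalMax f θ :=
  Eventually.of_forall fun x => by
    rcases eq_or_ne x θ with rfl | hx
    · exact le_rfl
    · exact (h.unique_max x hx).le

lemma fderiv_eq_zero (h : IsRegularMaximizer f θ L) : fderiv ℝ f θ = 0 :=
  h.isLocalMax.fderiv_eq_zero

lemma exists_quadratic_bound (h : IsRegularMaximizer f θ L) :
    ∃ C r : ℝ, 0 ≤ C ∧ 0 < r ∧ ∀ x, ‖x - θ‖ ≤ r → |f x - f θ| ≤ C * ‖x - θ‖ ^ 2 := by
  obtain ⟨C, r, hC, hr, hb⟩ := exists_quadratic_remainder (h.contDiffAt.of_le (by norm_num))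
  refine ⟨C, r, hC, hr, fun x hx => ?_⟩
  simpa [h.fderiv_eq_zero] using hb x hx

/-- The two sides have the arguments of the second derivative in opposite order; the symmetry of the
Hessian matrix is part of its negative definiteness. -/
lemma fderiv_fderiv_apply (h : IsRegularMaximizer f θ L) (v : EuclideanSpace ℝ (Fin d))
    (i : Fin d) : fderiv ℝ (fderiv ℝ f) θ v (basisVec i) = hessianCLM f θ v i := by
  have hv := eq_sum_smul_basisVec v
  have h1 : hessianCLM f θ v i = ∑ j, hessian f θ i j * v j := by
    simp [hessianCLM, Matrix.ofLp_toEuclideanCLM, Matrix.mulVec, dotProduct]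
  rw [h1]
  conv_lhs => rw [hv]
  rw [map_sum, sum_apply]
  refine Finset.sum_congr rfl fun j _ => ?_
  have hsymm : hessian f θ i j = hessian f θ j i := by
    have := h.negDef.1.apply j i
    simp at this
    linarith
  rw [hsymm, map_smul, smul_apply, smul_eq_mul, mul_comm]
  congr 1
  simp [hessian, iteratedFDeriv_two_apply]

lemma exists_gradient_bound (h : IsRegularMaximizer f θ L) (i : Fin d) :
    ∃ C r : ℝ, 0 ≤ C ∧ 0 < r ∧ ∀ x, ‖x - θ‖ ≤ r →
      |fderiv ℝ f x (basisVec i) - hessianCLM f θ (x - θ) i| ≤ C * ‖x - θ‖ ^ 2 := by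
  have h1 : ContDiffAt ℝ 2 (fderiv ℝ f) θ := h.contDiffAt.fderiv_right (by norm_num)
  obtain ⟨C, r, hC, hr, hb⟩ := exists_quadratic_remainder h1
  refine ⟨C, r, hC, hr, fun x hx => ?_⟩
  have h2 := ContinuousLinearMap.le_opNorm
    (fderiv ℝ f x - fderiv ℝ f θ - fderiv ℝ (fderiv ℝ f) θ (x - θ)) (basisVec i)
  rw [norm_basisVec, mul_one, h.fderiv_eq_zero] at h2
  have h3 := hb x hx
  rw [h.fderiv_eq_zero] at h3
  rw [← h.fderiv_fderiv_apply]
  simpa using h2.trans h3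

/-- Expansion of the difference quotients near the maximizer. -/
lemma exists_expansion (h : IsRegularMaximizer f θ L) :
    ∃ C : ℝ, 0 ≤ C ∧ ∀ ε : ℝ, 0 < ε → ∃ r, 0 < r ∧ ∀ x, ‖x - θ‖ ≤ r → ∀ c, 0 < c → c ≤ r →
      ‖diffQuotient f c x - hessianCLM f θ (x - θ) - c ^ 2 • biasVec f θ‖
        ≤ C * ‖x - θ‖ ^ 2 + ε * c ^ 2 := by
  choose C r hC hr hb using h.exists_gradient_bound
  refine ⟨d * ∑ i, C i, mul_nonneg (by positivity) (Finset.sum_nonneg fun i _ => hC i),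
    fun ε hε => ?_⟩
  -- The norm is bounded by `d` times a bound of the coordinates; the denominator `d + 1` also
  -- covers `d = 0`. The constant `C` is fixed before `ε`, which is needed to make the excess over
  -- `C ‖x - θ‖²` of order `o(c²)`.
  choose r' hr' hb' using fun i : Fin d => exists_symmetric_quotient_expansion h.contDiffAt
    (norm_basisVec i) (show 0 < ε / (d + 1) by positivity)
  have hev : ∀ᶠ ρ : ℝ in 𝓝[>] 0, ∀ i, ρ ≤ r i ∧ ρ ≤ r' i := by
    refine eventually_all.2 fun i => ?_
    filter_upwards [Ioc_mem_nhdsGT (hr i), Ioc_mem_nhdsGT (hr' i)] with ρ h1 h2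
    exact ⟨h1.2, h2.2⟩
  obtain ⟨ρ, hρ, hρ0⟩ := (hev.and self_mem_nhdsWithin).exists
  refine ⟨ρ, hρ0, fun x hx c hc hcρ => ?_⟩
  have hcoord : ∀ i, |(diffQuotient f c x - hessianCLM f θ (x - θ) - c ^ 2 • biasVec f θ) i|
      ≤ (∑ i, C i) * ‖x - θ‖ ^ 2 + ε / (d + 1) * c ^ 2 := by
    intro i
    have h1 := hb i x (hx.trans (hρ i).1)
    have h2 := hb' i x (hx.trans (hρ i).2) c hc (hcρ.trans (hρ i).2)
    have e : (diffQuotient f c x - hessianCLM f θ (x - θ) - c ^ 2 • biasVec f θ) i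
        = (1 / (2 * c) * (f (x + c • basisVec i) - f (x - c • basisVec i))
            - fderiv ℝ f x (basisVec i)
            - c ^ 2 * ((1 / 6) * iteratedFDeriv ℝ 3 f θ fun _ => basisVec i))
          + (fderiv ℝ f x (basisVec i) - hessianCLM f θ (x - θ) i) := by
      simp only [diffQuotient, biasVec, thirdOrderBias, PiLp.sub_apply, PiLp.smul_apply,
        smul_eq_mul]
      ring
    rw [e]
    have h3 : C i * ‖x - θ‖ ^ 2 ≤ (∑ i, C i) * ‖x - θ‖ ^ 2 := by
      gcongr
      exact Finset.single_le_sum (fun j _ => hC j) (Finset.mem_univ i)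
    have := abs_add_le (1 / (2 * c) * (f (x + c • basisVec i) - f (x - c • basisVec i))
            - fderiv ℝ f x (basisVec i)
            - c ^ 2 * ((1 / 6) * iteratedFDeriv ℝ 3 f θ fun _ => basisVec i))
          (fderiv ℝ f x (basisVec i) - hessianCLM f θ (x - θ) i)
    linarith
  refine (norm_le_of_abs_coord_le hcoord).trans ?_
  have h4 : (d : ℝ) * (ε / (d + 1) * c ^ 2) ≤ ε * c ^ 2 := by
    have : (d : ℝ) * (ε / (d + 1)) ≤ ε := by
      rw [mul_div_assoc', div_le_iff₀ (by positivity)]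
      nlinarith
    calc _ = (d : ℝ) * (ε / (d + 1)) * c ^ 2 := by ring
      _ ≤ _ := by gcongr
  linarith

lemma inner_hessianCLM_neg (h : IsRegularMaximizer f θ L) {x : EuclideanSpace ℝ (Fin d)}
    (hx : x ≠ 0) : inner ℝ x (hessianCLM f θ x) < 0 := by
  have h1 := (Matrix.posDef_iff_dotProduct_mulVec.1 h.negDef).2 (x := WithLp.ofLp x)
    (by simpa using hx)
  rw [hessianCLM, Matrix.inner_toEuclideanCLM]
  simp [Matrix.neg_mulVec] at h1
  exact h1

/-- The quadratic form attains its maximum on the unit sphere, where it is negative; the rest is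
homogeneity. For `d = 0` the sphere is empty and any constant works. -/
lemma exists_coercive (h : IsRegularMaximizer f θ L) :
    ∃ l : ℝ, 0 < l ∧ ∀ x, inner ℝ x (hessianCLM f θ x) ≤ -l * ‖x‖ ^ 2 := by
  rcases (Metric.sphere (0 : EuclideanSpace ℝ (Fin d)) 1).eq_empty_or_nonempty with he | hne
  · refine ⟨1, one_pos, fun x => ?_⟩
    rcases eq_or_ne x 0 with rfl | hx
    · simp
    · exfalso
      have : ‖x‖⁻¹ • x ∈ Metric.sphere (0 : EuclideanSpace ℝ (Fin d)) 1 := by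
        simp [norm_smul, hx]
      rw [he] at this
      exact this
  · have hcont : ContinuousOn (fun x => inner ℝ x (hessianCLM f θ x))
        (Metric.sphere (0 : EuclideanSpace ℝ (Fin d)) 1) := by fun_prop
    obtain ⟨y, hy, hmax⟩ := (isCompact_sphere _ _).exists_isMaxOn hne hcont
    have hy1 : ‖y‖ = 1 := by simpa using hy
    have hy0 : y ≠ 0 := by
      rintro rfl
      simp at hy1
    refine ⟨-inner ℝ y (hessianCLM f θ y), by linarith [h.inner_hessianCLM_neg hy0], fun x => ?_⟩
    rcases eq_or_ne x 0 with rfl | hx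
    · simp
    · have h1 : ‖x‖⁻¹ • x ∈ Metric.sphere (0 : EuclideanSpace ℝ (Fin d)) 1 := by
        simp [norm_smul, hx]
      have h2 := hmax h1
      simp only [Set.mem_ofPred_eq, map_smul, inner_smul_left, inner_smul_right] at h2
      have h3 : 0 < ‖x‖ := norm_pos_iff.2 hx
      simp only [conj_trivial] at h2
      rw [neg_neg]
      have h4 : ‖x‖⁻¹ * (‖x‖⁻¹ * inner ℝ x (hessianCLM f θ x)) * ‖x‖ ^ 2
          = inner ℝ x (hessianCLM f θ x) := by field_simp
      rw [← h4]
      gcongr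

/-- The quadratic form is evaluated at an eigenvector for `-L`. Positivity of `L` turns the
condition on `n a_n` into a positive lower bound, whence `s_n → ∞`. -/
lemma L_pos (h : IsRegularMaximizer f θ L) : 0 < L := by
  obtain ⟨v, hv⟩ := h.max_eigenvalue.1.exists_hasEigenvector
  have h1 : WithLp.toLp 2 v ≠ 0 := by simpa using hv.2
  have h2 := h.inner_hessianCLM_neg h1
  have h3 : hessianCLM f θ (WithLp.toLp 2 v) = (-L) • WithLp.toLp 2 v := by
    have := hv.apply_eq_smul
    rw [Matrix.toLin'_apply] at this
    rw [hessianCLM, Matrix.toEuclideanCLM_toLp, this]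
    simp
  rw [h3, inner_smul_right, real_inner_self_eq_norm_sq] at h2
  have h4 : 0 < ‖WithLp.toLp 2 v‖ ^ 2 := by positivity
  nlinarith

end IsRegularMaximizer

end

/-! ### Conditional centring, conditional independence and disintegration. -/

section

section CondExp
variable {Ω : Type*} {m m0 : MeasurableSpace Ω} {μ : Measure Ω}

/-- The hypothesis says that the conditional expectation of `X` is `0`, and `W` can be taken out of
the conditional expectation of `W X`. -/
lemma integral_mul_eq_zero_of_setIntegral_eq_zero [IsFiniteMeasure μ] (hm : m ≤ m0)
    {X W : Ω → ℝ} (hX : Integrable X μ)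
    (h : ∀ A, MeasurableSet[m] A → ∫ ω in A, X ω ∂μ = 0) (hW : StronglyMeasurable[m] W)
    (hWX : Integrable (fun ω => W ω * X ω) μ) : ∫ ω, W ω * X ω ∂μ = 0 := by
  have h1 : (0 : Ω → ℝ) =ᵐ[μ] μ[X | m] :=
    ae_eq_condExp_of_forall_setIntegral_eq hm hX (fun _ _ _ => integrableOn_zero)
      (fun s hs _ => by simp [h s hs]) aestronglyMeasurable_zero
  have h2 := condExp_mul_of_stronglyMeasurable_left hW hWX hX
  have h3 : ∫ ω, W ω * X ω ∂μ = ∫ ω, (μ[fun ω => W ω * X ω | m]) ω ∂μ :=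
    (integral_condExp hm).symm
  rw [h3]
  have h4 : μ[fun ω => W ω * X ω | m] =ᵐ[μ] 0 := by
    refine h2.trans ?_
    filter_upwards [h1] with ω hω
    simp [← hω]
  rw [integral_congr_ae h4]
  simp

lemma measureReal_inter_eq_setIntegral_condExp [IsFiniteMeasure μ] (hm : m ≤ m0) {A S : Set Ω}
    (hA : MeasurableSet[m] A) (hS : MeasurableSet S) :
    μ.real (A ∩ S) = ∫ ω in A, (μ⟦S | m⟧) ω ∂μ := by
  rw [setIntegral_condExp hm ((integrable_const (1 : ℝ)).indicator hS) hA,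
    integral_indicator hS]
  simp [Measure.restrict_restrict hS, Set.inter_comm]

/-- Conditional independence is known for events only, so laws of `X` are compared: restricting the
measure to `A ∩ {Y ∈ C}` and weighting it by the `m`-measurable density `1_A · P(Y ∈ C | m)` give
`X` the same image. The integral of `X` against such a density vanishes. -/
lemma setIntegral_inter_preimage_eq_zero [IsFiniteMeasure μ] (hm : m ≤ m0) {X Y : Ω → ℝ}
    (hX : Measurable X) (hY : Measurable Y) (hXi : Integrable X μ)
    (h0 : ∀ A, MeasurableSet[m] A → ∫ ω in A, X ω ∂μ = 0)
    (hind : ∀ B C, MeasurableSet B → MeasurableSet C →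
      μ⟦X ⁻¹' B ∩ Y ⁻¹' C | m⟧ =ᵐ[μ] fun ω => (μ⟦X ⁻¹' B | m⟧) ω * (μ⟦Y ⁻¹' C | m⟧) ω)
    {A : Set Ω} (hA : MeasurableSet[m] A) {C : Set ℝ} (hC : MeasurableSet C) :
    ∫ ω in A ∩ Y ⁻¹' C, X ω ∂μ = 0 := by
  set p : Ω → ℝ := μ⟦Y ⁻¹' C | m⟧ with hp
  have hpm : StronglyMeasurable[m] p := stronglyMeasurable_condExp
  have hp0 : 0 ≤ᵐ[μ] p := condExp_nonneg (Eventually.of_forall fun ω =>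
    Set.indicator_nonneg (fun _ _ => zero_le_one) ω)
  have hp1 : p ≤ᵐ[μ] 1 := by
    have : (fun _ : Ω => (1 : ℝ)) = μ[fun _ : Ω => (1 : ℝ) | m] := (condExp_const hm 1).symm
    have h2 : p ≤ᵐ[μ] μ[fun _ : Ω => (1 : ℝ) | m] :=
      condExp_mono ((integrable_const (1 : ℝ)).indicator (hY hC)) (integrable_const _)
        (Eventually.of_forall fun ω => Set.indicator_le_self' (fun _ _ => zero_le_one) ω)
    rw [← this] at h2
    exact h2
  -- The truncation to `[0, 1]` makes the version of the conditional probability bounded everywhere.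
  set W : Ω → ℝ := A.indicator fun ω => max 0 (min 1 (p ω)) with hW
  have hWm : StronglyMeasurable[m] W := by
    have h2 : Measurable fun x : ℝ => max 0 (min 1 x) := by fun_prop
    exact (h2.comp hpm.measurable).stronglyMeasurable.indicator hA
  have hW0 : ∀ ω, 0 ≤ W ω := fun ω => Set.indicator_nonneg (fun _ _ => le_max_left _ _) ω
  have hW1 : ∀ ω, ‖W ω‖ ≤ 1 := fun ω => by
    rw [Real.norm_of_nonneg (hW0 ω)]
    exact Set.indicator_le' (fun _ _ => max_le zero_le_one (min_le_left _ _))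
      (fun _ _ => zero_le_one) ω
  have hWp : W =ᵐ[μ] A.indicator p := by
    filter_upwards [hp0, hp1] with ω h1 h2
    simp only [hW, Set.indicator]
    split_ifs
    · have h1' : 0 ≤ p ω := h1
      have h2' : p ω ≤ 1 := h2
      rw [min_eq_right h2', max_eq_right h1']
    · rfl
  have hWi : Integrable W μ :=
    Integrable.of_bound (hWm.mono hm).aestronglyMeasurable 1 (Eventually.of_forall hW1)
  have hmeas : (μ.restrict (A ∩ Y ⁻¹' C)).map X
      = (μ.withDensity fun ω => ENNReal.ofReal (W ω)).map X := by
    ext B hB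
    rw [Measure.map_apply hX hB, Measure.map_apply hX hB, Measure.restrict_apply (hX hB),
      withDensity_apply _ (hX hB), ← ofReal_integral_eq_lintegral_ofReal hWi.integrableOn
        (Eventually.of_forall hW0), ← ofReal_measureReal (by finiteness)]
    congr 1
    have e1 : X ⁻¹' B ∩ (A ∩ Y ⁻¹' C) = A ∩ (X ⁻¹' B ∩ Y ⁻¹' C) := by
      ext ω; simp only [Set.mem_inter_iff]; tauto
    rw [e1, measureReal_inter_eq_setIntegral_condExp hm hA ((hX hB).inter (hY hC)),
      setIntegral_congr_ae (hm A hA) ((hind B C hB hC).mono fun ω hω _ => hω),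
      ← integral_indicator (hm A hA), ← integral_indicator (hX hB)]
    have e2 : ∀ᵐ ω ∂μ, A.indicator (fun ω => (μ⟦X ⁻¹' B | m⟧) ω * (μ⟦Y ⁻¹' C | m⟧) ω) ω
        = W ω * (μ⟦X ⁻¹' B | m⟧) ω := by
      filter_upwards [hWp] with ω hω
      rw [hω]
      simp only [Set.indicator]
      split_ifs
      · rw [mul_comm]
      · simp
    rw [integral_congr_ae e2]
    have hi : Integrable ((X ⁻¹' B).indicator fun _ => (1 : ℝ)) μ :=
      (integrable_const (1 : ℝ)).indicator (hX hB)
    have e3 := condExp_stronglyMeasurable_mul_of_bound hm hWm hi 1 (Eventually.of_forall hW1)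
    have e4 : ∫ ω, W ω * (μ⟦X ⁻¹' B | m⟧) ω ∂μ
        = ∫ ω, (W * (X ⁻¹' B).indicator fun _ => (1 : ℝ)) ω ∂μ := by
      rw [← integral_condExp hm (f := W * (X ⁻¹' B).indicator fun _ => (1 : ℝ))]
      exact integral_congr_ae (e3.mono fun ω hω => hω.symm)
    rw [e4]
    refine integral_congr_ae (Eventually.of_forall fun ω => ?_)
    simp only [Pi.mul_apply, Set.indicator]
    split_ifs <;> simp
  have h1 : ∫ ω in A ∩ Y ⁻¹' C, X ω ∂μ
      = ∫ x, x ∂((μ.restrict (A ∩ Y ⁻¹' C)).map X) :=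
    (integral_map hX.aemeasurable aestronglyMeasurable_id).symm
  have h2 : ∫ x, x ∂((μ.withDensity fun ω => ENNReal.ofReal (W ω)).map X)
      = ∫ ω, X ω ∂(μ.withDensity fun ω => ENNReal.ofReal (W ω)) :=
    integral_map hX.aemeasurable aestronglyMeasurable_id
  rw [h1, hmeas, h2, integral_withDensity_eq_integral_toReal_smul (by
      exact ENNReal.measurable_ofReal.comp (hWm.mono hm).measurable) (by simp)]
  simp only [smul_eq_mul, ENNReal.toReal_ofReal (hW0 _)]
  exact integral_mul_eq_zero_of_setIntegral_eq_zero hm hXi h0 hWm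
    (hXi.bdd_mul (hWm.mono hm).aestronglyMeasurable (Eventually.of_forall hW1))

/-- Conditionally independent square integrable variables, one of which is conditionally
centred, are conditionally uncorrelated. -/
lemma setIntegral_mul_eq_zero_of_condIndep [IsFiniteMeasure μ] (hm : m ≤ m0) {X Y : Ω → ℝ}
    (hX : Measurable X) (hY : Measurable Y) (hX2 : MemLp X 2 μ) (hY2 : MemLp Y 2 μ)
    (h0 : ∀ A, MeasurableSet[m] A → ∫ ω in A, X ω ∂μ = 0)
    (hind : ∀ B C, MeasurableSet B → MeasurableSet C →
      μ⟦X ⁻¹' B ∩ Y ⁻¹' C | m⟧ =ᵐ[μ] fun ω => (μ⟦X ⁻¹' B | m⟧) ω * (μ⟦Y ⁻¹' C | m⟧) ω)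
    {A : Set Ω} (hA : MeasurableSet[m] A) :
    ∫ ω in A, Y ω * X ω ∂μ = 0 := by
  have hXi : Integrable X μ := hX2.integrable (by norm_num)
  -- The first lemma is applied again, now under the measure restricted to `A`, with the `σ`-field
  -- generated by `Y`.
  refine integral_mul_eq_zero_of_setIntegral_eq_zero (m := MeasurableSpace.comap Y inferInstance)
    hY.comap_le hXi.integrableOn ?_ (comap_measurable Y).stronglyMeasurable
    (hY2.integrable_mul hX2).integrableOn
  rintro _ ⟨C, hC, rfl⟩
  rw [Measure.restrict_restrict (hY hC), Set.inter_comm]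
  exact setIntegral_inter_preimage_eq_zero hm hX hY hXi h0 hind hA hC

/-- A version of the disintegration of the joint law of `q` and `Z` on the events of `m`. -/
lemma map_restrict_eq_compProd [IsFiniteMeasure μ] (hm : m ≤ m0) {E : Type*} [MeasurableSpace E]
    {P : Kernel E ℝ} [IsMarkovKernel P] {q : Ω → E} {Z : Ω → ℝ} (hq : Measurable[m] q)
    (hZ : Measurable Z)
    (hlaw : ∀ B, MeasurableSet B → μ⟦Z ⁻¹' B | m⟧ =ᵐ[μ] fun ω => (P (q ω)).real B)
    {A : Set Ω} (hA : MeasurableSet[m] A) :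
    (μ.restrict A).map (fun ω => (q ω, Z ω)) = ((μ.restrict A).map q) ⊗ₘ P := by
  have hq' : Measurable q := hq.mono hm le_rfl
  refine Measure.ext_prod fun {D B} hD hB => ?_
  have hqD : MeasurableSet[m] (q ⁻¹' D) := hq hD
  rw [Measure.map_apply (hq'.prodMk hZ) (hD.prod hB), Measure.compProd_apply_prod hD hB,
    Measure.restrict_map hq' hD, lintegral_map (P.measurable_coe hB) hq',
    Measure.restrict_restrict (hq' hD), Set.mk_preimage_prod,
    Measure.restrict_apply ((hq' hD).inter (hZ hB))]
  have e1 : q ⁻¹' D ∩ Z ⁻¹' B ∩ A = (q ⁻¹' D ∩ A) ∩ Z ⁻¹' B := by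
    ext ω; simp only [Set.mem_inter_iff]; tauto
  have hDA : MeasurableSet[m] (q ⁻¹' D ∩ A) := hqD.inter hA
  rw [e1, ← ofReal_measureReal (by finiteness),
    measureReal_inter_eq_setIntegral_condExp hm hDA (hZ hB),
    setIntegral_congr_ae (hm _ hDA) ((hlaw B hB).mono fun ω hω _ => hω),
    ofReal_integral_eq_lintegral_ofReal]
  · refine lintegral_congr fun ω => ?_
    rw [ofReal_measureReal (by finiteness)]
  · refine Integrable.of_bound ?_ 1 (Eventually.of_forall fun ω => ?_)
    · exact ((P.measurable_coe hB).comp hq').ennreal_toReal.aestronglyMeasurable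
    · rw [Real.norm_of_nonneg measureReal_nonneg]
      exact measureReal_le_one
  · exact Eventually.of_forall fun ω => measureReal_nonneg

end CondExp

/-- Errors that are centred and uncorrelated with variance `σ²` conditionally on the past, with
bounded moments of order `p`. -/
structure NoiseArray {Ω : Type*} [m0 : MeasurableSpace Ω] (Pr : Measure Ω) {ι : Type*}
    (G : ℕ → MeasurableSpace Ω) (ξ : ℕ → ι → Ω → ℝ) (σ p : ℝ) : Prop where
  le : ∀ n, G n ≤ m0
  mono : Monotone G
  measurable : ∀ n, 1 ≤ n → ∀ j, Measurable[G (n + 1)] (ξ n j)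
  memLp : ∀ n, 1 ≤ n → ∀ j, MemLp (ξ n j) 2 Pr
  mean : ∀ n, 1 ≤ n → ∀ j (W : Ω → ℝ), Measurable[G n] W → (∃ C, ∀ ω, |W ω| ≤ C) →
    ∫ ω, W ω * ξ n j ω ∂Pr = 0
  var : ∀ n, 1 ≤ n → ∀ j (W : Ω → ℝ), Measurable[G n] W → (∃ C, ∀ ω, |W ω| ≤ C) →
    ∫ ω, W ω * ξ n j ω ^ 2 ∂Pr = σ ^ 2 * ∫ ω, W ω ∂Pr
  cov : ∀ n, 1 ≤ n → ∀ i j, i ≠ j → ∀ (W : Ω → ℝ), Measurable[G n] W →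
    (∃ C, ∀ ω, |W ω| ≤ C) → ∫ ω, W ω * (ξ n i ω * ξ n j ω) ∂Pr = 0
  two_lt : 2 < p
  le_three : p ≤ 3
  moment : ∃ C, ∀ n, 1 ≤ n → ∀ j, Integrable (fun ω => |ξ n j ω| ^ p) Pr ∧
    ∫ ω, |ξ n j ω| ^ p ∂Pr ≤ C

end

/-! ### The observation errors of the algorithm. -/

section

variable {d δ : ℕ} {Ω : Type*}
  {P : Kernel (EuclideanSpace ℝ (Fin d)) ℝ} {a c : ℕ → ℝ}
  {Θ : ℕ → Ω → EuclideanSpace ℝ (Fin d)} {M : ℕ → Ω → ℝ} {Z : ℕ → Label d δ → Ω → ℝ}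
  {f : EuclideanSpace ℝ (Fin d) → ℝ} {σ m : ℝ}

section Measurability

lemma measurable_regression (P : Kernel (EuclideanSpace ℝ (Fin d)) ℝ) :
    Measurable (regression P) :=
  (stronglyMeasurable_id.integral_kernel (κ := P)).measurable

lemma measurable_toLp_of_coord {m : MeasurableSpace Ω} {g : Fin d → Ω → ℝ}
    (hg : ∀ i, Measurable (g i)) :
    Measurable fun ω => (WithLp.toLp 2 fun i => g i ω : EuclideanSpace ℝ (Fin d)) :=
  (WithLp.measurable_toLp 2 (Fin d → ℝ)).comp (measurable_pi_lambda _ hg)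

lemma measurable_gradientEstimate {m : MeasurableSpace Ω} (c : ℕ → ℝ) {n : ℕ}
    (h : ∀ j, Measurable (Z n j)) : Measurable (gradientEstimate c Z n) := by
  refine Measurable.const_smul ?_ (1 / (2 * c n))
  exact measurable_toLp_of_coord fun i => (h _).sub (h _)

lemma measurable_average {m : MeasurableSpace Ω} (c : ℕ → ℝ) {n : ℕ}
    (h : ∀ k, 1 ≤ k → k ≤ n → Measurable (Θ k)) : Measurable (average c Θ n) := by
  have h1 : Measurable fun ω => ∑ k ∈ Finset.Icc 1 n, c k ^ 2 • Θ k ω :=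
    Finset.measurable_fun_sum _ fun k hk =>
      (h k (Finset.mem_Icc.1 hk).1 (Finset.mem_Icc.1 hk).2).const_smul (c k ^ 2)
  exact h1.const_smul (∑ k ∈ Finset.Icc 1 n, c k ^ 2)⁻¹

lemma measurable_queryPoint {m : MeasurableSpace Ω} (c : ℕ → ℝ) {n : ℕ} (hn : 1 ≤ n)
    (h : ∀ k, 1 ≤ k → k ≤ n → Measurable (Θ k)) (j : Label d δ) :
    Measurable (queryPoint c Θ n j) := by
  rcases j with i | i | k
  · exact (h n hn le_rfl).add_const _
  · exact (h n hn le_rfl).sub_const _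
  · exact measurable_average c h

lemma history_mono : Monotone (history f c Θ Z) := by
  intro n n' h
  refine sup_le_sup le_rfl (biSup_mono fun k hk => ?_)
  simp only [Finset.mem_Ico] at hk ⊢
  omega

lemma measurable_noise_history {n : ℕ} (hn : 1 ≤ n) (j : Label d δ) :
    Measurable[history f c Θ Z (n + 1)] (noise f c Θ Z n j) := by
  rw [measurable_iff_comap_le]
  refine le_sup_of_le_right ?_
  refine le_iSup₂_of_le n (Finset.mem_Ico.2 ⟨hn, by omega⟩) ?_
  exact le_iSup (fun j => MeasurableSpace.comap (noise f c Θ Z n j) inferInstance) j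

variable [m0 : MeasurableSpace Ω]

namespace IsAlgorithm

lemma measurable_theta (hA : IsAlgorithm a c Θ M Z) {n : ℕ} (hn : 1 ≤ n) : Measurable (Θ n) := by
  induction n, hn using Nat.le_induction with
  | base => exact hA.measurable_init
  | succ n hn ih =>
    rw [funext (hA.step n hn)]
    exact ih.add ((measurable_gradientEstimate c (hA.measurable_obs n)).const_smul (a n))

lemma measurable_noise (hA : IsAlgorithm a c Θ M Z) (hf : Measurable f) {n : ℕ} (hn : 1 ≤ n)
    (j : Label d δ) : Measurable (noise f c Θ Z n j) :=
  (hA.measurable_obs n j).sub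
    (hf.comp (measurable_queryPoint c hn (fun _ hk _ => hA.measurable_theta hk) j))

lemma history_le (hA : IsAlgorithm a c Θ M Z) (hf : Measurable f) (n : ℕ) :
    history f c Θ Z n ≤ m0 := by
  refine sup_le hA.measurable_init.comap_le (iSup₂_le fun k hk => iSup_le fun j => ?_)
  exact (hA.measurable_noise hf (Finset.mem_Ico.1 hk).1 j).comap_le

end IsAlgorithm

/-- The past is generated by errors, not by observations. An observation is its error plus `f` at a
query point that is already measurable by induction, and the recursion then gives the next iterate.
-/
lemma IsAlgorithm.measurable_theta_history (hA : IsAlgorithm a c Θ M Z) (hf : Measurable f)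
    {n : ℕ} (hn : 1 ≤ n) : Measurable[history f c Θ Z n] (Θ n) := by
  induction n using Nat.strong_induction_on with
  | _ n ih =>
    rcases Nat.lt_or_ge n 2 with h | h
    · have : n = 1 := by omega
      subst this
      exact measurable_iff_comap_le.2 le_sup_left
    · obtain ⟨k, rfl⟩ : ∃ k, n = k + 1 := ⟨n - 1, by omega⟩
      have hk : 1 ≤ k := by omega
      have hle : ∀ l, 1 ≤ l → l ≤ k → Measurable[history f c Θ Z (k + 1)] (Θ l) :=
        fun l h1 h2 => (ih l (by omega) h1).mono (history_mono (by omega)) le_rfl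
      have hobs : ∀ j, Measurable[history f c Θ Z (k + 1)] (Z k j) := by
        intro j
        have e : Z k j = fun ω => noise f c Θ Z k j ω + f (queryPoint c Θ k j ω) := by
          ext ω; simp [noise]
        rw [e]
        exact (measurable_noise_history hk j).add
          (hf.comp (measurable_queryPoint c hk hle j))
      rw [funext (hA.step k hk)]
      exact (hle k hk le_rfl).add ((measurable_gradientEstimate c hobs).const_smul (a k))

lemma IsAlgorithm.measurable_queryPoint_history (hA : IsAlgorithm a c Θ M Z) (hf : Measurable f)
    {n : ℕ} (hn : 1 ≤ n) (j : Label d δ) :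
    Measurable[history f c Θ Z n] (queryPoint c Θ n j) :=
  measurable_queryPoint c hn (fun _ h1 h2 =>
    (hA.measurable_theta_history hf h1).mono (history_mono h2) le_rfl) j

end Measurability

namespace HasUniformNoise

lemma exists_moment_bound (h : HasUniformNoise P σ m) :
    ∃ K : ENNReal, K ≠ ⊤ ∧ ∀ x, ∫⁻ z, ‖z‖ₑ ^ m ∂(P x) ≤ K :=
  ⟨_, h.moment_lt_top.ne, fun x => le_iSup (fun x => ∫⁻ z, ‖z‖ₑ ^ m ∂(P x)) x⟩

lemma enorm_regression_le [IsMarkovKernel P] (hm : 1 ≤ m) {K : ENNReal}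
    (hK : ∀ x, ∫⁻ z, ‖z‖ₑ ^ m ∂(P x) ≤ K) (x : EuclideanSpace ℝ (Fin d)) :
    ‖regression P x‖ₑ ≤ 1 + K := by
  refine (enorm_integral_le_lintegral_enorm _).trans ?_
  calc ∫⁻ z, ‖z‖ₑ ∂(P x) ≤ ∫⁻ z, (1 + ‖z‖ₑ ^ m) ∂(P x) := by
        refine lintegral_mono fun z => ?_
        rcases le_total ‖z‖ₑ 1 with h1 | h1
        · exact h1.trans le_self_add
        · refine le_trans ?_ le_add_self
          simpa using ENNReal.rpow_le_rpow_of_exponent_le h1 hm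
    _ = 1 + ∫⁻ z, ‖z‖ₑ ^ m ∂(P x) := by
        rw [lintegral_add_left measurable_const]; simp
    _ ≤ 1 + K := by gcongr; exact hK x

/-- Bounded central moments of every order `p ≤ m`. -/
lemma exists_central_moment_bound [IsMarkovKernel P] (h : HasUniformNoise P σ m) {p : ℝ}
    (hp0 : 0 ≤ p) (hp : p ≤ m) :
    ∃ K : ENNReal, K ≠ ⊤ ∧ ∀ x, ∫⁻ z, ‖z - regression P x‖ₑ ^ p ∂(P x) ≤ K := by
  obtain ⟨K, hK, hb⟩ := h.exists_moment_bound
  have hm : 1 ≤ m := by linarith [h.two_lt]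
  set F : ENNReal := 1 + K with hF
  have hFtop : F ≠ ⊤ := by finiteness
  have hF' : F + 1 ≠ ⊤ := by finiteness
  have h2 : (2 : ENNReal) ^ (m - 1) ≠ ⊤ := by finiteness
  refine ⟨2 ^ (m - 1) * (K + (F + 1) ^ m), ?_, fun x => ?_⟩
  · have : (F + 1) ^ m ≠ ⊤ := ENNReal.rpow_ne_top_of_nonneg (by linarith) hF'
    finiteness
  calc ∫⁻ z, ‖z - regression P x‖ₑ ^ p ∂(P x)
      ≤ ∫⁻ z, 2 ^ (m - 1) * (‖z‖ₑ ^ m + (F + 1) ^ m) ∂(P x) := by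
        refine lintegral_mono fun z => ?_
        have h3 : ‖z - regression P x‖ₑ ≤ ‖z‖ₑ + (F + 1) := by
          refine (enorm_sub_le).trans ?_
          gcongr
          exact (enorm_regression_le hm hb x).trans le_self_add
        calc ‖z - regression P x‖ₑ ^ p ≤ (‖z‖ₑ + (F + 1)) ^ p :=
              ENNReal.rpow_le_rpow h3 hp0
          _ ≤ (‖z‖ₑ + (F + 1)) ^ m := by
              -- The summand `1` in `F + 1` makes the base at least `1`, so that the exponent may be
              -- raised from `p` to `m`.
              refine ENNReal.rpow_le_rpow_of_exponent_le ?_ hp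
              exact le_trans le_add_self le_add_self
          _ ≤ _ := ENNReal.rpow_add_le_mul_rpow_add_rpow _ _ hm
    _ = 2 ^ (m - 1) * (∫⁻ z, ‖z‖ₑ ^ m ∂(P x) + (F + 1) ^ m) := by
        rw [lintegral_const_mul _ (by fun_prop), lintegral_add_right _ measurable_const]
        simp
    _ ≤ _ := by gcongr; exact hb x

lemma memLp_id [IsMarkovKernel P] (h : HasUniformNoise P σ m) (x : EuclideanSpace ℝ (Fin d)) :
    MemLp id 2 (P x) := by
  obtain ⟨K, hK, hb⟩ := h.exists_moment_bound
  have hm : 0 < m := by linarith [h.two_lt]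
  have h1 : MemLp id (ENNReal.ofReal m) (P x) := by
    refine ⟨aestronglyMeasurable_id, ?_⟩
    rw [eLpNorm_lt_top_iff_lintegral_rpow_enorm_lt_top (by simpa using hm) (by simp),
      ENNReal.toReal_ofReal hm.le]
    exact (hb x).trans_lt hK.lt_top
  refine h1.mono_exponent ?_
  rw [show (2 : ENNReal) = ENNReal.ofReal 2 by simp]
  exact ENNReal.ofReal_le_ofReal h.two_lt.le

lemma integral_sub_regression [IsMarkovKernel P] (h : HasUniformNoise P σ m)
    (x : EuclideanSpace ℝ (Fin d)) : ∫ z, (z - regression P x) ∂(P x) = 0 := by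
  have h1 : Integrable (fun z : ℝ => z) (P x) := (h.memLp_id x).integrable (by norm_num)
  rw [integral_sub h1 (integrable_const _)]
  simp [regression]

lemma integral_sub_regression_sq (h : HasUniformNoise P σ m)
    (x : EuclideanSpace ℝ (Fin d)) : ∫ z, (z - regression P x) ^ 2 ∂(P x) = σ ^ 2 := by
  rw [← h.variance_eq x, variance_eq_integral aemeasurable_id]
  rfl

end HasUniformNoise

/-- The events of all other labels are taken to be the whole space; their conditional probabilities
are `1`. -/
lemma CondIndepFamily.pair {ι : Type*} [Fintype ι] [DecidableEq ι] {G : MeasurableSpace Ω}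
    [m0 : MeasurableSpace Ω] {Pr : Measure Ω} [IsFiniteMeasure Pr] (hG : G ≤ m0) {X : ι → Ω → ℝ} (h : CondIndepFamily Pr G X) {i j : ι} (hij : i ≠ j)
    {B C : Set ℝ} (hB : MeasurableSet B) (hC : MeasurableSet C) :
    Pr⟦X i ⁻¹' B ∩ X j ⁻¹' C | G⟧
      =ᵐ[Pr] fun ω => (Pr⟦X i ⁻¹' B | G⟧) ω * (Pr⟦X j ⁻¹' C | G⟧) ω := by
  set S : ι → Set ℝ := fun k => if k = i then B else if k = j then C else Set.univ with hS
  have hSi : S i = B := by simp [hS]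
  have hSj : S j = C := by simp [hS, hij.symm]
  have hSk : ∀ k, k ≠ i → k ≠ j → S k = Set.univ := fun k h1 h2 => by simp [hS, h1, h2]
  have h1 := h S fun k => by
    by_cases hi : k = i
    · rw [hi, hSi]; exact hB
    by_cases hj : k = j
    · rw [hj, hSj]; exact hC
    rw [hSk k hi hj]; exact MeasurableSet.univ
  have h2 : ⋂ k, X k ⁻¹' S k = X i ⁻¹' B ∩ X j ⁻¹' C := by
    ext ω
    simp only [Set.mem_iInter, Set.mem_inter_iff, Set.mem_preimage]
    refine ⟨fun h => ⟨hSi ▸ h i, hSj ▸ h j⟩, fun h k => ?_⟩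
    by_cases hi : k = i
    · rw [hi, hSi]; exact h.1
    by_cases hj : k = j
    · rw [hj, hSj]; exact h.2
    rw [hSk k hi hj]; trivial
  rw [h2] at h1
  refine h1.trans (Eventually.of_forall fun ω => ?_)
  have h3 : ∀ k, k ∉ ({i, j} : Finset ι) → (Pr⟦X k ⁻¹' S k | G⟧) ω = 1 := by
    intro k hk
    simp only [Finset.mem_insert, Finset.mem_singleton, not_or] at hk
    rw [hSk k hk.1 hk.2]
    simp [condExp_const hG]
  have h4 := Finset.prod_subset (Finset.subset_univ ({i, j} : Finset ι))
    (f := fun k => (Pr⟦X k ⁻¹' S k | G⟧) ω) fun k _ hk => h3 k hk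
  simp only
  rw [← h4, Finset.prod_pair hij, hSi, hSj]

/-- The observation errors of the algorithm form a `NoiseArray`. -/
lemma noiseArray [m0 : MeasurableSpace Ω] {Pr : Measure Ω} [IsProbabilityMeasure Pr] [IsMarkovKernel P] (hA : IsAlgorithm a c Θ M Z)
    (hN : HasUniformNoise P σ m) (hS : IsSampling Pr P c Θ Z) :
    NoiseArray Pr (history (regression P) c Θ Z) (noise (regression P) c Θ Z) σ (min m 3) := by
  set f := regression P with hf
  have hfm : Measurable f := measurable_regression P
  have hle := hA.history_le hfm
  -- On every event of the past, the pair of query point and observation is distributed as a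
  -- marginal composed with the kernel. All conditional moments below reduce to integrals against `P
  -- x`.
  have hjoint : ∀ n, 1 ≤ n → ∀ (j : Label d δ) A, MeasurableSet[history f c Θ Z n] A →
      (Pr.restrict A).map (fun ω => (queryPoint c Θ n j ω, Z n j ω))
        = ((Pr.restrict A).map (queryPoint c Θ n j)) ⊗ₘ P := fun n hn j A hAm =>
    map_restrict_eq_compProd (hle n) (hA.measurable_queryPoint_history hfm hn j)
      (hA.measurable_obs n j) (hS.law n hn j) hAm
  have hqm : ∀ n, 1 ≤ n → ∀ j : Label d δ, Measurable (queryPoint c Θ n j) := fun n hn j =>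
    (hA.measurable_queryPoint_history hfm hn j).mono (hle n) le_rfl
  have hnm : ∀ n, 1 ≤ n → ∀ j : Label d δ, Measurable (noise f c Θ Z n j) := fun n hn j =>
    hA.measurable_noise hfm hn j
  have hpair : ∀ n, 1 ≤ n → ∀ j : Label d δ,
      Measurable fun ω => (queryPoint c Θ n j ω, Z n j ω) := fun n hn j =>
    (hqm n hn j).prodMk (hA.measurable_obs n j)
  -- moments
  have hmom : ∀ q : ℝ, 0 ≤ q → q ≤ m → ∃ K : ENNReal, K ≠ ⊤ ∧ ∀ n, 1 ≤ n → ∀ j : Label d δ,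
      ∫⁻ ω, ‖noise f c Θ Z n j ω‖ₑ ^ q ∂Pr ≤ K := by
    intro q hq0 hqm'
    obtain ⟨K, hK, hb⟩ := hN.exists_central_moment_bound hq0 hqm'
    refine ⟨K, hK, fun n hn j => ?_⟩
    have h1 := hjoint n hn j Set.univ MeasurableSet.univ
    rw [Measure.restrict_univ] at h1
    have hmeas : Measurable fun y : EuclideanSpace ℝ (Fin d) × ℝ => ‖y.2 - f y.1‖ₑ ^ q := by
      fun_prop
    have h2 : ∫⁻ ω, ‖noise f c Θ Z n j ω‖ₑ ^ q ∂Pr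
        = ∫⁻ y, ‖y.2 - f y.1‖ₑ ^ q ∂(Pr.map fun ω => (queryPoint c Θ n j ω, Z n j ω)) := by
      rw [lintegral_map hmeas (hpair n hn j)]; rfl
    rw [h2, h1, Measure.lintegral_compProd hmeas]
    have : IsProbabilityMeasure (Pr.map (queryPoint c Θ n j)) :=
      Measure.isProbabilityMeasure_map (hqm n hn j).aemeasurable
    calc _ ≤ ∫⁻ _, K ∂(Pr.map (queryPoint c Θ n j)) := lintegral_mono fun x => hb x
      _ = K := by simp
  have h2m : (2 : ℝ) < m := hN.two_lt
  have hL2 : ∀ n, 1 ≤ n → ∀ j : Label d δ, MemLp (noise f c Θ Z n j) 2 Pr := by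
    intro n hn j
    obtain ⟨K, hK, hb⟩ := hmom 2 (by norm_num) h2m.le
    refine ⟨(hnm n hn j).aestronglyMeasurable, ?_⟩
    rw [eLpNorm_lt_top_iff_lintegral_rpow_enorm_lt_top (by simp) (by simp)]
    exact (hb n hn j).trans_lt hK.lt_top
  have hset : ∀ n, 1 ≤ n → ∀ (j : Label d δ) A, MeasurableSet[history f c Θ Z n] A →
      ∫ ω in A, noise f c Θ Z n j ω ∂Pr = 0 := by
    intro n hn j A hAm
    have hmeas : Measurable fun y : EuclideanSpace ℝ (Fin d) × ℝ => y.2 - f y.1 := by fun_prop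
    have hi : Integrable (fun y : EuclideanSpace ℝ (Fin d) × ℝ => y.2 - f y.1)
        ((Pr.restrict A).map fun ω => (queryPoint c Θ n j ω, Z n j ω)) :=
      (integrable_map_measure hmeas.aestronglyMeasurable (hpair n hn j).aemeasurable).2
        ((hL2 n hn j).integrable (by norm_num)).integrableOn
    have h2 : ∫ ω in A, noise f c Θ Z n j ω ∂Pr = ∫ y, (y.2 - f y.1)
        ∂((Pr.restrict A).map fun ω => (queryPoint c Θ n j ω, Z n j ω)) := by
      rw [integral_map (hpair n hn j).aemeasurable hmeas.aestronglyMeasurable]; rfl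
    rw [hjoint n hn j A hAm] at hi h2
    rw [h2, Measure.integral_compProd hi]
    simp [hf, hN.integral_sub_regression]
  have hset2 : ∀ n, 1 ≤ n → ∀ (j : Label d δ) A, MeasurableSet[history f c Θ Z n] A →
      ∫ ω in A, noise f c Θ Z n j ω ^ 2 ∂Pr = ∫ ω in A, σ ^ 2 ∂Pr := by
    intro n hn j A hAm
    have hmeas : Measurable fun y : EuclideanSpace ℝ (Fin d) × ℝ => (y.2 - f y.1) ^ 2 := by
      fun_prop
    have hi : Integrable (fun y : EuclideanSpace ℝ (Fin d) × ℝ => (y.2 - f y.1) ^ 2)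
        ((Pr.restrict A).map fun ω => (queryPoint c Θ n j ω, Z n j ω)) :=
      (integrable_map_measure hmeas.aestronglyMeasurable (hpair n hn j).aemeasurable).2
        (hL2 n hn j).integrable_sq.integrableOn
    have h2 : ∫ ω in A, noise f c Θ Z n j ω ^ 2 ∂Pr = ∫ y, (y.2 - f y.1) ^ 2
        ∂((Pr.restrict A).map fun ω => (queryPoint c Θ n j ω, Z n j ω)) := by
      rw [integral_map (hpair n hn j).aemeasurable hmeas.aestronglyMeasurable]; rfl
    rw [hjoint n hn j A hAm] at hi h2
    rw [h2, Measure.integral_compProd hi]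
    simp only [hf, hN.integral_sub_regression_sq]
    rw [integral_map (hqm n hn j).aemeasurable aestronglyMeasurable_const]
  have hbdd : ∀ {n : ℕ} {W X : Ω → ℝ}, Measurable[history f c Θ Z n] W →
      (∃ C, ∀ ω, |W ω| ≤ C) → Integrable X Pr → Integrable (fun ω => W ω * X ω) Pr := by
    rintro n W X hW ⟨C, hC⟩ hX
    exact hX.bdd_mul (hW.mono (hle n) le_rfl).aestronglyMeasurable (Eventually.of_forall hC)
  refine ⟨hle, history_mono, fun n hn j => measurable_noise_history hn j, hL2, ?_, ?_, ?_,
    lt_min h2m (by norm_num), min_le_right _ _, ?_⟩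
  · intro n hn j W hW hC
    have hi := (hL2 n hn j).integrable (by norm_num)
    exact integral_mul_eq_zero_of_setIntegral_eq_zero (hle n) hi (hset n hn j)
      hW.stronglyMeasurable (hbdd hW hC hi)
  · intro n hn j W hW hC
    have hi := (hL2 n hn j).integrable_sq
    have hi' : Integrable (fun ω => noise f c Θ Z n j ω ^ 2 - σ ^ 2) Pr :=
      hi.sub (integrable_const _)
    have h1 := integral_mul_eq_zero_of_setIntegral_eq_zero (hle n) hi' (fun A hAm => by
      rw [integral_sub hi.integrableOn (integrable_const _).integrableOn, hset2 n hn j A hAm,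
        sub_self]) hW.stronglyMeasurable (hbdd hW hC hi')
    have h2 : ∫ ω, W ω * (noise f c Θ Z n j ω ^ 2 - σ ^ 2) ∂Pr
        = ∫ ω, W ω * noise f c Θ Z n j ω ^ 2 ∂Pr - ∫ ω, W ω * σ ^ 2 ∂Pr := by
      rw [← integral_sub (hbdd hW hC hi) (hbdd hW hC (integrable_const _))]
      simp only [mul_sub]
    rw [h2, integral_mul_const] at h1
    linarith
  · intro n hn i j hij W hW hC
    classical
    have hi : Integrable (fun ω => noise f c Θ Z n i ω * noise f c Θ Z n j ω) Pr :=
      (hL2 n hn i).integrable_mul (hL2 n hn j)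
    refine integral_mul_eq_zero_of_setIntegral_eq_zero (hle n) hi (fun A hAm => ?_)
      hW.stronglyMeasurable (hbdd hW hC hi)
    exact setIntegral_mul_eq_zero_of_condIndep (hle n) (hnm n hn j) (hnm n hn i) (hL2 n hn j)
      (hL2 n hn i) (hset n hn j)
      (fun B C hB hC => (hS.condIndep n hn).pair (hle n) hij.symm hB hC) hAm
  · have hp0 : 0 ≤ min m 3 := le_min (by linarith) (by norm_num)
    obtain ⟨K, hK, hb⟩ := hmom (min m 3) hp0 (min_le_left _ _)
    refine ⟨K.toReal, fun n hn j => ?_⟩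
    have e : ∀ ω, ENNReal.ofReal (|noise f c Θ Z n j ω| ^ min m 3)
        = ‖noise f c Θ Z n j ω‖ₑ ^ min m 3 := fun ω => by
      rw [← ENNReal.ofReal_rpow_of_nonneg (abs_nonneg _) hp0, ← Real.norm_eq_abs,
        ofReal_norm]
    have hms : AEStronglyMeasurable (fun ω => |noise f c Θ Z n j ω| ^ min m 3) Pr :=
      (((hnm n hn j).norm).pow_const _).aestronglyMeasurable
    have hlin : ∫⁻ ω, ENNReal.ofReal (|noise f c Θ Z n j ω| ^ min m 3) ∂Pr ≤ K := by
      simp only [e]; exact hb n hn j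
    refine ⟨⟨hms, ?_⟩, ?_⟩
    · rw [hasFiniteIntegral_iff_ofReal (Eventually.of_forall fun ω => by positivity)]
      exact hlin.trans_lt hK.lt_top
    · rw [integral_eq_lintegral_of_nonneg_ae (Eventually.of_forall fun ω => by positivity) hms]
      exact ENNReal.toReal_mono hK hlin

end

/-! ### A central limit theorem by characteristic functions. -/

section

section ExpExpansion

lemma norm_le_mul_of_hasDerivAt {u u' : ℝ → ℂ} (hu : ∀ s, HasDerivAt u (u' s) s) (h0 : u 0 = 0)
    {y C : ℝ} (hC : ∀ s, |s| ≤ |y| → ‖u' s‖ ≤ C) : ‖u y‖ ≤ C * |y| := by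
  have h := (convex_Icc (-|y|) |y|).norm_image_sub_le_of_norm_hasDerivWithin_le
    (f := u) (f' := u') (C := C) (fun x _ => (hu x).hasDerivWithinAt)
    (fun x hx => hC x (abs_le.2 hx)) (show (0 : ℝ) ∈ Set.Icc (-|y|) |y| by simp)
    (show y ∈ Set.Icc (-|y|) |y| from abs_le.1 le_rfl)
  simpa [h0] using h

lemma hasDerivAt_cexp_mul_I (s : ℝ) :
    HasDerivAt (fun s : ℝ => Complex.exp (s * Complex.I))
      (Complex.I * Complex.exp (s * Complex.I)) s := by
  have h1 : HasDerivAt (fun s : ℝ => (s : ℂ) * Complex.I) Complex.I s := by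
    simpa using (Complex.ofRealCLM.hasDerivAt (x := s)).mul_const Complex.I
  rw [mul_comm]
  exact h1.cexp

lemma hasDerivAt_ofReal (s : ℝ) : HasDerivAt (fun s : ℝ => (s : ℂ)) 1 s :=
  Complex.ofRealCLM.hasDerivAt

lemma norm_cexp_sub_one_le (y : ℝ) : ‖Complex.exp (y * Complex.I) - 1‖ ≤ |y| := by
  refine (norm_le_mul_of_hasDerivAt (u := fun s : ℝ => Complex.exp (s * Complex.I) - 1)
    (C := 1) (fun s => (hasDerivAt_cexp_mul_I s).sub_const 1) (by simp) (fun s _ => ?_)).trans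
      (by simp)
  simp [Complex.norm_exp_ofReal_mul_I]

lemma norm_cexp_sub_linear_le (y : ℝ) :
    ‖Complex.exp (y * Complex.I) - 1 - y * Complex.I‖ ≤ |y| * |y| := by
  refine norm_le_mul_of_hasDerivAt
    (u := fun s : ℝ => Complex.exp (s * Complex.I) - 1 - s * Complex.I)
    (u' := fun s => Complex.I * Complex.exp (s * Complex.I) - 1 * Complex.I)
    (fun s => ((hasDerivAt_cexp_mul_I s).sub_const 1).sub
      ((hasDerivAt_ofReal s).mul_const Complex.I)) (by simp) (fun s hs => ?_)
  rw [one_mul, ← mul_sub_one, norm_mul, Complex.norm_I, one_mul]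
  exact (norm_cexp_sub_one_le s).trans hs

/-- The derivative of each Taylor remainder of `exp(is)` is `i` times the preceding one, so every
bound follows from the previous one and the mean value inequality. -/
lemma norm_cexp_sub_quadratic_le (y : ℝ) :
    ‖Complex.exp (y * Complex.I) - 1 - y * Complex.I + (y : ℂ) ^ 2 / 2‖ ≤ |y| * |y| * |y| := by
  refine norm_le_mul_of_hasDerivAt
    (u := fun s : ℝ => Complex.exp (s * Complex.I) - 1 - s * Complex.I + (s : ℂ) ^ 2 / 2)
    (u' := fun s => Complex.I * Complex.exp (s * Complex.I) - 1 * Complex.I + s)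
    (fun s => ?_) (by simp) (fun s hs => ?_)
  · refine (((hasDerivAt_cexp_mul_I s).sub_const 1).sub
      ((hasDerivAt_ofReal s).mul_const Complex.I)).add ?_
    refine (((hasDerivAt_ofReal s).pow 2).div_const 2).congr_deriv ?_
    simp
  · have e : Complex.I * Complex.exp (s * Complex.I) - 1 * Complex.I + s
        = Complex.I * (Complex.exp (s * Complex.I) - 1 - s * Complex.I) := by
      ring_nf
      simp
    rw [e, norm_mul, Complex.norm_I, one_mul]
    refine (norm_cexp_sub_linear_le s).trans ?_
    gcongr

/-- Second order expansion of `exp (i y)` with an error of order `|y|^p`, `2 ≤ p ≤ 3`. -/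
lemma norm_cexp_sub_quadratic_le_rpow {p : ℝ} (hp : 2 ≤ p) (hp3 : p ≤ 3) (y : ℝ) :
    ‖Complex.exp (y * Complex.I) - 1 - y * Complex.I + (y : ℂ) ^ 2 / 2‖ ≤ 2 * |y| ^ p := by
  rcases le_total |y| 1 with h | h
  · rcases (abs_nonneg y).eq_or_lt with h0 | h0
    · have hy : y = 0 := abs_eq_zero.1 h0.symm
      subst hy
      have : (0 : ℝ) ≤ 2 * |0| ^ p := by positivity
      simpa using this
    · have h1 : |y| ^ (3 : ℝ) ≤ |y| ^ p := Real.rpow_le_rpow_of_exponent_ge h0 h hp3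
      have h2 : |y| ^ (3 : ℝ) = |y| * |y| * |y| := by
        rw [Real.rpow_ofNat]; ring
      rw [h2] at h1
      have h3 : 0 ≤ |y| ^ p := by positivity
      have := norm_cexp_sub_quadratic_le y
      linarith
  · have h1 : |y| ^ (2 : ℝ) ≤ |y| ^ p := Real.rpow_le_rpow_of_exponent_le h hp
    have h2 : |y| ^ (2 : ℝ) = |y| * |y| := by
      rw [Real.rpow_ofNat]; ring
    rw [h2] at h1
    have h3 : ‖(y : ℂ) ^ 2 / 2‖ = |y| * |y| / 2 := by
      simp [pow_two]
    have h4 := norm_add_le (Complex.exp (y * Complex.I) - 1 - y * Complex.I) ((y : ℂ) ^ 2 / 2)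
    have h5 := norm_cexp_sub_linear_le y
    rw [h3] at h4
    have h6 : 0 ≤ |y| * |y| := by positivity
    linarith

end ExpExpansion

namespace NoiseArray
variable {Ω : Type*} [m0 : MeasurableSpace Ω] {Pr : Measure Ω} [IsProbabilityMeasure Pr]
  {ι : Type*} [Fintype ι] {G : ℕ → MeasurableSpace Ω} {ξ : ℕ → ι → Ω → ℝ} {σ p : ℝ}

lemma bdd_mul (h : NoiseArray Pr G ξ σ p) {n : ℕ} {W X : Ω → ℝ} (hW : Measurable[G n] W)
    (hC : ∃ C, ∀ ω, |W ω| ≤ C) (hX : Integrable X Pr) :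
    Integrable (fun ω => W ω * X ω) Pr := by
  obtain ⟨C, hC⟩ := hC
  exact hX.bdd_mul (hW.mono (h.le n) le_rfl).aestronglyMeasurable (Eventually.of_forall hC)

/-- Linear combinations of the errors of one step. -/
def comb (ξ : ℕ → ι → Ω → ℝ) (n : ℕ) (w : ι → ℝ) (ω : Ω) : ℝ := ∑ j, w j * ξ n j ω

lemma measurable_comb (h : NoiseArray Pr G ξ σ p) {n : ℕ} (hn : 1 ≤ n) (w : ι → ℝ) :
    Measurable[G (n + 1)] (comb ξ n w) :=
  Finset.measurable_fun_sum _ fun j _ => (h.measurable n hn j).const_mul (w j)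

lemma memLp_comb (h : NoiseArray Pr G ξ σ p) {n : ℕ} (hn : 1 ≤ n) (w : ι → ℝ) :
    MemLp (comb ξ n w) 2 Pr :=
  memLp_finsetSum (f := fun j ω => w j * ξ n j ω) _ fun j _ => (h.memLp n hn j).const_mul (w j)

lemma integral_mul_comb (h : NoiseArray Pr G ξ σ p) {n : ℕ} (hn : 1 ≤ n) (w : ι → ℝ)
    {W : Ω → ℝ} (hW : Measurable[G n] W) (hC : ∃ C, ∀ ω, |W ω| ≤ C) :
    ∫ ω, W ω * comb ξ n w ω ∂Pr = 0 := by
  have e : ∀ ω, W ω * comb ξ n w ω = ∑ j, w j * (W ω * ξ n j ω) := fun ω => by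
    rw [comb, Finset.mul_sum]
    exact Finset.sum_congr rfl fun j _ => by ring
  simp_rw [e]
  rw [integral_finsetSum _ fun j _ =>
    (h.bdd_mul hW hC ((h.memLp n hn j).integrable (by norm_num))).const_mul (w j)]
  refine Finset.sum_eq_zero fun j _ => ?_
  rw [integral_const_mul, h.mean n hn j W hW hC, mul_zero]

lemma integral_mul_comb_mul_comb (h : NoiseArray Pr G ξ σ p) {n : ℕ} (hn : 1 ≤ n) (w w' : ι → ℝ)
    {W : Ω → ℝ} (hW : Measurable[G n] W) (hC : ∃ C, ∀ ω, |W ω| ≤ C) :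
    ∫ ω, W ω * (comb ξ n w ω * comb ξ n w' ω) ∂Pr = σ ^ 2 * (∑ j, w j * w' j) * ∫ ω, W ω ∂Pr := by
  classical
  have e : ∀ ω, W ω * (comb ξ n w ω * comb ξ n w' ω)
      = ∑ i, ∑ j, (w i * w' j) * (W ω * (ξ n i ω * ξ n j ω)) := fun ω => by
    rw [comb, comb, Finset.sum_mul_sum, Finset.mul_sum]
    refine Finset.sum_congr rfl fun i _ => ?_
    rw [Finset.mul_sum]
    exact Finset.sum_congr rfl fun j _ => by ring
  have hint : ∀ i j, Integrable (fun ω => (w i * w' j) * (W ω * (ξ n i ω * ξ n j ω))) Pr :=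
    fun i j => (h.bdd_mul hW hC ((h.memLp n hn i).integrable_mul (h.memLp n hn j))).const_mul _
  simp_rw [e]
  rw [integral_finsetSum _ fun i _ => integrable_finsetSum _ fun j _ => hint i j, Finset.mul_sum,
    Finset.sum_mul]
  refine Finset.sum_congr rfl fun i _ => ?_
  rw [integral_finsetSum _ fun j _ => hint i j, Finset.sum_eq_single i]
  · rw [integral_const_mul]
    have := h.var n hn i W hW hC
    simp only [pow_two (ξ n i _)] at this
    rw [this]
    ring
  · intro j _ hj
    rw [integral_const_mul, h.cov n hn i j hj.symm W hW hC, mul_zero]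
  · simp

lemma abs_comb_rpow_le (h : NoiseArray Pr G ξ σ p) (n : ℕ) (w : ι → ℝ) (ω : Ω) :
    |comb ξ n w ω| ^ p
      ≤ (Fintype.card ι : ℝ) ^ (p - 1) * ∑ j, |w j| ^ p * |ξ n j ω| ^ p := by
  have hp : 1 ≤ p := by linarith [h.two_lt]
  have h1 := Real.rpow_sum_le_const_mul_sum_rpow Finset.univ (fun j => w j * ξ n j ω) hp
  simp only [abs_mul, Real.mul_rpow (abs_nonneg _) (abs_nonneg _), Finset.card_univ] at h1
  refine le_trans ?_ h1
  refine Real.rpow_le_rpow (abs_nonneg _) ?_ (by linarith)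
  rw [comb]
  refine (Finset.abs_sum_le_sum_abs _ _).trans ?_
  simp [abs_mul]

lemma integrable_abs_comb_rpow (h : NoiseArray Pr G ξ σ p) {n : ℕ} (hn : 1 ≤ n) (w : ι → ℝ) :
    Integrable (fun ω => |comb ξ n w ω| ^ p) Pr := by
  obtain ⟨C, hC⟩ := h.moment
  have h1 : Integrable (fun ω =>
      (Fintype.card ι : ℝ) ^ (p - 1) * ∑ j, |w j| ^ p * |ξ n j ω| ^ p) Pr :=
    (integrable_finsetSum _ fun j _ => ((hC n hn j).1.const_mul (|w j| ^ p))).const_mul _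
  refine h1.mono' ?_ (Eventually.of_forall fun ω => ?_)
  · have := ((h.measurable_comb hn w).mono (h.le _) le_rfl)
    exact (this.norm.pow_const p).aestronglyMeasurable
  · rw [Real.norm_of_nonneg (by positivity)]
    exact h.abs_comb_rpow_le n w ω

/-- This is Lyapunov's condition: `|w_j|^p ≤ b^{p-2} w_j²` leaves the sum of squares, which stays
bounded in the limit theorem, and a factor that vanishes with `b`. -/
lemma exists_moment_comb_le (h : NoiseArray Pr G ξ σ p) :
    ∃ K, 0 ≤ K ∧ ∀ n, 1 ≤ n → ∀ (w : ι → ℝ) (b : ℝ), (∀ j, |w j| ≤ b) →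
      ∫ ω, |comb ξ n w ω| ^ p ∂Pr ≤ K * b ^ (p - 2) * ∑ j, w j ^ 2 := by
  obtain ⟨C, hC⟩ := h.moment
  have hp2 : 0 ≤ p - 2 := by linarith [h.two_lt]
  refine ⟨(Fintype.card ι : ℝ) ^ (p - 1) * max C 0, by positivity, fun n hn w b hb => ?_⟩
  have h1 : Integrable (fun ω =>
      (Fintype.card ι : ℝ) ^ (p - 1) * ∑ j, |w j| ^ p * |ξ n j ω| ^ p) Pr :=
    (integrable_finsetSum _ fun j _ => ((hC n hn j).1.const_mul (|w j| ^ p))).const_mul _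
  calc ∫ ω, |comb ξ n w ω| ^ p ∂Pr
      ≤ ∫ ω, (Fintype.card ι : ℝ) ^ (p - 1) * ∑ j, |w j| ^ p * |ξ n j ω| ^ p ∂Pr :=
        integral_mono (h.integrable_abs_comb_rpow hn w) h1 (h.abs_comb_rpow_le n w)
    _ = (Fintype.card ι : ℝ) ^ (p - 1) * ∑ j, |w j| ^ p * ∫ ω, |ξ n j ω| ^ p ∂Pr := by
        rw [integral_const_mul, integral_finsetSum _ fun j _ => (hC n hn j).1.const_mul _]
        simp only [integral_const_mul]
    _ ≤ (Fintype.card ι : ℝ) ^ (p - 1) * ∑ j, (b ^ (p - 2) * w j ^ 2) * max C 0 := by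
        refine mul_le_mul_of_nonneg_left (Finset.sum_le_sum fun j _ => ?_) (by positivity)
        have hb0 : 0 ≤ b := (abs_nonneg _).trans (hb j)
        refine mul_le_mul ?_ ((hC n hn j).2.trans (le_max_left _ _))
          (integral_nonneg fun ω => by positivity) (by positivity)
        · have e : |w j| ^ p = |w j| ^ (p - 2) * w j ^ 2 := by
            rcases (abs_nonneg (w j)).eq_or_lt with h0 | h0
            · rw [← h0, abs_eq_zero.1 h0.symm, Real.zero_rpow (by linarith)]
              simp
            · rw [← sq_abs, ← Real.rpow_natCast, ← Real.rpow_add h0]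
              norm_num
          rw [e]
          gcongr
          exact hb j
    _ = _ := by
        rw [← Finset.sum_mul, ← Finset.mul_sum]; ring

/-- The effect of one step on the characteristic function. -/
lemma norm_integral_cexp_sub_le (h : NoiseArray Pr G ξ σ p) {n : ℕ} (hn : 1 ≤ n) (w : ι → ℝ)
    {U : Ω → ℝ} (hU : Measurable[G n] U) :
    ‖∫ ω, Complex.exp ((U ω + comb ξ n w ω : ℝ) * Complex.I) ∂Pr
        - (1 - (σ ^ 2 * ∑ j, w j ^ 2 : ℝ) / 2) * ∫ ω, Complex.exp (U ω * Complex.I) ∂Pr‖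
      ≤ 2 * ∫ ω, |comb ξ n w ω| ^ p ∂Pr := by
  set Y := comb ξ n w with hY
  have hUm : Measurable U := hU.mono (h.le n) le_rfl
  have hYm : Measurable Y := (h.measurable_comb hn w).mono (h.le _) le_rfl
  have hY2 : MemLp Y 2 Pr := h.memLp_comb hn w
  have hYi : Integrable Y Pr := hY2.integrable (by norm_num)
  have hYsq : Integrable (fun ω => Y ω * Y ω) Pr := hY2.integrable_mul hY2
  -- The real and imaginary parts of `exp(iU)` are bounded functions of the past. Against them the
  -- linear term of the expansion integrates to `0` and the quadratic one to the constant
  -- conditional variance.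
  have hcos : Measurable[G n] fun ω => Real.cos (U ω) := Real.measurable_cos.comp hU
  have hsin : Measurable[G n] fun ω => Real.sin (U ω) := Real.measurable_sin.comp hU
  have bcos : ∃ C, ∀ ω, |Real.cos (U ω)| ≤ C := ⟨1, fun ω => Real.abs_cos_le_one _⟩
  have bsin : ∃ C, ∀ ω, |Real.sin (U ω)| ≤ C := ⟨1, fun ω => Real.abs_sin_le_one _⟩
  have hexp : ∀ ω, Complex.exp (U ω * Complex.I)
      = (Real.cos (U ω) : ℂ) + (Real.sin (U ω) : ℂ) * Complex.I := fun ω => by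
    rw [Complex.exp_mul_I, Complex.ofReal_cos, Complex.ofReal_sin]
  -- integrals against `exp (i U)` of real functions
  have key : ∀ X : Ω → ℝ, Integrable X Pr → Integrable (fun ω => Complex.exp (U ω * Complex.I)
      * (X ω : ℂ)) Pr ∧ ∫ ω, Complex.exp (U ω * Complex.I) * (X ω : ℂ) ∂Pr
      = ((∫ ω, Real.cos (U ω) * X ω ∂Pr : ℝ) : ℂ)
        + ((∫ ω, Real.sin (U ω) * X ω ∂Pr : ℝ) : ℂ) * Complex.I := by
    intro X hX
    have i1 := (h.bdd_mul hcos bcos hX).ofReal (𝕜 := ℂ)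
    have i2 := ((h.bdd_mul hsin bsin hX).ofReal (𝕜 := ℂ)).mul_const Complex.I
    have e : ∀ ω, Complex.exp (U ω * Complex.I) * (X ω : ℂ)
        = ((Real.cos (U ω) * X ω : ℝ) : ℂ) + ((Real.sin (U ω) * X ω : ℝ) : ℂ) * Complex.I := by
      intro ω
      rw [hexp]
      push_cast
      ring
    simp_rw [e]
    refine ⟨i1.add i2, ?_⟩
    have e2 := integral_add i1 i2
    have e3 : ∫ ω, ((Real.sin (U ω) * X ω : ℝ) : ℂ) * Complex.I ∂Pr
        = (∫ ω, ((Real.sin (U ω) * X ω : ℝ) : ℂ) ∂Pr) * Complex.I := integral_mul_const _ _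
    have e4 : ∫ ω, ((Real.cos (U ω) * X ω : ℝ) : ℂ) ∂Pr
        = ((∫ ω, Real.cos (U ω) * X ω ∂Pr : ℝ) : ℂ) := integral_ofReal
    have e5 : ∫ ω, ((Real.sin (U ω) * X ω : ℝ) : ℂ) ∂Pr
        = ((∫ ω, Real.sin (U ω) * X ω ∂Pr : ℝ) : ℂ) := integral_ofReal
    rw [← e4, ← e5, ← e3]
    exact e2
  obtain ⟨i0, k0⟩ := key (fun _ => 1) (integrable_const 1)
  obtain ⟨i1, k1⟩ := key Y hYi
  obtain ⟨i2, k2⟩ := key (fun ω => Y ω * Y ω) hYsq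
  rw [h.integral_mul_comb hn w hcos bcos, h.integral_mul_comb hn w hsin bsin] at k1
  rw [h.integral_mul_comb_mul_comb hn w w hcos bcos,
    h.integral_mul_comb_mul_comb hn w w hsin bsin] at k2
  simp only [mul_one, Complex.ofReal_one] at k0 i0
  have hv : ∑ j, w j * w j = ∑ j, w j ^ 2 := Finset.sum_congr rfl fun j _ => by ring
  rw [hv] at k2
  set v := σ ^ 2 * ∑ j, w j ^ 2 with hvdef
  have hi3 : Integrable (fun ω => Complex.exp ((U ω + Y ω : ℝ) * Complex.I)) Pr := by
    refine Integrable.of_bound (by fun_prop) 1 (Eventually.of_forall fun ω => ?_)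
    rw [Complex.norm_exp_ofReal_mul_I]
  have hpoly : (1 - (v : ℂ) / 2) * ∫ ω, Complex.exp (U ω * Complex.I) ∂Pr
      = ∫ ω, (Complex.exp (U ω * Complex.I)
        + Complex.exp (U ω * Complex.I) * (Y ω : ℂ) * Complex.I
        - Complex.exp (U ω * Complex.I) * ((Y ω * Y ω : ℝ) : ℂ) * (1 / 2)) ∂Pr := by
    have e1 : ∫ ω, Complex.exp (U ω * Complex.I) * (Y ω : ℂ) * Complex.I ∂Pr
        = (∫ ω, Complex.exp (U ω * Complex.I) * (Y ω : ℂ) ∂Pr) * Complex.I :=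
      integral_mul_const _ _
    have e2 : ∫ ω, Complex.exp (U ω * Complex.I) * ((Y ω * Y ω : ℝ) : ℂ) * (1 / 2) ∂Pr
        = (∫ ω, Complex.exp (U ω * Complex.I) * ((Y ω * Y ω : ℝ) : ℂ) ∂Pr) * (1 / 2) :=
      integral_mul_const _ _
    have i1' := i1.mul_const Complex.I
    have i2' := i2.mul_const (1 / 2 : ℂ)
    have e3 := integral_add i0 i1'
    have e4 := integral_sub (i0.add i1') i2'
    refine Eq.trans ?_ e4.symm
    refine Eq.trans ?_ (congrArg₂ (· - ·) e3.symm rfl)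
    rw [e1, e2, k1, k2, k0]
    push_cast
    ring
  have hi4 : Integrable (fun ω => Complex.exp (U ω * Complex.I)
      + Complex.exp (U ω * Complex.I) * (Y ω : ℂ) * Complex.I
      - Complex.exp (U ω * Complex.I) * ((Y ω * Y ω : ℝ) : ℂ) * (1 / 2)) Pr :=
    (i0.add (i1.mul_const Complex.I)).sub (i2.mul_const (1 / 2 : ℂ))
  rw [hpoly, ← integral_sub hi3 hi4, ← integral_const_mul]
  refine (norm_integral_le_integral_norm _).trans
    (integral_mono_of_nonneg (Eventually.of_forall fun ω => norm_nonneg _)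
      ((h.integrable_abs_comb_rpow hn w).const_mul 2) (Eventually.of_forall fun ω => ?_))
  have e : Complex.exp ((U ω + Y ω : ℝ) * Complex.I)
      - (Complex.exp (U ω * Complex.I) + Complex.exp (U ω * Complex.I) * (Y ω : ℂ) * Complex.I
        - Complex.exp (U ω * Complex.I) * ((Y ω * Y ω : ℝ) : ℂ) * (1 / 2))
      = Complex.exp (U ω * Complex.I)
        * (Complex.exp (Y ω * Complex.I) - 1 - Y ω * Complex.I + (Y ω : ℂ) ^ 2 / 2) := by
    rw [Complex.ofReal_add, add_mul, Complex.exp_add]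
    push_cast
    ring
  simp only
  rw [e, norm_mul, Complex.norm_exp_ofReal_mul_I, one_mul]
  exact norm_cexp_sub_quadratic_le_rpow h.two_lt.le h.le_three _

lemma norm_one_sub_half_sub_exp_le {v : ℝ} (hv : 0 ≤ v) (hv2 : v ≤ 2) :
    ‖(1 - (v : ℂ) / 2) - (Real.exp (-(v / 2)) : ℂ)‖ ≤ v * v := by
  have h1 := Real.abs_exp_sub_one_sub_id_le (x := -(v / 2))
    (by rw [abs_neg, abs_of_nonneg (by positivity)]; linarith)
  have e : (1 - (v : ℂ) / 2) - (Real.exp (-(v / 2)) : ℂ)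
      = ((-(Real.exp (-(v / 2)) - 1 - -(v / 2)) : ℝ) : ℂ) := by
    push_cast; ring
  rw [e, Complex.norm_real, Real.norm_eq_abs, abs_neg]
  nlinarith

/-- Central limit theorem for linear combinations of the errors, in terms of characteristic
functions. -/
theorem tendsto_integral_cexp_sum (h : NoiseArray Pr G ξ σ p) {w : ℕ → ℕ → ι → ℝ} {b : ℕ → ℝ}
    (hb0 : ∀ n, 0 ≤ b n) (hwb : ∀ n k, 1 ≤ k → k ≤ n → ∀ j, |w n k j| ≤ b n)
    (hb : Tendsto b atTop (𝓝 0)) {V : ℝ}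
    (hV : Tendsto (fun n => ∑ k ∈ Finset.Icc 1 n, ∑ j, w n k j ^ 2) atTop (𝓝 V)) :
    Tendsto (fun n => ∫ ω, Complex.exp
      ((∑ k ∈ Finset.Icc 1 n, comb ξ k (w n k) ω : ℝ) * Complex.I) ∂Pr) atTop
      (𝓝 (Complex.exp (-(σ ^ 2 * V / 2 : ℝ)))) := by
  obtain ⟨K, hK0, hK⟩ := h.exists_moment_comb_le
  set N : ℝ := (Fintype.card ι : ℝ) with hN
  have hp2 : 0 < p - 2 := by linarith [h.two_lt]
  set q : ℕ → ℕ → ℝ := fun n k => ∑ j, w n k j ^ 2 with hq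
  have hq0 : ∀ n k, 0 ≤ q n k := fun n k => Finset.sum_nonneg fun j _ => sq_nonneg _
  have hqb : ∀ n k, 1 ≤ k → k ≤ n → q n k ≤ N * b n ^ 2 := fun n k h1 h2 => by
    calc q n k ≤ ∑ _j : ι, b n ^ 2 := Finset.sum_le_sum fun j _ => by
          rw [← sq_abs]
          exact pow_le_pow_left₀ (abs_nonneg _) (hwb n k h1 h2 j) 2
      _ = N * b n ^ 2 := by simp [hN]
  -- The error of one step, per unit of squared weights: the first summand is the moment bound of
  -- order `p`, the second the error of replacing `1 - v/2` by `exp(-v/2)`.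
  set ε : ℕ → ℝ := fun n => 2 * K * b n ^ (p - 2) + σ ^ 4 * (N * b n ^ 2) with hε
  have hb2 : Tendsto (fun n => N * b n ^ 2) atTop (𝓝 0) := by
    simpa using (hb.pow 2).const_mul N
  have hε0 : Tendsto ε atTop (𝓝 0) := by
    have h1 := (hb.rpow_const (p := p - 2) (Or.inr hp2.le)).const_mul (2 * K)
    rw [Real.zero_rpow hp2.ne', mul_zero] at h1
    simpa using h1.add (hb2.const_mul (σ ^ 4))
  have hsmall : ∀ᶠ n in atTop, σ ^ 2 * (N * b n ^ 2) < 2 := by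
    have := hb2.const_mul (σ ^ 2)
    rw [mul_zero] at this
    exact this.eventually (gt_mem_nhds (by norm_num))
  -- Induction over the steps of one row: each adds at most `ε n * q n k` to the distance from the
  -- Gaussian characteristic function, so that the total error is `ε n` times a convergent sum.
  have hind : ∀ᶠ n in atTop, ∀ k, k ≤ n →
      ‖∫ ω, Complex.exp ((∑ l ∈ Finset.Icc 1 k, comb ξ l (w n l) ω : ℝ) * Complex.I) ∂Pr
        - (Real.exp (-(σ ^ 2 * (∑ l ∈ Finset.Icc 1 k, q n l) / 2)) : ℂ)‖
      ≤ ε n * ∑ l ∈ Finset.Icc 1 k, q n l := by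
    filter_upwards [hsmall] with n hn k
    induction k with
    | zero => intro _; simp
    | succ k ih =>
      intro hk
      have ih := ih (by omega)
      have hk1 : 1 ≤ k + 1 := by omega
      set U : Ω → ℝ := fun ω => ∑ l ∈ Finset.Icc 1 k, comb ξ l (w n l) ω with hU
      have hUm : Measurable[G (k + 1)] U := Finset.measurable_fun_sum _ fun l hl => by
        obtain ⟨h1, h2⟩ := Finset.mem_Icc.1 hl
        exact (h.measurable_comb h1 (w n l)).mono (h.mono (by omega)) le_rfl
      have hstep := h.norm_integral_cexp_sub_le hk1 (w n (k + 1)) hUm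
      have hmom := hK (k + 1) hk1 (w n (k + 1)) (b n) (hwb n (k + 1) hk1 hk)
      set Q := ∑ l ∈ Finset.Icc 1 k, q n l with hQ
      simp only [Finset.sum_Icc_succ_top hk1]
      change ‖∫ ω, Complex.exp ((U ω + comb ξ (k + 1) (w n (k + 1)) ω : ℝ) * Complex.I) ∂Pr
        - (Real.exp (-(σ ^ 2 * (Q + q n (k + 1)) / 2)) : ℂ)‖ ≤ ε n * (Q + q n (k + 1))
      change ‖_ - (1 - ((σ ^ 2 * q n (k + 1) : ℝ) : ℂ) / 2) * _‖ ≤ _ at hstep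
      have hqk := hqb n (k + 1) hk1 hk
      have hq0k := hq0 n (k + 1)
      set t := q n (k + 1) with ht
      have hσt : σ ^ 2 * t ≤ σ ^ 2 * (N * b n ^ 2) := by gcongr
      have hexp := norm_one_sub_half_sub_exp_le (v := σ ^ 2 * t) (by positivity)
        (by linarith)
      set φ := ∫ ω, Complex.exp (U ω * Complex.I) ∂Pr with hφ
      have hφ1 : ‖φ‖ ≤ 1 := by
        refine (norm_integral_le_integral_norm _).trans ?_
        simp [Complex.norm_exp_ofReal_mul_I]
      set φ' := ∫ ω, Complex.exp ((U ω + comb ξ (k + 1) (w n (k + 1)) ω : ℝ) * Complex.I) ∂Pr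
      have he : (Real.exp (-(σ ^ 2 * (Q + t) / 2)) : ℂ)
          = (Real.exp (-(σ ^ 2 * t / 2)) : ℂ) * (Real.exp (-(σ ^ 2 * Q / 2)) : ℂ) := by
        rw [← Complex.ofReal_mul, ← Real.exp_add]
        congr 2; ring
      -- Three errors: that of the new step, that of exponentiating its variance, and the one
      -- inherited from the previous steps, which is multiplied by a factor at most `1`.
      have hdec : φ' - (Real.exp (-(σ ^ 2 * (Q + t) / 2)) : ℂ)
          = (φ' - (1 - ((σ ^ 2 * t : ℝ) : ℂ) / 2) * φ)
            + ((1 - ((σ ^ 2 * t : ℝ) : ℂ) / 2) - (Real.exp (-(σ ^ 2 * t / 2)) : ℂ)) * φ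
            + (Real.exp (-(σ ^ 2 * t / 2)) : ℂ) * (φ - (Real.exp (-(σ ^ 2 * Q / 2)) : ℂ)) := by
        rw [he]; ring
      have hn1 : ‖((1 - ((σ ^ 2 * t : ℝ) : ℂ) / 2) - (Real.exp (-(σ ^ 2 * t / 2)) : ℂ)) * φ‖
          ≤ σ ^ 2 * t * (σ ^ 2 * t) := by
        rw [norm_mul]
        exact (mul_le_mul hexp hφ1 (norm_nonneg _) (by positivity)).trans (by rw [mul_one])
      have hn2 : ‖(Real.exp (-(σ ^ 2 * t / 2)) : ℂ) * (φ - (Real.exp (-(σ ^ 2 * Q / 2)) : ℂ))‖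
          ≤ ε n * Q := by
        rw [norm_mul, Complex.norm_real, Real.norm_of_nonneg (Real.exp_pos _).le]
        refine (mul_le_mul ?_ ih (norm_nonneg _) zero_le_one).trans (by rw [one_mul])
        rw [Real.exp_le_one_iff]
        have : 0 ≤ σ ^ 2 * t := by positivity
        linarith
      have hn3 : σ ^ 2 * t * (σ ^ 2 * t) ≤ σ ^ 4 * (N * b n ^ 2) * t := by
        have : σ ^ 2 * t * (σ ^ 2 * t) = σ ^ 4 * t * t := by ring
        rw [this]
        gcongr
      rw [hdec]
      refine (norm_add₃_le).trans ?_
      have : ε n * (Q + t)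
          = 2 * (K * b n ^ (p - 2) * t) + σ ^ 4 * (N * b n ^ 2) * t + ε n * Q := by
        simp only [hε]; ring
      rw [this]
      have hmom' : ∫ ω, |comb ξ (k + 1) (w n (k + 1)) ω| ^ p ∂Pr ≤ K * b n ^ (p - 2) * t := hmom
      gcongr
      · exact hstep.trans (by gcongr)
      · exact hn1.trans hn3
  have hlim : Tendsto (fun n => (Real.exp (-(σ ^ 2 * (∑ l ∈ Finset.Icc 1 n, q n l) / 2)) : ℂ))
      atTop (𝓝 (Complex.exp (-(σ ^ 2 * V / 2 : ℝ)))) := by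
    rw [← Complex.ofReal_neg, ← Complex.ofReal_exp]
    refine (Complex.continuous_ofReal.tendsto _).comp ?_
    exact (Real.continuous_exp.tendsto _).comp (((hV.const_mul _).div_const 2).neg)
  have hdiff : Tendsto (fun n => ∫ ω, Complex.exp
      ((∑ k ∈ Finset.Icc 1 n, comb ξ k (w n k) ω : ℝ) * Complex.I) ∂Pr
      - (Real.exp (-(σ ^ 2 * (∑ l ∈ Finset.Icc 1 n, q n l) / 2)) : ℂ)) atTop (𝓝 0) := by
    rw [tendsto_zero_iff_norm_tendsto_zero]
    have h0 := hε0.mul hV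
    rw [zero_mul] at h0
    refine squeeze_zero' (Eventually.of_forall fun n => norm_nonneg _) ?_ h0
    filter_upwards [hind] with n hn using hn n le_rfl
  simpa using hdiff.add hlim

end NoiseArray

end

/-! ### The mean square error on events where the iterates stay close to `θ`. -/

section

section GradNoise
variable {d δ : ℕ} {Ω : Type*}

/-- The error of the approximation of the gradient, multiplied by the width of the quotient. -/
def gradNoise (ξ : ℕ → Label d δ → Ω → ℝ) (n : ℕ) (ω : Ω) : EuclideanSpace ℝ (Fin d) :=
  WithLp.toLp 2 fun i => (ξ n (Sum.inl i) ω - ξ n (Sum.inr (Sum.inl i)) ω) / 2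

/-- The weights that express the inner products with `gradNoise`. -/
def gradWeight (v : EuclideanSpace ℝ (Fin d)) : Label d δ → ℝ
  | Sum.inl i => v i / 2
  | Sum.inr (Sum.inl i) => -(v i / 2)
  | Sum.inr (Sum.inr _) => 0

lemma inner_gradNoise (ξ : ℕ → Label d δ → Ω → ℝ) (n : ℕ) (v : EuclideanSpace ℝ (Fin d)) (ω : Ω) :
    inner ℝ v (gradNoise ξ n ω) = NoiseArray.comb ξ n (gradWeight v) ω := by
  simp only [NoiseArray.comb, Fintype.sum_sum_type, gradWeight, gradNoise, PiLp.inner_apply,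
    zero_mul, Finset.sum_const_zero, add_zero, ← Finset.sum_add_distrib]
  refine Finset.sum_congr rfl fun i _ => ?_
  simp
  ring

lemma sum_gradWeight_mul (v u : EuclideanSpace ℝ (Fin d)) :
    ∑ j, (gradWeight v : Label d δ → ℝ) j * gradWeight u j = inner ℝ v u / 2 := by
  simp only [Fintype.sum_sum_type, gradWeight, PiLp.inner_apply,
    zero_mul, Finset.sum_const_zero, add_zero, ← Finset.sum_add_distrib, Finset.sum_div]
  refine Finset.sum_congr rfl fun i _ => ?_
  simp
  ring

lemma abs_gradWeight_le (v : EuclideanSpace ℝ (Fin d)) (j : Label d δ) :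
    |gradWeight v j| ≤ ‖v‖ := by
  have h : ∀ i, |v i| ≤ ‖v‖ := fun i => PiLp.norm_apply_le v i
  have h0 := norm_nonneg v
  rcases j with i | i | k
  · simp only [gradWeight, abs_div, abs_two]; linarith [h i, abs_nonneg (v i)]
  · simp only [gradWeight, abs_neg, abs_div, abs_two]; linarith [h i, abs_nonneg (v i)]
  · simpa [gradWeight] using h0

lemma gradientEstimate_eq (f : EuclideanSpace ℝ (Fin d) → ℝ) (c : ℕ → ℝ)
    (Θ : ℕ → Ω → EuclideanSpace ℝ (Fin d)) (Z : ℕ → Label d δ → Ω → ℝ) (n : ℕ) (ω : Ω) :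
    gradientEstimate c Z n ω
      = diffQuotient f (c n) (Θ n ω) + (c n)⁻¹ • gradNoise (noise f c Θ Z) n ω := by
  ext i
  simp [gradientEstimate, diffQuotient, gradNoise, noise, queryPoint]
  ring

variable [m0 : MeasurableSpace Ω] {Pr : Measure Ω} [IsProbabilityMeasure Pr]
  {G : ℕ → MeasurableSpace Ω} {ξ : ℕ → Label d δ → Ω → ℝ} {σ p : ℝ}

namespace NoiseArray

lemma measurable_gradNoise (h : NoiseArray Pr G ξ σ p) {n : ℕ} (hn : 1 ≤ n) :
    Measurable[G (n + 1)] (gradNoise ξ n) :=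
  measurable_toLp_of_coord fun _ =>
    ((h.measurable n hn _).sub (h.measurable n hn _)).div_const 2

lemma memLp_gradNoise (h : NoiseArray Pr G ξ σ p) {n : ℕ} (hn : 1 ≤ n) :
    MemLp (gradNoise ξ n) 2 Pr := by
  have e : gradNoise ξ n = fun ω => ∑ i, comb ξ n (gradWeight (basisVec i)) ω • basisVec i := by
    ext1 ω
    conv_lhs => rw [eq_sum_smul_basisVec (gradNoise ξ n ω)]
    refine Finset.sum_congr rfl fun i _ => ?_
    rw [← inner_gradNoise]
    simp [basisVec, EuclideanSpace.inner_single_left]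
  rw [e]
  refine memLp_finsetSum _ fun i _ => ?_
  exact (ContinuousLinearMap.toSpanSingleton ℝ (basisVec i)).comp_memLp' (h.memLp_comb hn _)

lemma norm_sq_gradNoise (n : ℕ) (ω : Ω) : ‖gradNoise ξ n ω‖ ^ 2
    = ∑ i, comb ξ n (gradWeight (basisVec i)) ω * comb ξ n (gradWeight (basisVec i)) ω := by
  rw [EuclideanSpace.real_norm_sq_eq]
  refine Finset.sum_congr rfl fun i _ => ?_
  rw [← inner_gradNoise]
  simp [basisVec, EuclideanSpace.inner_single_left, pow_two]

lemma integral_inner_gradNoise (h : NoiseArray Pr G ξ σ p) {n : ℕ} (hn : 1 ≤ n)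
    {V : Ω → EuclideanSpace ℝ (Fin d)} (hV : Measurable[G n] V) (hC : ∃ C, ∀ ω, ‖V ω‖ ≤ C) :
    ∫ ω, inner ℝ (V ω) (gradNoise ξ n ω) ∂Pr = 0 := by
  obtain ⟨C, hC⟩ := hC
  have e : ∀ ω, inner ℝ (V ω) (gradNoise ξ n ω)
      = ∑ i, V ω i * comb ξ n (gradWeight (basisVec i)) ω := fun ω => by
    conv_lhs => rw [eq_sum_smul_basisVec (V ω)]
    rw [sum_inner]
    refine Finset.sum_congr rfl fun i _ => ?_
    rw [real_inner_smul_left, inner_gradNoise]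
  have hVi : ∀ i, Measurable[G n] fun ω => V ω i := fun i =>
    (EuclideanSpace.proj (𝕜 := ℝ) i).measurable.comp hV
  have hb : ∀ i, ∃ C, ∀ ω, |V ω i| ≤ C := fun i =>
    ⟨C, fun ω => (PiLp.norm_apply_le (V ω) i).trans (hC ω)⟩
  simp_rw [e]
  rw [integral_finsetSum _ fun i _ =>
    h.bdd_mul (hVi i) (hb i) ((h.memLp_comb hn _).integrable (by norm_num))]
  exact Finset.sum_eq_zero fun i _ => h.integral_mul_comb hn _ (hVi i) (hb i)

lemma integral_mul_norm_sq_gradNoise (h : NoiseArray Pr G ξ σ p) {n : ℕ} (hn : 1 ≤ n)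
    {W : Ω → ℝ} (hW : Measurable[G n] W) (hC : ∃ C, ∀ ω, |W ω| ≤ C) :
    ∫ ω, W ω * ‖gradNoise ξ n ω‖ ^ 2 ∂Pr = d * σ ^ 2 / 2 * ∫ ω, W ω ∂Pr := by
  simp_rw [norm_sq_gradNoise, Finset.mul_sum]
  have hi : ∀ i : Fin d, Integrable (fun ω => W ω * (comb ξ n (gradWeight (basisVec i)) ω
      * comb ξ n (gradWeight (basisVec i)) ω)) Pr := fun i => h.bdd_mul hW hC
    ((h.memLp_comb hn (gradWeight (basisVec i))).integrable_mul
      (h.memLp_comb hn (gradWeight (basisVec i))))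
  rw [integral_finsetSum _ fun i _ => hi i]
  simp_rw [h.integral_mul_comb_mul_comb hn _ _ hW hC, sum_gradWeight_mul]
  simp [basisVec]
  ring

/-- One step of a recursion, on an event of the past. -/
lemma setIntegral_norm_add_smul_sq (h : NoiseArray Pr G ξ σ p) {n : ℕ} (hn : 1 ≤ n) {A : Set Ω}
    (hA : MeasurableSet[G n] A) {B : Ω → EuclideanSpace ℝ (Fin d)} (hB : Measurable[G n] B)
    (hC : ∃ C, ∀ ω ∈ A, ‖B ω‖ ≤ C) (s : ℝ) :
    IntegrableOn (fun ω => ‖B ω + s • gradNoise ξ n ω‖ ^ 2) A Pr ∧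
    ∫ ω in A, ‖B ω + s • gradNoise ξ n ω‖ ^ 2 ∂Pr
      = ∫ ω in A, ‖B ω‖ ^ 2 ∂Pr + s ^ 2 * (d * σ ^ 2 / 2) * Pr.real A := by
  obtain ⟨C, hC⟩ := hC
  have hA0 : MeasurableSet A := h.le n _ hA
  -- Cutting off at the event `A` of the past makes the predictable part bounded everywhere, so the
  -- cross term integrates to `0`.
  set V : Ω → EuclideanSpace ℝ (Fin d) := A.indicator B with hVdef
  have hV : Measurable[G n] V := hB.indicator hA
  have hV0 : Measurable V := hV.mono (h.le n) le_rfl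
  have hVb : ∀ ω, ‖V ω‖ ≤ max C 0 := fun ω => by
    by_cases hω : ω ∈ A
    · rw [hVdef, Set.indicator_of_mem hω]; exact (hC ω hω).trans (le_max_left _ _)
    · rw [hVdef, Set.indicator_of_notMem hω, norm_zero]; exact le_max_right _ _
  set W : Ω → ℝ := A.indicator fun _ => 1 with hWdef
  have hW : Measurable[G n] W := measurable_const.indicator hA
  have hWb : ∀ ω, |W ω| ≤ 1 := fun ω => by
    by_cases hω : ω ∈ A <;> simp [hWdef, hω]
  have hηm : Measurable (gradNoise ξ n) := (h.measurable_gradNoise hn).mono (h.le _) le_rfl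
  have hη2 : Integrable (fun ω => ‖gradNoise ξ n ω‖ ^ 2) Pr := (h.memLp_gradNoise hn).integrable_norm_pow (by norm_num)
  have hη1 : Integrable (gradNoise ξ n) Pr := (h.memLp_gradNoise hn).integrable (by norm_num)
  have e : A.indicator (fun ω => ‖B ω + s • gradNoise ξ n ω‖ ^ 2)
      = fun ω => ‖V ω‖ ^ 2 + (2 * s * inner ℝ (V ω) (gradNoise ξ n ω)
        + s ^ 2 * (W ω * ‖gradNoise ξ n ω‖ ^ 2)) := by
    ext1 ω
    by_cases hω : ω ∈ A
    · simp only [hVdef, hWdef, Set.indicator_of_mem hω]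
      rw [norm_add_sq_real, norm_smul, real_inner_smul_right, mul_pow, Real.norm_eq_abs, sq_abs]
      ring
    · simp [hVdef, hWdef, Set.indicator_of_notMem hω]
  have i1 : Integrable (fun ω => ‖V ω‖ ^ 2) Pr :=
    Integrable.of_bound (hV0.norm.pow_const 2).aestronglyMeasurable (max C 0 ^ 2)
      (Eventually.of_forall fun ω => by
        rw [Real.norm_of_nonneg (by positivity)]
        exact pow_le_pow_left₀ (norm_nonneg _) (hVb ω) 2)
  have i2 : Integrable (fun ω => 2 * s * inner ℝ (V ω) (gradNoise ξ n ω)) Pr := by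
    refine Integrable.const_mul ?_ _
    refine (hη1.norm.const_mul (max C 0)).mono' (hV0.inner hηm).aestronglyMeasurable
      (Eventually.of_forall fun ω => ?_)
    exact (norm_inner_le_norm _ _).trans (by gcongr; exact hVb ω)
  have i3 : Integrable (fun ω => s ^ 2 * (W ω * ‖gradNoise ξ n ω‖ ^ 2)) Pr :=
    (h.bdd_mul hW ⟨1, hWb⟩ hη2).const_mul _
  have i23 : Integrable (fun ω => 2 * s * inner ℝ (V ω) (gradNoise ξ n ω)
        + s ^ 2 * (W ω * ‖gradNoise ξ n ω‖ ^ 2)) Pr := i2.add i3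
  constructor
  · rw [← integrable_indicator_iff hA0, e]
    exact i1.add i23
  · rw [← integral_indicator hA0, e, integral_add i1 i23, integral_add i2 i3, integral_const_mul,
      integral_const_mul, h.integral_inner_gradNoise hn hV ⟨_, hVb⟩,
      h.integral_mul_norm_sq_gradNoise hn hW ⟨1, hWb⟩, ← integral_indicator hA0]
    have e1 : ∀ ω, ‖V ω‖ ^ 2 = A.indicator (fun ω => ‖B ω‖ ^ 2) ω := fun ω => by
      by_cases hω : ω ∈ A <;> simp [hVdef, hω]
    have e2 : ∫ ω, W ω ∂Pr = Pr.real A := by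
      rw [hWdef, integral_indicator hA0]; simp
    simp_rw [e1, e2]
    ring

end NoiseArray
end GradNoise

section OneStep
variable {E : Type*} [NormedAddCommGroup E] [InnerProductSpace ℝ E]

/-- The budget for the coercivity `l`: the perturbation `κ` and Young's inequality cost `l/8` each,
leaving `3l/4` in the inner product and `3l/2` in its double. The squared step costs `l/2`, and the
contraction rate `l` remains. -/
lemma norm_add_smul_sq_le {H : E →L[ℝ] E} {l κ D : ℝ} (hl : 0 < l)
    (hH : ∀ x, inner ℝ x (H x) ≤ -l * ‖x‖ ^ 2) (hκ0 : 0 ≤ κ) (hκ : κ ≤ l / 8) (hD : 0 ≤ D)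
    {x g : E} {a s : ℝ} (ha : 0 ≤ a) (ha1 : a ≤ 1) (hal : a * (2 * (‖H‖ + κ) ^ 2) ≤ l / 2)
    (hs : 0 ≤ s) (hg : ‖g - H x‖ ≤ κ * ‖x‖ + D * s) :
    ‖x + a • g‖ ^ 2 ≤ (1 - l * a) * ‖x‖ ^ 2 + a * ((4 / l + 2) * D ^ 2 * s ^ 2) := by
  have h1 : inner ℝ x g ≤ -(3 * l / 4) * ‖x‖ ^ 2 + 2 / l * (D * s) ^ 2 := by
    have e : inner ℝ x g = inner ℝ x (H x) + inner ℝ x (g - H x) := by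
      rw [← inner_add_right]; simp
    have h2 : inner ℝ x (g - H x) ≤ ‖x‖ * (κ * ‖x‖ + D * s) :=
      (real_inner_le_norm _ _).trans (by gcongr)
    have h3 : ‖x‖ * (D * s) ≤ l / 8 * ‖x‖ ^ 2 + 2 / l * (D * s) ^ 2 := by
      have : 0 ≤ 2 / l * (l / 4 * ‖x‖ - D * s) ^ 2 := by positivity
      have e2 : 2 / l * (l / 4 * ‖x‖ - D * s) ^ 2
          = l / 8 * ‖x‖ ^ 2 + 2 / l * (D * s) ^ 2 - ‖x‖ * (D * s) := by
        field_simp; ring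
      linarith
    have h4 : κ * ‖x‖ ^ 2 ≤ l / 8 * ‖x‖ ^ 2 := by gcongr
    have h5 := hH x
    rw [e]
    nlinarith
  have h6 : ‖g‖ ≤ (‖H‖ + κ) * ‖x‖ + D * s := by
    calc ‖g‖ = ‖H x + (g - H x)‖ := by simp
      _ ≤ ‖H x‖ + ‖g - H x‖ := norm_add_le _ _
      _ ≤ ‖H‖ * ‖x‖ + (κ * ‖x‖ + D * s) := add_le_add (H.le_opNorm x) hg
      _ = _ := by ring
  have h7 : ‖g‖ ^ 2 ≤ 2 * (‖H‖ + κ) ^ 2 * ‖x‖ ^ 2 + 2 * (D * s) ^ 2 := by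
    have := pow_le_pow_left₀ (norm_nonneg _) h6 2
    nlinarith [sq_nonneg ((‖H‖ + κ) * ‖x‖ - D * s)]
  rw [norm_add_sq_real, norm_smul, real_inner_smul_right, mul_pow, Real.norm_eq_abs, sq_abs]
  have h8 : a * inner ℝ x g ≤ a * (-(3 * l / 4) * ‖x‖ ^ 2 + 2 / l * (D * s) ^ 2) := by gcongr
  have h9 : a ^ 2 * ‖g‖ ^ 2 ≤ a * (l / 2 * ‖x‖ ^ 2 + 2 * (D * s) ^ 2) := by
    calc a ^ 2 * ‖g‖ ^ 2 ≤ a ^ 2 * (2 * (‖H‖ + κ) ^ 2 * ‖x‖ ^ 2 + 2 * (D * s) ^ 2) := by gcongr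
      _ = a * ((a * (2 * (‖H‖ + κ) ^ 2)) * ‖x‖ ^ 2 + a * (2 * (D * s) ^ 2)) := by ring
      _ ≤ a * (l / 2 * ‖x‖ ^ 2 + 1 * (2 * (D * s) ^ 2)) := by gcongr
      _ = _ := by ring
  calc ‖x‖ ^ 2 + 2 * (a * inner ℝ x g) + a ^ 2 * ‖g‖ ^ 2
      ≤ ‖x‖ ^ 2 + 2 * (a * (-(3 * l / 4) * ‖x‖ ^ 2 + 2 / l * (D * s) ^ 2))
        + a * (l / 2 * ‖x‖ ^ 2 + 2 * (D * s) ^ 2) := by gcongr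
    _ = _ := by field_simp; ring

end OneStep

section LocalBound
variable {d δ : ℕ} {Ω : Type*} [m0 : MeasurableSpace Ω] {Pr : Measure Ω} [IsProbabilityMeasure Pr]
  {a c : ℕ → ℝ} {Θ : ℕ → Ω → EuclideanSpace ℝ (Fin d)} {M : ℕ → Ω → ℝ}
  {Z : ℕ → Label d δ → Ω → ℝ} {f : EuclideanSpace ℝ (Fin d) → ℝ} {σ p L τ : ℝ}
  {θ : EuclideanSpace ℝ (Fin d)}

/-- The event that the iterates of the steps `N, …, n` are close to `θ`. -/
def nearEvent (Θ : ℕ → Ω → EuclideanSpace ℝ (Fin d)) (θ : EuclideanSpace ℝ (Fin d)) (r : ℝ)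
    (N n : ℕ) : Set Ω := ⋂ k ∈ Finset.Icc N n, {ω | ‖Θ k ω - θ‖ ≤ r}

lemma nearEvent_anti (r : ℝ) (N : ℕ) : Antitone (nearEvent Θ θ r N) := fun _ _ h =>
  Set.biInter_subset_biInter_left fun _ hk =>
    Finset.mem_Icc.2 ⟨(Finset.mem_Icc.1 hk).1, (Finset.mem_Icc.1 hk).2.trans h⟩

lemma norm_le_of_mem_nearEvent {r : ℝ} {N n k : ℕ} (h1 : N ≤ k) (h2 : k ≤ n) {ω : Ω}
    (h : ω ∈ nearEvent Θ θ r N n) : ‖Θ k ω - θ‖ ≤ r :=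
  Set.mem_iInter₂.1 h k (Finset.mem_Icc.2 ⟨h1, h2⟩)

lemma IsAlgorithm.measurableSet_nearEvent (hA : IsAlgorithm a c Θ M Z) (hf : Measurable f) (r : ℝ)
    {N n : ℕ} (hN : 1 ≤ N) : MeasurableSet[history f c Θ Z n] (nearEvent Θ θ r N n) := by
  refine Finset.measurableSet_biInter _ fun k hk => ?_
  obtain ⟨h1, h2⟩ := Finset.mem_Icc.1 hk
  have h3 : Measurable[history f c Θ Z n] (Θ k) :=
    (hA.measurable_theta_history hf (hN.trans h1)).mono (history_mono h2) le_rfl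
  have h4 : Measurable[history f c Θ Z n] fun ω => ‖Θ k ω - θ‖ :=
    ((measurable_id.sub_const θ).norm).comp h3
  exact h4 measurableSet_Iic

/-- One half of the contraction `l a_n` pays for the decrease of `errRate`, the other half for the
input `a_n (K₁ c_n⁴ + K₂ a_n / c_n²)`, which is at most `a_n (K₁ + K₂)` times `errRate`; hence the
requirement `2 (K₁ + K₂) ≤ K l`. -/
lemma moment_recursion_bound {n : ℕ} {l K K₁ K₂ x P : ℝ} (ha : 0 < a n) (hc : 0 < c n)
    (hK₁ : 0 ≤ K₁) (hK₂ : 0 ≤ K₂) (hK : 0 ≤ K) (hl : 0 ≤ 1 - l * a n) (hP : P ≤ 1)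
    (hx : x ≤ K * errRate a c n) (hKl : 2 * (K₁ + K₂) ≤ K * l)
    (he : (1 - l / 2 * a n) * errRate a c n ≤ errRate a c (n + 1)) :
    (1 - l * a n) * x + P * (a n * (K₁ * c n ^ 4)) + (a n * (c n)⁻¹) ^ 2 * K₂ * P
      ≤ K * errRate a c (n + 1) := by
  have hv : 0 < errRate a c n := errRate_pos ha hc
  have h3 : (1 - l * a n) * x ≤ (1 - l * a n) * (K * errRate a c n) :=
    mul_le_mul_of_nonneg_left hx hl
  have h4 : P * (a n * (K₁ * c n ^ 4)) ≤ 1 * (a n * (K₁ * c n ^ 4)) :=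
    mul_le_mul_of_nonneg_right hP (by positivity)
  have h5 : (a n * (c n)⁻¹) ^ 2 * K₂ * P ≤ (a n * (c n)⁻¹) ^ 2 * K₂ * 1 :=
    mul_le_mul_of_nonneg_left hP (by positivity)
  have q1 : 0 ≤ K₁ * (a n / c n ^ 2) := by positivity
  have q2 : 0 ≤ K₂ * c n ^ 4 := by positivity
  have h6 : a n * (K₁ * c n ^ 4) + (a n * (c n)⁻¹) ^ 2 * K₂
      ≤ a n * ((K₁ + K₂) * errRate a c n) := by
    have e : (a n * (c n)⁻¹) ^ 2 * K₂ = a n * (K₂ * (a n / c n ^ 2)) := by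
      field_simp
    rw [e, ← mul_add]
    refine mul_le_mul_of_nonneg_left ?_ ha.le
    rw [errRate]
    linarith
  have h7 : 2 * (K₁ + K₂) * (a n * errRate a c n) ≤ K * l * (a n * errRate a c n) :=
    mul_le_mul_of_nonneg_right hKl (by positivity)
  have h8 : K * ((1 - l / 2 * a n) * errRate a c n) ≤ K * errRate a c (n + 1) :=
    mul_le_mul_of_nonneg_left he hK
  linarith

/-- The mean square error is of order `errRate` on the event that the iterates stay close
to `θ`. -/
lemma exists_setIntegral_sq_le (hA : IsAlgorithm a c Θ M Z) (hf : Measurable f)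
    (hM : IsRegularMaximizer f θ L)
    (hX : NoiseArray Pr (history f c Θ Z) (noise f c Θ Z) σ p) (hR : Rates a c τ) :
    ∃ r : ℝ, 0 < r ∧ ∃ N₀ : ℕ, 1 ≤ N₀ ∧ ∀ N, N₀ ≤ N → ∃ K, ∀ n, N ≤ n →
      ∫ ω in nearEvent Θ θ r N n, ‖Θ n ω - θ‖ ^ 2 ∂Pr ≤ K * errRate a c n := by
  obtain ⟨l, hl, hH⟩ := hM.exists_coercive
  obtain ⟨C, hC, hexp⟩ := hM.exists_expansion
  obtain ⟨r₁, hr₁, hexp⟩ := hexp 1 one_pos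
  set H := hessianCLM f θ with hHdef
  set D := ‖biasVec f θ‖ + 1 with hD
  have hD0 : 0 ≤ D := by positivity
  -- Within distance `r` the quadratic error `C ‖x - θ‖²` is at most `C r ‖x - θ‖` with `C r ≤ l/8`,
  -- as the contraction estimate requires.
  set r := min r₁ (l / (8 * (C + 1))) with hr
  have hr0 : 0 < r := by positivity
  have hCr : C * r ≤ l / 8 := by
    calc C * r ≤ (C + 1) * (l / (8 * (C + 1))) := by
          gcongr
          · linarith
          · exact min_le_right _ _
      _ = l / 8 := by field_simp
  set κ := C * r with hκ
  have hκ0 : 0 ≤ κ := by positivity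
  set K₁ := (4 / l + 2) * D ^ 2 with hK₁
  set K₂ := (d : ℝ) * σ ^ 2 / 2 with hK₂
  have hK₁0 : 0 ≤ K₁ := by positivity
  have hK₂0 : 0 ≤ K₂ := by positivity
  have ev1 : ∀ᶠ n in atTop, a n ≤ 1 := hR.a_zero.eventually (ge_mem_nhds one_pos)
  have ev2 : ∀ᶠ n in atTop, a n * (2 * (‖H‖ + κ) ^ 2) ≤ l / 2 := by
    have := hR.a_zero.mul_const (2 * (‖H‖ + κ) ^ 2)
    rw [zero_mul] at this
    exact this.eventually (ge_mem_nhds (by positivity))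
  have ev3 : ∀ᶠ n in atTop, c n ≤ r₁ := hR.c_zero.eventually (ge_mem_nhds hr₁)
  have ev5 : ∀ᶠ n in atTop, a n * l ≤ 1 := by
    have := hR.a_zero.mul_const l
    rw [zero_mul] at this
    exact this.eventually (ge_mem_nhds one_pos)
  obtain ⟨N₁, hN₁⟩ := eventually_atTop.1
    (ev1.and (ev2.and (ev3.and ((hR.errRate_le (l / 2) (by positivity)).and ev5))))
  refine ⟨r, hr0, max N₁ 1, le_max_right _ _, fun N hN => ?_⟩
  have hN1 : 1 ≤ N := (le_max_right _ _).trans hN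
  have hvN : 0 < errRate a c N := errRate_pos (hR.a_pos N hN1) (hR.c_pos N hN1)
  -- The first summand handles the initial index `N`, the second the induction step.
  set K := r ^ 2 / errRate a c N + 2 * (K₁ + K₂) / l with hK
  have hK0 : 0 ≤ K := by positivity
  refine ⟨K, fun n hn => ?_⟩
  induction n, hn using Nat.le_induction with
  | base =>
    have hA0 : MeasurableSet (nearEvent Θ θ r N N) :=
      hA.history_le hf N _ (hA.measurableSet_nearEvent hf r hN1)
    have h1 : ∫ ω in nearEvent Θ θ r N N, ‖Θ N ω - θ‖ ^ 2 ∂Pr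
        ≤ ∫ ω in nearEvent Θ θ r N N, r ^ 2 ∂Pr := by
      refine integral_mono_of_nonneg (Eventually.of_forall fun ω => by positivity)
        (integrable_const _) ?_
      refine (ae_restrict_iff' hA0).2 (Eventually.of_forall fun ω hω => ?_)
      exact pow_le_pow_left₀ (norm_nonneg _) (norm_le_of_mem_nearEvent le_rfl le_rfl hω) 2
    refine h1.trans ?_
    rw [setIntegral_const, smul_eq_mul]
    calc Pr.real (nearEvent Θ θ r N N) * r ^ 2 ≤ 1 * r ^ 2 := by gcongr; exact measureReal_le_one
      _ = r ^ 2 / errRate a c N * errRate a c N := by field_simp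
      _ ≤ K * errRate a c N := by
        gcongr
        rw [hK]
        have : 0 ≤ 2 * (K₁ + K₂) / l := by positivity
        linarith
  | succ n hn ih =>
    have hn1 : 1 ≤ n := hN1.trans hn
    obtain ⟨e1, e2, e3, e4, e5⟩ := hN₁ n ((le_max_left _ _).trans (hN.trans hn))
    have ha := hR.a_pos n hn1
    have hc := hR.c_pos n hn1
    set A := nearEvent Θ θ r N n with hAdef
    have hAm : MeasurableSet[history f c Θ Z n] A := hA.measurableSet_nearEvent hf r hN1
    have hA0 : MeasurableSet A := hA.history_le hf n _ hAm
    set g : Ω → EuclideanSpace ℝ (Fin d) := fun ω => diffQuotient f (c n) (Θ n ω) with hg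
    set B : Ω → EuclideanSpace ℝ (Fin d) := fun ω => (Θ n ω - θ) + a n • g ω with hBdef
    have hgm : Measurable[history f c Θ Z n] g := by
      refine Measurable.const_smul ?_ (1 / (2 * c n))
      refine measurable_toLp_of_coord fun i => ?_
      exact (hf.comp (hA.measurable_queryPoint_history hf hn1 (Sum.inl i))).sub
        (hf.comp (hA.measurable_queryPoint_history hf hn1 (Sum.inr (Sum.inl i))))
    have hBm : Measurable[history f c Θ Z n] B :=
      ((hA.measurable_theta_history hf hn1).sub_const θ).add (hgm.const_smul (a n))
    have hB2 : ∀ ω ∈ A, ‖B ω‖ ^ 2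
        ≤ (1 - l * a n) * ‖Θ n ω - θ‖ ^ 2 + a n * (K₁ * c n ^ 4) := by
      intro ω hω
      have hx : ‖Θ n ω - θ‖ ≤ r := norm_le_of_mem_nearEvent hn le_rfl hω
      have h1 := hexp (Θ n ω) (hx.trans (min_le_left _ _)) (c n) hc e3
      have h2 : ‖g ω - H (Θ n ω - θ)‖ ≤ κ * ‖Θ n ω - θ‖ + D * c n ^ 2 := by
        calc ‖g ω - H (Θ n ω - θ)‖
            = ‖(g ω - H (Θ n ω - θ) - c n ^ 2 • biasVec f θ) + c n ^ 2 • biasVec f θ‖ := by simp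
          _ ≤ ‖g ω - H (Θ n ω - θ) - c n ^ 2 • biasVec f θ‖ + ‖c n ^ 2 • biasVec f θ‖ :=
            norm_add_le _ _
          _ ≤ (C * ‖Θ n ω - θ‖ ^ 2 + 1 * c n ^ 2) + c n ^ 2 * ‖biasVec f θ‖ := by
            rw [norm_smul, Real.norm_of_nonneg (by positivity)]
            gcongr
          _ ≤ (C * (r * ‖Θ n ω - θ‖) + 1 * c n ^ 2) + c n ^ 2 * ‖biasVec f θ‖ := by
            rw [pow_two ‖Θ n ω - θ‖]; gcongr
          _ = _ := by rw [hκ, hD]; ring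
      have h3 := norm_add_smul_sq_le hl hH hκ0 hCr hD0 ha.le e1 e2 (sq_nonneg (c n)) h2
      refine h3.trans_eq ?_
      rw [hK₁]; ring
    have hBb : ∃ C, ∀ ω ∈ A, ‖B ω‖ ≤ C := by
      refine ⟨Real.sqrt (r ^ 2 + a n * (K₁ * c n ^ 4)), fun ω hω => ?_⟩
      refine Real.le_sqrt_of_sq_le ((hB2 ω hω).trans ?_)
      have hx : ‖Θ n ω - θ‖ ≤ r := norm_le_of_mem_nearEvent hn le_rfl hω
      have : (1 - l * a n) * ‖Θ n ω - θ‖ ^ 2 ≤ 1 * r ^ 2 := by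
        gcongr
        have : 0 ≤ l * a n := by positivity
        linarith
      linarith
    obtain ⟨hi, heq⟩ := hX.setIntegral_norm_add_smul_sq hn1 hAm hBm hBb (a n * (c n)⁻¹)
    have hstep : ∀ ω, Θ (n + 1) ω - θ = B ω + (a n * (c n)⁻¹) • gradNoise (noise f c Θ Z) n ω := by
      intro ω
      rw [hA.step n hn1 ω, gradientEstimate_eq f c Θ Z n ω, smul_add, smul_smul]
      change _ = (Θ n ω - θ + a n • diffQuotient f (c n) (Θ n ω)) + _
      abel
    simp_rw [← hstep] at hi heq
    have hv : 0 < errRate a c n := errRate_pos ha hc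
    -- The event for `n + 1` depends on the noise of step `n`. It is enlarged to the event for `n`,
    -- which belongs to the past.
    have hsub : nearEvent Θ θ r N (n + 1) ⊆ A := nearEvent_anti r N (Nat.le_succ n)
    have h1 : ∫ ω in nearEvent Θ θ r N (n + 1), ‖Θ (n + 1) ω - θ‖ ^ 2 ∂Pr
        ≤ ∫ ω in A, ‖Θ (n + 1) ω - θ‖ ^ 2 ∂Pr :=
      setIntegral_mono_set hi (Eventually.of_forall fun ω => by positivity) hsub.eventuallyLE
    have hm0 : Measurable (Θ n) := hA.measurable_theta hn1
    have hxi : IntegrableOn (fun ω => ‖Θ n ω - θ‖ ^ 2) A Pr := by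
      refine IntegrableOn.of_bound (measure_lt_top _ _) ((hm0.sub_const θ).norm.pow_const 2).aestronglyMeasurable (r ^ 2) ?_
      refine (ae_restrict_iff' hA0).2 (Eventually.of_forall fun ω hω => ?_)
      rw [Real.norm_of_nonneg (by positivity)]
      exact pow_le_pow_left₀ (norm_nonneg _) (norm_le_of_mem_nearEvent hn le_rfl hω) 2
    have h2 : ∫ ω in A, ‖B ω‖ ^ 2 ∂Pr
        ≤ ∫ ω in A, ((1 - l * a n) * ‖Θ n ω - θ‖ ^ 2 + a n * (K₁ * c n ^ 4)) ∂Pr := by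
      refine integral_mono_of_nonneg (Eventually.of_forall fun ω => by positivity)
        ((hxi.const_mul _).add (integrable_const _)) ?_
      exact (ae_restrict_iff' hA0).2 (Eventually.of_forall hB2)
    rw [integral_add (hxi.const_mul _) (integrable_const _), integral_const_mul,
      setIntegral_const, smul_eq_mul] at h2
    have hP : Pr.real A ≤ 1 := measureReal_le_one
    have hP0 : 0 ≤ Pr.real A := measureReal_nonneg
    rw [← hK₂] at heq
    have hKl : 2 * (K₁ + K₂) / l ≤ K := by
      rw [hK]
      have : 0 ≤ r ^ 2 / errRate a c N := by positivity
      linarith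
    rw [div_le_iff₀ hl] at hKl
    refine h1.trans (heq.trans_le ((add_le_add h2 le_rfl).trans ?_))
    exact moment_recursion_bound ha hc hK₁0 hK₂0 hK0 (by linarith) measureReal_le_one ih hKl e4

end LocalBound

end

/-! ### Convergence in probability and bounds in mean on large events. -/

section

section ProbZero
variable {Ω : Type*} [m0 : MeasurableSpace Ω] {Pr : Measure Ω} [IsProbabilityMeasure Pr]
  {X Y : ℕ → Ω → ℝ}

/-- Convergence to `0` in probability of real random variables. -/
abbrev ProbZero (Pr : Measure Ω) (X : ℕ → Ω → ℝ) : Prop :=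
  TendstoInMeasure Pr X atTop fun _ => (0 : ℝ)

lemma probZero_iff : ProbZero Pr X ↔
    ∀ ε : ℝ, 0 < ε → Tendsto (fun n => Pr.real {ω | ε ≤ |X n ω|}) atTop (𝓝 0) := by
  simp [ProbZero, tendstoInMeasure_iff_measureReal_norm]

lemma ProbZero.of_abs_le (hY : ProbZero Pr Y) (h : ∀ᶠ n in atTop, ∀ ω, |X n ω| ≤ |Y n ω|) :
    ProbZero Pr X := by
  rw [probZero_iff] at hY ⊢
  intro ε hε
  refine squeeze_zero' (Eventually.of_forall fun n => measureReal_nonneg) ?_ (hY ε hε)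
  filter_upwards [h] with n hn
  exact measureReal_mono fun ω hω => le_trans hω (hn ω)

/-- It suffices to argue along the subsequences and the points where the dominating sequence
tends to `0`. -/
lemma ProbZero.of_pathwise (hY : ProbZero Pr Y) (hX : ∀ n, AEStronglyMeasurable (X n) Pr)
    (h : ∀ᵐ ω ∂Pr, ∀ φ : ℕ → ℕ, Tendsto φ atTop atTop →
      Tendsto (fun n => Y (φ n) ω) atTop (𝓝 0) → Tendsto (fun n => X (φ n) ω) atTop (𝓝 0)) :
    ProbZero Pr X := by
  rw [ProbZero, exists_seq_tendstoInMeasure_atTop_iff hX]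
  intro ns hns
  obtain ⟨ns', hns', hc⟩ := (hY.comp hns.tendsto_atTop).exists_seq_tendsto_ae
  refine ⟨ns', hns', ?_⟩
  filter_upwards [h, hc] with ω h1 h2
  exact h1 (fun i => ns (ns' i)) (hns.comp hns').tendsto_atTop h2

lemma ProbZero.of_tendsto_ae (hX : ∀ n, AEStronglyMeasurable (X n) Pr)
    (h : ∀ᵐ ω ∂Pr, Tendsto (fun n => X n ω) atTop (𝓝 0)) : ProbZero Pr X :=
  tendstoInMeasure_of_tendsto_ae hX h

lemma ProbZero.add (hX : ProbZero Pr X) (hY : ProbZero Pr Y) :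
    ProbZero Pr fun n ω => X n ω + Y n ω := by
  rw [probZero_iff] at hX hY ⊢
  intro ε hε
  have h := (hX (ε / 2) (by positivity)).add (hY (ε / 2) (by positivity))
  rw [add_zero] at h
  refine squeeze_zero (fun n => measureReal_nonneg) (fun n => ?_) h
  refine le_trans (measureReal_mono fun ω hω => ?_) (measureReal_union_le _ _)
  simp only [Set.mem_ofPred_eq, Set.mem_union] at hω ⊢
  by_contra! hc
  linarith [abs_add_le (X n ω) (Y n ω)]

lemma ProbZero.of_integral (hX : ∀ᶠ n in atTop, ∀ ω, 0 ≤ X n ω) (hi : ∀ᶠ n in atTop, Integrable (X n) Pr)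
    (h : Tendsto (fun n => ∫ ω, X n ω ∂Pr) atTop (𝓝 0)) : ProbZero Pr X := by
  rw [probZero_iff]
  intro ε hε
  have h1 := h.div_const ε
  rw [zero_div] at h1
  refine squeeze_zero' (Eventually.of_forall fun n => measureReal_nonneg) ?_ h1
  filter_upwards [hi, hX] with n hn hXn
  rw [le_div_iff₀ hε, mul_comm]
  simp only [abs_of_nonneg (hXn _)]
  exact mul_meas_ge_le_integral_of_nonneg (Eventually.of_forall hXn) hn ε

lemma ProbZero.of_events (h : ∀ η : ℝ, 0 < η → ∃ E : Set Ω, Pr.real Eᶜ ≤ η ∧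
    ProbZero Pr fun n => E.indicator (X n)) : ProbZero Pr X := by
  rw [probZero_iff]
  intro ε hε
  rw [Metric.tendsto_atTop]
  intro η hη
  obtain ⟨E, hE, hX⟩ := h (η / 2) (by positivity)
  rw [probZero_iff] at hX
  obtain ⟨N, hN⟩ := Metric.tendsto_atTop.1 (hX ε hε) (η / 2) (by positivity)
  refine ⟨N, fun n hn => ?_⟩
  have h1 := hN n hn
  rw [Real.dist_eq, sub_zero, abs_of_nonneg measureReal_nonneg] at h1 ⊢
  have h2 : Pr.real {ω | ε ≤ |X n ω|} ≤ Pr.real {ω | ε ≤ |E.indicator (X n) ω|} + Pr.real Eᶜ := by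
    refine le_trans (measureReal_mono fun ω hω => ?_) (measureReal_union_le _ _)
    by_cases hω' : ω ∈ E
    · left
      simpa [hω'] using hω
    · exact Or.inr hω'
  linarith

/-- `X n` is bounded in mean by a multiple of `v n`, on events whose probability is arbitrarily
close to `1`. -/
def LocalMeanBound (Pr : Measure Ω) (X : ℕ → Ω → ℝ) (v : ℕ → ℝ) : Prop :=
  ∀ η : ℝ, 0 < η → ∃ (E : Set Ω) (K : ℝ), MeasurableSet E ∧ Pr.real Eᶜ ≤ η ∧ 0 ≤ K ∧
    ∀ n, 1 ≤ n → IntegrableOn (X n) E Pr ∧ ∫ ω in E, X n ω ∂Pr ≤ K * v n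

lemma exists_event_bound {Y : Ω → ℝ} (hY : Measurable Y) {η : ℝ} (hη : 0 < η) :
    ∃ (E : Set Ω) (B : ℝ), MeasurableSet E ∧ Pr.real Eᶜ ≤ η ∧ ∀ ω ∈ E, |Y ω| ≤ B := by
  set F : ℕ → Set Ω := fun n => {ω | |Y ω| ≤ n} with hF
  have hFm : ∀ n, MeasurableSet (F n) := fun n => hY.norm measurableSet_Iic
  have hmono : Monotone F := fun m n h ω hω => le_trans (show |Y ω| ≤ m from hω) (by exact_mod_cast h)
  have hlim := tendsto_measure_iUnion_atTop (μ := Pr) hmono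
  have hfull : ⋃ n, F n = Set.univ := Set.eq_univ_of_forall fun ω =>
    Set.mem_iUnion.2 (exists_nat_ge |Y ω|)
  rw [hfull, measure_univ] at hlim
  have hlim' : Tendsto (fun N => Pr.real (F N)) atTop (𝓝 1) := by
    have := (ENNReal.tendsto_toReal ENNReal.one_ne_top).comp hlim
    rwa [ENNReal.toReal_one] at this
  obtain ⟨N, hN⟩ := (hlim'.eventually (lt_mem_nhds (show 1 - η < 1 by linarith))).exists
  refine ⟨F N, N, hFm N, ?_, fun ω hω => hω⟩
  rw [probReal_compl_eq_one_sub (hFm N)]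
  linarith

/-- The finitely many early terms need not be integrable; they are bounded on a further event, at
the cost of half of the admitted probability. -/
lemma LocalMeanBound.of_eventually {v : ℕ → ℝ} (hX0 : ∀ n ω, 0 ≤ X n ω) (hv : ∀ n, 1 ≤ n → 0 < v n)
    (hXm : ∀ n, 1 ≤ n → Measurable (X n))
    (h : ∀ η : ℝ, 0 < η → ∃ (E : Set Ω) (N : ℕ) (K : ℝ), MeasurableSet E ∧ Pr.real Eᶜ ≤ η ∧
      ∀ n, N ≤ n → IntegrableOn (X n) E Pr ∧ ∫ ω in E, X n ω ∂Pr ≤ K * v n) :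
    LocalMeanBound Pr X v := by
  intro η hη
  obtain ⟨E, N, K, hE, hEη, hb⟩ := h (η / 2) (by positivity)
  have hm : Measurable fun ω => ∑ k ∈ Finset.Ico 1 N, |X k ω| :=
    Finset.measurable_fun_sum _ fun k hk => (hXm k (Finset.mem_Ico.1 hk).1).norm
  obtain ⟨F, B, hF, hFη, hB⟩ := exists_event_bound (Pr := Pr) hm (show 0 < η / 2 by positivity)
  set B' := max B 0
  set K' := max K 0 + ∑ k ∈ Finset.Ico 1 N, B' / v k with hK'
  have hB'0 : 0 ≤ B' := le_max_right _ _
  have hs0 : 0 ≤ ∑ k ∈ Finset.Ico 1 N, B' / v k := Finset.sum_nonneg fun k hk =>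
    div_nonneg hB'0 (hv k (Finset.mem_Ico.1 hk).1).le
  have hEF : IntegrableOn (fun _ : Ω => B') (E ∩ F) Pr := integrable_const _
  refine ⟨E ∩ F, K', hE.inter hF, ?_, by positivity, fun n hn => ?_⟩
  · rw [Set.compl_inter]
    exact (measureReal_union_le _ _).trans (by linarith)
  rcases le_or_gt N n with hNn | hNn
  · obtain ⟨h1, h2⟩ := hb n hNn
    refine ⟨h1.mono_set Set.inter_subset_left, ?_⟩
    refine (setIntegral_mono_set h1 (Eventually.of_forall (hX0 n))
      (Set.inter_subset_left (s := E) (t := F)).eventuallyLE).trans (h2.trans ?_)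
    refine mul_le_mul_of_nonneg_right ?_ (hv n hn).le
    exact (le_max_left _ _).trans (le_add_of_nonneg_right hs0)
  · have hmem : n ∈ Finset.Ico 1 N := Finset.mem_Ico.2 ⟨hn, hNn⟩
    have hle : ∀ ω ∈ E ∩ F, |X n ω| ≤ B' := fun ω hω => by
      refine le_trans ?_ ((le_abs_self _).trans ((hB ω hω.2).trans (le_max_left _ _)))
      exact Finset.single_le_sum (f := fun k => |X k ω|) (fun k _ => abs_nonneg _) hmem
    have hi : IntegrableOn (X n) (E ∩ F) Pr := hEF.mono' (hXm n hn).aestronglyMeasurable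
      ((ae_restrict_iff' (hE.inter hF)).2 (Eventually.of_forall hle))
    refine ⟨hi, ?_⟩
    calc ∫ ω in E ∩ F, X n ω ∂Pr ≤ ∫ ω in E ∩ F, B' ∂Pr :=
          setIntegral_mono_on hi hEF (hE.inter hF) fun ω hω => (le_abs_self _).trans (hle ω hω)
      _ = Pr.real (E ∩ F) * B' := by rw [setIntegral_const, smul_eq_mul]
      _ ≤ 1 * B' := mul_le_mul_of_nonneg_right measureReal_le_one hB'0
      _ = B' / v n * v n := by field_simp [(hv n hn).ne']
      _ ≤ K' * v n := by
        refine mul_le_mul_of_nonneg_right ?_ (hv n hn).le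
        have h1 := Finset.single_le_sum (f := fun k => B' / v k)
          (fun k hk => div_nonneg hB'0 (hv k (Finset.mem_Ico.1 hk).1).le) hmem
        exact h1.trans (le_add_of_nonneg_left (le_max_right _ _))

lemma LocalMeanBound.mono {v : ℕ → ℝ} (hX : LocalMeanBound Pr X v)
    (hYm : ∀ n, 1 ≤ n → Measurable (Y n)) (h : ∀ n, 1 ≤ n → ∀ ω, |Y n ω| ≤ X n ω) :
    LocalMeanBound Pr Y v := by
  intro η hη
  obtain ⟨E, K, hE, hEη, hK, hb⟩ := hX η hη
  refine ⟨E, K, hE, hEη, hK, fun n hn => ?_⟩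
  obtain ⟨h1, h2⟩ := hb n hn
  have h3 : IntegrableOn (Y n) E Pr :=
    h1.mono' (hYm n hn).aestronglyMeasurable (Eventually.of_forall (h n hn))
  exact ⟨h3, (integral_mono h3 h1 fun ω => (le_abs_self _).trans (h n hn ω)).trans h2⟩

lemma LocalMeanBound.const_mul {v : ℕ → ℝ} (hX : LocalMeanBound Pr X v) {u : ℕ → ℝ}
    (hu : ∀ n, 1 ≤ n → 0 ≤ u n) :
    LocalMeanBound Pr (fun n ω => u n * X n ω) (fun n => u n * v n) := by
  intro η hη
  obtain ⟨E, K, hE, hEη, hK, hb⟩ := hX η hη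
  refine ⟨E, K, hE, hEη, hK, fun n hn => ?_⟩
  obtain ⟨h1, h2⟩ := hb n hn
  refine ⟨h1.const_mul _, ?_⟩
  rw [integral_const_mul]
  calc u n * ∫ ω in E, X n ω ∂Pr ≤ u n * (K * v n) := mul_le_mul_of_nonneg_left h2 (hu n hn)
    _ = _ := by ring

lemma LocalMeanBound.sum {v : ℕ → ℝ} (hX : LocalMeanBound Pr X v) {w : ℕ → ℕ → ℝ}
    (hw : ∀ n k, 1 ≤ k → 0 ≤ w n k) :
    LocalMeanBound Pr (fun n ω => ∑ k ∈ Finset.Icc 1 n, w n k * X k ω)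
      (fun n => ∑ k ∈ Finset.Icc 1 n, w n k * v k) := by
  intro η hη
  obtain ⟨E, K, hE, hEη, hK, hb⟩ := hX η hη
  have hi : ∀ n, ∀ k ∈ Finset.Icc 1 n, IntegrableOn (fun ω => w n k * X k ω) E Pr :=
    fun n k hk => (hb k (Finset.mem_Icc.1 hk).1).1.const_mul _
  refine ⟨E, K, hE, hEη, hK, fun n hn => ⟨integrable_finsetSum _ (hi n), ?_⟩⟩
  rw [integral_finsetSum _ (hi n), Finset.mul_sum]
  refine Finset.sum_le_sum fun k hk => ?_
  rw [integral_const_mul]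
  calc w n k * ∫ ω in E, X k ω ∂Pr ≤ w n k * (K * v k) :=
        mul_le_mul_of_nonneg_left (hb k (Finset.mem_Icc.1 hk).1).2
          (hw n k (Finset.mem_Icc.1 hk).1)
    _ = _ := by ring

lemma LocalMeanBound.probZero {v : ℕ → ℝ} (hX : LocalMeanBound Pr X v)
    (hX0 : ∀ n, 1 ≤ n → ∀ ω, 0 ≤ X n ω) (hv : Tendsto v atTop (𝓝 0)) : ProbZero Pr X := by
  refine ProbZero.of_events fun η hη => ?_
  obtain ⟨E, K, hE, hEη, hK, hb⟩ := hX η hη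
  refine ⟨E, hEη, ?_⟩
  have h0 := hv.const_mul K
  rw [mul_zero] at h0
  have hnn : ∀ᶠ n in atTop, ∀ ω, 0 ≤ E.indicator (X n) ω := by
    filter_upwards [eventually_ge_atTop 1] with n hn ω
    exact Set.indicator_nonneg (fun ω _ => hX0 n hn ω) ω
  refine ProbZero.of_integral hnn ?_ (squeeze_zero' ?_ ?_ h0)
  · filter_upwards [eventually_ge_atTop 1] with n hn
    exact (integrable_indicator_iff hE).2 (hb n hn).1
  · filter_upwards [hnn] with n hn
    exact integral_nonneg hn
  · filter_upwards [eventually_ge_atTop 1] with n hn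
    rw [integral_indicator hE]
    exact (hb n hn).2

/-- With `s = √v`, the elementary bound `|X| ≤ X²/s + s` replaces the Cauchy–Schwarz inequality and
gives integrability at the same time. -/
lemma LocalMeanBound.sqrt {v : ℕ → ℝ} (hX : LocalMeanBound Pr (fun n ω => X n ω ^ 2) v)
    (hXm : ∀ n, 1 ≤ n → Measurable (X n)) (hv : ∀ n, 1 ≤ n → 0 < v n) :
    LocalMeanBound Pr X (fun n => Real.sqrt (v n)) := by
  intro η hη
  obtain ⟨E, K, hE, hEη, hK, hb⟩ := hX η hη
  refine ⟨E, K + 1, hE, hEη, by positivity, fun n hn1 => ?_⟩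
  obtain ⟨hi, hle⟩ := hb n hn1
  have hs : 0 < Real.sqrt (v n) := Real.sqrt_pos.2 (hv n hn1)
  set s := Real.sqrt (v n) with hsdef
  have hsv : v n = s * s := (Real.mul_self_sqrt (hv n hn1).le).symm
  have hbound : ∀ ω, |X n ω| ≤ s⁻¹ * X n ω ^ 2 + s := by
    intro ω
    have e : s⁻¹ * X n ω ^ 2 + s - |X n ω| = s⁻¹ * ((|X n ω| - s / 2) ^ 2 + 3 / 4 * s ^ 2) := by
      rw [← sq_abs (X n ω)]
      field_simp
      ring
    have : 0 ≤ s⁻¹ * ((|X n ω| - s / 2) ^ 2 + 3 / 4 * s ^ 2) := by positivity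
    linarith
  have hi2 : IntegrableOn (fun ω => s⁻¹ * X n ω ^ 2 + s) E Pr :=
    (hi.const_mul s⁻¹).add (integrable_const s)
  have hi3 : IntegrableOn (X n) E Pr :=
    hi2.mono' (hXm n hn1).aestronglyMeasurable (Eventually.of_forall hbound)
  refine ⟨hi3, ?_⟩
  calc ∫ ω in E, X n ω ∂Pr ≤ ∫ ω in E, (s⁻¹ * X n ω ^ 2 + s) ∂Pr :=
        integral_mono hi3 hi2 fun ω => (le_abs_self _).trans (hbound ω)
    _ = s⁻¹ * (∫ ω in E, X n ω ^ 2 ∂Pr) + Pr.real E * s := by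
        rw [integral_add (hi.const_mul s⁻¹) (integrable_const s), integral_const_mul,
          setIntegral_const, smul_eq_mul]
    _ ≤ s⁻¹ * (K * (s * s)) + 1 * s := by
        rw [← hsv]
        gcongr
        exact measureReal_le_one
    _ = (K + 1) * s := by field_simp

end ProbZero

section Error
variable {d δ : ℕ} {Ω : Type*} [m0 : MeasurableSpace Ω] {Pr : Measure Ω} [IsProbabilityMeasure Pr]
  {a c : ℕ → ℝ} {Θ : ℕ → Ω → EuclideanSpace ℝ (Fin d)} {M : ℕ → Ω → ℝ}
  {Z : ℕ → Label d δ → Ω → ℝ} {f : EuclideanSpace ℝ (Fin d) → ℝ} {σ p L τ : ℝ}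
  {θ : EuclideanSpace ℝ (Fin d)}

/-- By almost sure convergence, the events that all iterates from `N` on are within `r` of `θ`
increase to an event of probability `1`. -/
lemma localMeanBound_sq (hA : IsAlgorithm a c Θ M Z) (hf : Measurable f)
    (hM : IsRegularMaximizer f θ L)
    (hX : NoiseArray Pr (history f c Θ Z) (noise f c Θ Z) σ p) (hR : Rates a c τ)
    (hconv : ∀ᵐ ω ∂Pr, Tendsto (fun n => Θ n ω) atTop (𝓝 θ)) :
    LocalMeanBound Pr (fun n ω => ‖Θ n ω - θ‖ ^ 2) (errRate a c) := by
  obtain ⟨r, hr, N₀, hN₀, hb⟩ := exists_setIntegral_sq_le hA hf hM hX hR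
  refine LocalMeanBound.of_eventually (fun n ω => by positivity) (fun n hn => errRate_pos (hR.a_pos n hn) (hR.c_pos n hn))
    (fun n hn => (((hA.measurable_theta hn).sub_const θ).norm).pow_const 2) fun η hη => ?_
  set F : ℕ → Set Ω := fun N => ⋂ k ∈ Set.Ici (max N N₀), {ω | ‖Θ k ω - θ‖ ≤ r} with hF
  have hm : ∀ k, N₀ ≤ k → Measurable fun ω => ‖Θ k ω - θ‖ := fun k hk =>
    ((hA.measurable_theta (hN₀.trans hk)).sub_const θ).norm
  have hFm : ∀ N, MeasurableSet (F N) := fun N =>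
    MeasurableSet.biInter (Set.to_countable _) fun k hk =>
      hm k ((le_max_right _ _).trans hk) measurableSet_Iic
  have hmono : Monotone F := fun N N' h =>
    Set.biInter_subset_biInter_left (Set.Ici_subset_Ici.2 (max_le_max_right _ h))
  have hlim := tendsto_measure_iUnion_atTop (μ := Pr) hmono
  have hfull : Pr (⋃ N, F N) = 1 := by
    rw [← prob_compl_eq_zero_iff (MeasurableSet.iUnion hFm)]
    refine measure_mono_null (t := {ω | ¬ Tendsto (fun n => Θ n ω) atTop (𝓝 θ)}) ?_ hconv
    intro ω hω hc
    refine hω ?_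
    obtain ⟨N, hN⟩ := eventually_atTop.1 (hc.eventually (Metric.closedBall_mem_nhds θ hr))
    refine Set.mem_iUnion.2 ⟨N, Set.mem_iInter₂.2 fun k hk => ?_⟩
    have := hN k ((le_max_left _ _).trans hk)
    rwa [dist_eq_norm] at this
  rw [hfull] at hlim
  have hlim' : Tendsto (fun N => Pr.real (F N)) atTop (𝓝 1) := by
    have := (ENNReal.tendsto_toReal ENNReal.one_ne_top).comp hlim
    rwa [ENNReal.toReal_one] at this
  obtain ⟨N, hN⟩ := (hlim'.eventually (lt_mem_nhds (show 1 - η < 1 by linarith))).exists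
  obtain ⟨K, hK⟩ := hb (max N N₀) (le_max_right _ _)
  refine ⟨F N, max N N₀, K, hFm N, ?_, fun n hn => ?_⟩
  · rw [probReal_compl_eq_one_sub (hFm N)]; linarith
  have hn0 : N₀ ≤ n := (le_max_right _ _).trans hn
  have hn1 : 1 ≤ n := hN₀.trans hn0
  have hmeas : Measurable fun ω => ‖Θ n ω - θ‖ ^ 2 := (hm n hn0).pow_const 2
  have hbd : ∀ A : Set Ω, MeasurableSet A → (∀ ω ∈ A, ‖Θ n ω - θ‖ ≤ r) →
      IntegrableOn (fun ω => ‖Θ n ω - θ‖ ^ 2) A Pr := fun A hA hAr => by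
    refine IntegrableOn.of_bound (measure_lt_top _ _) hmeas.aestronglyMeasurable (r ^ 2) ?_
    refine (ae_restrict_iff' hA).2 (Eventually.of_forall fun ω hω => ?_)
    rw [Real.norm_of_nonneg (by positivity)]
    exact pow_le_pow_left₀ (norm_nonneg _) (hAr ω hω) 2
  -- The event `F N` involves the whole future; the moment bound holds on the larger event that
  -- looks only up to step `n`.
  have hsub : F N ⊆ nearEvent Θ θ r (max N N₀) n := fun ω hω =>
    Set.mem_iInter₂.2 fun k hk => Set.mem_iInter₂.1 hω k (Finset.mem_Icc.1 hk).1
  have hnear : MeasurableSet (nearEvent Θ θ r (max N N₀) n) :=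
    hA.history_le hf n _ (hA.measurableSet_nearEvent hf r (hN₀.trans (le_max_right _ _)))
  refine ⟨hbd _ (hFm N) fun ω hω => Set.mem_iInter₂.1 hω n hn, ?_⟩
  refine (setIntegral_mono_set (hbd _ hnear fun ω hω => norm_le_of_mem_nearEvent hn le_rfl hω)
    (Eventually.of_forall fun ω => by positivity) hsub.eventuallyLE).trans (hK n hn)

end Error

end

/-! ### The decomposition of the averaged error. -/

section

/-- The partial sums of `k^{-1/2}` are of order `√n`, so those of `y` are `o(√n)`. -/
lemma tendsto_rpow_mul_partialSum {y : ℕ → ℝ}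
    (hy : y =o[atTop] fun n : ℕ => (n : ℝ) ^ (-(1 / 2) : ℝ)) :
    Tendsto (fun n : ℕ => (n : ℝ) ^ (-(1 / 2) : ℝ) * partialSum y n) atTop (𝓝 0) := by
  have hGS : GS (-(1 / 2)) fun n : ℕ => (n : ℝ) ^ (-(1 / 2) : ℝ) := GS.rpow_nat _
  have h1 := isLittleO_partialSum hy (fun n _ => by positivity)
    (hGS.tendsto_partialSum_atTop (by norm_num))
  have h2 := hGS.tendsto_mul_div_partialSum (by norm_num)
  have h3 : (fun n : ℕ => partialSum (fun n : ℕ => (n : ℝ) ^ (-(1 / 2) : ℝ)) n)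
      =O[atTop] fun n : ℕ => (n : ℝ) * (n : ℝ) ^ (-(1 / 2) : ℝ) := by
    refine Asymptotics.isBigO_of_div_tendsto_nhds ?_ _
      (h2.inv₀ (by norm_num) |>.congr fun n => ?_)
    · filter_upwards [eventually_ge_atTop 1] with n hn h0
      have : (0 : ℝ) < n := by positivity
      have : 0 < (n : ℝ) * (n : ℝ) ^ (-(1 / 2) : ℝ) := by positivity
      exact absurd h0 this.ne'
    · simp
  have h4 := (h1.trans_isBigO h3)
  have h5 := (Asymptotics.isBigO_refl (fun n : ℕ => (n : ℝ) ^ (-(1 / 2) : ℝ)) atTop).mul_isLittleO h4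
  have h6 : (fun n : ℕ => (n : ℝ) ^ (-(1 / 2) : ℝ) * ((n : ℝ) * (n : ℝ) ^ (-(1 / 2) : ℝ)))
      =ᶠ[atTop] fun _ => (1 : ℝ) := by
    filter_upwards [eventually_ge_atTop 1] with n hn
    have hn0 : (0 : ℝ) < n := by positivity
    have e : (n : ℝ) ^ (-(1 / 2) : ℝ) * (n : ℝ) ^ (-(1 / 2) : ℝ) = (n : ℝ)⁻¹ := by
      rw [← Real.rpow_add hn0, ← Real.rpow_neg_one]; norm_num
    rw [mul_left_comm, e, mul_inv_cancel₀ hn0.ne']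
  exact (Asymptotics.isLittleO_one_iff ℝ).1 (h5.trans_eventuallyEq h6)

namespace Rates
variable {a c : ℕ → ℝ} {τ : ℝ}

lemma gain_pos (h : Rates a c τ) {n : ℕ} (hn : 1 ≤ n) : 0 < c n ^ 2 / a n := by
  have := h.a_pos n hn
  have := h.c_pos n hn
  positivity

lemma errRate_pos (h : Rates a c τ) {n : ℕ} (hn : 1 ≤ n) : 0 < errRate a c n :=
  KWB.errRate_pos (h.a_pos n hn) (h.c_pos n hn)

lemma weightSum_pos (h : Rates a c τ) {n : ℕ} (hn : 1 ≤ n) : 0 < weightSum c n :=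
  partialSum_pos (fun k hk => by have := h.c_pos k hk; positivity) hn

lemma driftRate_pos (h : Rates a c τ) {n : ℕ} (hn : 1 ≤ n) : 0 < driftRate c n :=
  KWB.driftRate_pos hn (h.c_pos n hn)

lemma driftSum_pos (h : Rates a c τ) {n : ℕ} (hn : 1 ≤ n) : 0 < partialSum (driftRate c) n :=
  partialSum_pos (fun _ hk => h.driftRate_pos hk) hn

/-- The boundary term of Abel's summation is `n` times the corresponding drift term, and `n *
driftRate` is dominated by the partial sums of `driftRate`. -/
lemma gain_mul_sqrt_isLittleO (h : Rates a c τ) :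
    (fun n => c n ^ 2 / a n * Real.sqrt (errRate a c n)) =o[atTop] partialSum (driftRate c) := by
  have h1 := (Asymptotics.isBigO_refl (fun n : ℕ => (n : ℝ)) atTop).mul_isLittleO
    h.drift_isLittleO
  refine (h1.trans_isBigO h.mul_driftRate).congr' ?_ EventuallyEq.rfl
  filter_upwards [eventually_ge_atTop 1] with n hn
  have : (0 : ℝ) < n := by positivity
  field_simp

lemma sqrt_errRate_succ (h : Rates a c τ) :
    (fun n => Real.sqrt (errRate a c (n + 1))) =O[atTop] fun n => Real.sqrt (errRate a c n) := by
  obtain ⟨C, hC, hb⟩ := exists_forall_le_of_isBigO h.errRate_succ fun n hn => h.errRate_pos hn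
  refine Asymptotics.IsBigO.of_bound (Real.sqrt C) ?_
  filter_upwards [eventually_ge_atTop 1] with n hn
  rw [Real.norm_of_nonneg (Real.sqrt_nonneg _), Real.norm_of_nonneg (Real.sqrt_nonneg _),
    ← Real.sqrt_mul hC.le]
  exact Real.sqrt_le_sqrt ((le_abs_self _).trans (hb n hn))

lemma gain_mul_sqrt_succ_isLittleO (h : Rates a c τ) :
    (fun n => c n ^ 2 / a n * Real.sqrt (errRate a c (n + 1)))
      =o[atTop] partialSum (driftRate c) :=
  ((Asymptotics.isBigO_refl (fun n => c n ^ 2 / a n) atTop).mul h.sqrt_errRate_succ).trans_isLittleO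
    h.gain_mul_sqrt_isLittleO

lemma driftSum_isLittleO (h : Rates a c τ) :
    partialSum (fun n : ℕ => c n ^ 2 / a n / n * Real.sqrt (errRate a c n))
      =o[atTop] partialSum (driftRate c) :=
  isLittleO_partialSum h.drift_isLittleO (fun _ hn => (h.driftRate_pos hn).le) h.driftSum_atTop

lemma sq_div_isLittleO (h : Rates a c τ) {x : ℕ → ℝ} (hx : x =O[atTop] partialSum (driftRate c)) :
    (fun n => (x n / weightSum c n) ^ 2) =o[atTop] fun n : ℕ => (n : ℝ) ^ (-(1 / 2) : ℝ) := by
  have h1 : (fun n => x n / weightSum c n) =o[atTop] fun n : ℕ => (n : ℝ) ^ (-(1 / 4) : ℝ) := by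
    refine Asymptotics.IsBigO.trans_isLittleO ?_ h.driftSum_div
    simp_rw [div_eq_mul_inv]
    exact hx.mul (Asymptotics.isBigO_refl _ _)
  refine (h1.pow two_pos).congr' EventuallyEq.rfl (Eventually.of_forall fun n => ?_)
  simp only
  rw [← Real.rpow_natCast, ← Real.rpow_mul (Nat.cast_nonneg n)]
  norm_num

lemma sum_c_four_isBigO (h : Rates a c τ) :
    partialSum (fun n => c n ^ 4) =O[atTop] partialSum (driftRate c) := by
  refine partialSum_isBigO (Asymptotics.IsBigO.of_bound 1 ?_) fun _ hn => h.driftRate_pos hn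
  filter_upwards [eventually_ge_atTop 1] with n hn
  have hc := h.c_pos n hn
  rw [one_mul, Real.norm_of_nonneg (by positivity), Real.norm_of_nonneg (h.driftRate_pos hn).le,
    driftRate]
  exact le_add_of_nonneg_left (by positivity)

end Rates

section Abel
variable {E : Type*} [AddCommGroup E] [Module ℝ E]

lemma sum_smul_sub_eq (b : ℕ → ℝ) (x : ℕ → E) {n : ℕ} (hn : 1 ≤ n) :
    ∑ k ∈ Finset.Icc 1 n, b k • (x (k + 1) - x k)
      = b n • x (n + 1) - b 1 • x 1 - ∑ k ∈ Finset.Icc 2 n, (b k - b (k - 1)) • x k := by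
  induction n, hn using Nat.le_induction with
  | base => simp [smul_sub]
  | succ n hn ih =>
    rw [Finset.sum_Icc_succ_top (by omega), Finset.sum_Icc_succ_top (by omega), ih]
    simp only [Nat.add_sub_cancel, smul_sub, sub_smul]
    abel

end Abel

section Decomposition
variable {d δ : ℕ} {Ω : Type*}

/-- The error of the second order expansion of the difference quotients. -/
def expansionError (f : EuclideanSpace ℝ (Fin d) → ℝ) (θ : EuclideanSpace ℝ (Fin d)) (c : ℕ → ℝ)
    (Θ : ℕ → Ω → EuclideanSpace ℝ (Fin d)) (k : ℕ) (ω : Ω) : EuclideanSpace ℝ (Fin d) :=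
  diffQuotient f (c k) (Θ k ω) - hessianCLM f θ (Θ k ω - θ) - c k ^ 2 • biasVec f θ

/-- The sum of the errors `gradNoise` with weights `c k`. -/
def noiseSum (ξ : ℕ → Label d δ → Ω → ℝ) (c : ℕ → ℝ) (n : ℕ) (ω : Ω) : EuclideanSpace ℝ (Fin d) :=
  ∑ k ∈ Finset.Icc 1 n, c k • gradNoise ξ k ω

/-- The negligible part of the decomposition of the averaged error. -/
def remainder (f : EuclideanSpace ℝ (Fin d) → ℝ) (θ : EuclideanSpace ℝ (Fin d)) (a c : ℕ → ℝ)
    (Θ : ℕ → Ω → EuclideanSpace ℝ (Fin d)) (n : ℕ) (ω : Ω) : EuclideanSpace ℝ (Fin d) :=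
  (c n ^ 2 / a n) • (Θ (n + 1) ω - θ) - (c 1 ^ 2 / a 1) • (Θ 1 ω - θ)
    - ∑ k ∈ Finset.Icc 2 n, (c k ^ 2 / a k - c (k - 1) ^ 2 / a (k - 1)) • (Θ k ω - θ)
    - ∑ k ∈ Finset.Icc 1 n, c k ^ 2 • expansionError f θ c Θ k ω

variable [MeasurableSpace Ω] {a c : ℕ → ℝ} {Θ : ℕ → Ω → EuclideanSpace ℝ (Fin d)}
  {M : ℕ → Ω → ℝ} {Z : ℕ → Label d δ → Ω → ℝ} {f : EuclideanSpace ℝ (Fin d) → ℝ}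
  {θ : EuclideanSpace ℝ (Fin d)} {τ : ℝ}

lemma weightSum_smul_average_sub (h : Rates a c τ) {n : ℕ} (hn : 1 ≤ n) (ω : Ω) :
    weightSum c n • (average c Θ n ω - θ) = ∑ k ∈ Finset.Icc 1 n, c k ^ 2 • (Θ k ω - θ) := by
  have hS := (h.weightSum_pos hn).ne'
  simp only [smul_sub, Finset.sum_sub_distrib, ← Finset.sum_smul, average]
  rw [smul_smul]
  change (weightSum c n * (weightSum c n)⁻¹) • _ - weightSum c n • θ = _ - weightSum c n • θ
  rw [mul_inv_cancel₀ hS, one_smul]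

/-- The recursion is solved for `H(θ_k - θ)` and multiplied by `c_k²`. The factor `c_k² / a_k` of
the increments becomes a boundary term and differences of weights under Abel's summation, while the
noise keeps the deterministic weight `c_k`. -/
lemma hessianCLM_weightSum_smul (hA : IsAlgorithm a c Θ M Z) (h : Rates a c τ) {n : ℕ} (hn : 1 ≤ n)
    (ω : Ω) : hessianCLM f θ (weightSum c n • (average c Θ n ω - θ))
      = remainder f θ a c Θ n ω - noiseSum (noise f c Θ Z) c n ω
        - partialSum (fun k => c k ^ 4) n • biasVec f θ := by
  rw [weightSum_smul_average_sub h hn, map_sum]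
  have hstep : ∀ k ∈ Finset.Icc 1 n, (c k ^ 2 / a k) • ((Θ (k + 1) ω - θ) - (Θ k ω - θ))
      = hessianCLM f θ (c k ^ 2 • (Θ k ω - θ)) + c k ^ 2 • expansionError f θ c Θ k ω
        + c k • gradNoise (noise f c Θ Z) k ω + c k ^ 4 • biasVec f θ := by
    intro k hk
    obtain ⟨hk1, _⟩ := Finset.mem_Icc.1 hk
    have ha := (h.a_pos k hk1).ne'
    have hc := (h.c_pos k hk1).ne'
    have e : (Θ (k + 1) ω - θ) - (Θ k ω - θ) = a k • (hessianCLM f θ (Θ k ω - θ)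
        + c k ^ 2 • biasVec f θ + expansionError f θ c Θ k ω
        + (c k)⁻¹ • gradNoise (noise f c Θ Z) k ω) := by
      rw [hA.step k hk1 ω, gradientEstimate_eq f c Θ Z k ω, expansionError]
      have : ∀ x y z w g : EuclideanSpace ℝ (Fin d),
          x + w - θ - (x - θ) = w := fun x y z w g => by abel
      rw [this _ 0 0 _ 0]
      congr 1
      abel
    rw [e, smul_smul, div_mul_cancel₀ _ ha, map_smul]
    simp only [smul_add, smul_smul]
    rw [show c k ^ 2 * (c k)⁻¹ = c k by field_simp, show c k ^ 2 * c k ^ 2 = c k ^ 4 by ring]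
    abel
  have hsum := Finset.sum_congr rfl hstep
  rw [sum_smul_sub_eq (fun k => c k ^ 2 / a k) (fun k => Θ k ω - θ) hn] at hsum
  simp only [Finset.sum_add_distrib] at hsum
  rw [← Finset.sum_smul] at hsum
  have hsum' := sub_eq_iff_eq_add.2 (hsum.trans (by abel :
    _ = ((∑ k ∈ Finset.Icc 1 n, hessianCLM f θ (c k ^ 2 • (Θ k ω - θ)))
      + ∑ k ∈ Finset.Icc 1 n, c k • gradNoise (noise f c Θ Z) k ω
      + (∑ k ∈ Finset.Icc 1 n, c k ^ 4) • biasVec f θ)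
      + ∑ k ∈ Finset.Icc 1 n, c k ^ 2 • expansionError f θ c Θ k ω))
  change _ = remainder f θ a c Θ n ω - _ - _
  rw [remainder, hsum']
  simp only [noiseSum, partialSum]
  abel

/-- The part of the expansion error that is not dominated by the square of the error. -/
def excess (f : EuclideanSpace ℝ (Fin d) → ℝ) (θ : EuclideanSpace ℝ (Fin d)) (c : ℕ → ℝ)
    (Θ : ℕ → Ω → EuclideanSpace ℝ (Fin d)) (C : ℝ) (k : ℕ) (ω : Ω) : ℝ :=
  max (‖expansionError f θ c Θ k ω‖ - C * ‖Θ k ω - θ‖ ^ 2) 0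

/-- The bound separates what is controlled in mean (the last iterate, the drift of the weights, the
squared errors) from the final bracket, which is controlled for almost every `ω`. -/
lemma norm_remainder_le (h : Rates a c τ) {K C : ℝ} (hK : ∀ n : ℕ, 1 ≤ n →
      |c n ^ 2 / a n - c (n - 1) ^ 2 / a (n - 1)| ≤ K * (c n ^ 2 / a n / n)) {n : ℕ} (hn : 1 ≤ n)
    (ω : Ω) : ‖remainder f θ a c Θ n ω‖
      ≤ c n ^ 2 / a n * ‖Θ (n + 1) ω - θ‖
        + K * ∑ k ∈ Finset.Icc 1 n, c k ^ 2 / a k / k * ‖Θ k ω - θ‖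
        + C * ∑ k ∈ Finset.Icc 1 n, c k ^ 2 * ‖Θ k ω - θ‖ ^ 2
        + (c 1 ^ 2 / a 1 * ‖Θ 1 ω - θ‖
          + ∑ k ∈ Finset.Icc 1 n, c k ^ 2 * excess f θ c Θ C k ω) := by
  have hK0 : 0 ≤ K := by
    have h1 := (abs_nonneg _).trans (hK 1 le_rfl)
    have := h.gain_pos le_rfl
    by_contra! hneg
    have : K * (c 1 ^ 2 / a 1 / (1 : ℕ)) < 0 := mul_neg_of_neg_of_pos hneg (by simpa using this)
    linarith
  have h1 : ‖∑ k ∈ Finset.Icc 2 n, (c k ^ 2 / a k - c (k - 1) ^ 2 / a (k - 1)) • (Θ k ω - θ)‖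
      ≤ K * ∑ k ∈ Finset.Icc 1 n, c k ^ 2 / a k / k * ‖Θ k ω - θ‖ := by
    refine (norm_sum_le _ _).trans ?_
    rw [Finset.mul_sum]
    refine (Finset.sum_le_sum fun k hk => ?_).trans
      (Finset.sum_le_sum_of_subset_of_nonneg (Finset.Icc_subset_Icc_left one_le_two)
        fun k hk _ => ?_)
    · rw [norm_smul, ← mul_assoc]
      exact mul_le_mul_of_nonneg_right (hK k (by have := Finset.mem_Icc.1 hk; omega))
        (norm_nonneg _)
    · have := h.gain_pos (Finset.mem_Icc.1 hk).1
      positivity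
  have h2 : ‖∑ k ∈ Finset.Icc 1 n, c k ^ 2 • expansionError f θ c Θ k ω‖
      ≤ C * (∑ k ∈ Finset.Icc 1 n, c k ^ 2 * ‖Θ k ω - θ‖ ^ 2)
        + ∑ k ∈ Finset.Icc 1 n, c k ^ 2 * excess f θ c Θ C k ω := by
    refine (norm_sum_le _ _).trans ?_
    rw [Finset.mul_sum, ← Finset.sum_add_distrib]
    refine Finset.sum_le_sum fun k _ => ?_
    rw [norm_smul, Real.norm_of_nonneg (sq_nonneg _)]
    have : ‖expansionError f θ c Θ k ω‖ ≤ C * ‖Θ k ω - θ‖ ^ 2 + excess f θ c Θ C k ω := by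
      have := le_max_left (‖expansionError f θ c Θ k ω‖ - C * ‖Θ k ω - θ‖ ^ 2) 0
      rw [excess]
      linarith
    calc c k ^ 2 * ‖expansionError f θ c Θ k ω‖
        ≤ c k ^ 2 * (C * ‖Θ k ω - θ‖ ^ 2 + excess f θ c Θ C k ω) := by gcongr
      _ = _ := by ring
  have h3 : ‖(c n ^ 2 / a n) • (Θ (n + 1) ω - θ)‖ = c n ^ 2 / a n * ‖Θ (n + 1) ω - θ‖ := by
    rw [norm_smul, Real.norm_of_nonneg (h.gain_pos hn).le]
  have h4 : ‖(c 1 ^ 2 / a 1) • (Θ 1 ω - θ)‖ = c 1 ^ 2 / a 1 * ‖Θ 1 ω - θ‖ := by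
    rw [norm_smul, Real.norm_of_nonneg (h.gain_pos le_rfl).le]
  rw [remainder]
  refine (norm_sub_le _ _).trans ?_
  refine (add_le_add ((norm_sub_le _ _).trans (add_le_add (norm_sub_le _ _) h1)) h2).trans ?_
  rw [h3, h4]
  linarith

end Decomposition

end

/-! ### Negligibility of the remainder. -/

section

/-- Minkowski's inequality in `ℓ²`: the vector indexed by `k` is the sum over `j` of vectors
supported on `k ≥ j`. -/
lemma sqrt_sum_sq_le (q s : ℕ → ℝ) (hq : ∀ j, 0 ≤ q j) (n : ℕ) :
    Real.sqrt (∑ k ∈ Finset.Icc 1 n, ((∑ j ∈ Finset.Icc 1 k, q j) * s k) ^ 2)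
      ≤ ∑ j ∈ Finset.Icc 1 n, q j * Real.sqrt (∑ k ∈ Finset.Icc j n, s k ^ 2) := by
  set x : ℕ → EuclideanSpace ℝ (Finset.Icc 1 n) := fun j =>
    WithLp.toLp 2 fun k => if j ≤ (k : ℕ) then q j * s k else 0 with hx
  have h1 : ∀ j ∈ Finset.Icc 1 n, ‖x j‖ = q j * Real.sqrt (∑ k ∈ Finset.Icc j n, s k ^ 2) := by
    intro j hj
    obtain ⟨hj1, hj2⟩ := Finset.mem_Icc.1 hj
    rw [EuclideanSpace.norm_eq]
    simp only [hx, Real.norm_eq_abs, sq_abs]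
    rw [Finset.sum_coe_sort (Finset.Icc 1 n)
      (fun k => (if j ≤ k then q j * s k else 0) ^ 2)]
    have e : ∑ k ∈ Finset.Icc 1 n, (if j ≤ k then q j * s k else 0) ^ 2
        = q j ^ 2 * ∑ k ∈ Finset.Icc j n, s k ^ 2 := by
      rw [Finset.mul_sum, show Finset.Icc j n = (Finset.Icc 1 n).filter (j ≤ ·) by
        ext k; simp only [Finset.mem_Icc, Finset.mem_filter]; omega, Finset.sum_filter]
      refine Finset.sum_congr rfl fun k _ => ?_
      split_ifs
      · ring
      · simp
    rw [e, Real.sqrt_mul (sq_nonneg _), Real.sqrt_sq (hq j)]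
  have h2 : Real.sqrt (∑ k ∈ Finset.Icc 1 n, ((∑ j ∈ Finset.Icc 1 k, q j) * s k) ^ 2)
      = ‖∑ j ∈ Finset.Icc 1 n, x j‖ := by
    rw [EuclideanSpace.norm_eq, ← Finset.sum_coe_sort (Finset.Icc 1 n)
      (fun k => ((∑ j ∈ Finset.Icc 1 k, q j) * s k) ^ 2)]
    congr 1
    refine Finset.sum_congr rfl fun k _ => ?_
    rw [Real.norm_eq_abs, sq_abs]
    congr 1
    have hk := Finset.mem_Icc.1 k.2
    simp only [WithLp.ofLp_sum, Finset.sum_apply, hx]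
    rw [Finset.sum_mul, show Finset.Icc 1 (k : ℕ) = (Finset.Icc 1 n).filter (· ≤ (k : ℕ)) by
        ext j; simp only [Finset.mem_Icc, Finset.mem_filter]; omega, Finset.sum_filter]
  rw [h2]
  exact (norm_sum_le _ _).trans_eq (Finset.sum_congr rfl h1)

section Noise
variable {d δ : ℕ} {Ω : Type*} [m0 : MeasurableSpace Ω] {Pr : Measure Ω} [IsProbabilityMeasure Pr]
  {G : ℕ → MeasurableSpace Ω} {ξ : ℕ → Label d δ → Ω → ℝ} {σ p : ℝ}
namespace NoiseArray

lemma integral_mul_comb_of_integrable (h : NoiseArray Pr G ξ σ p) {n : ℕ} (hn : 1 ≤ n)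
    (w : Label d δ → ℝ) {U : Ω → ℝ} (hU : Measurable[G n] U)
    (hi : Integrable (fun ω => U ω * comb ξ n w ω) Pr) :
    ∫ ω, U ω * comb ξ n w ω ∂Pr = 0 := by
  refine integral_mul_eq_zero_of_setIntegral_eq_zero (h.le n)
    ((h.memLp_comb hn w).integrable (by norm_num)) (fun A hA => ?_) hU.stronglyMeasurable hi
  have h1 := h.integral_mul_comb hn w (W := A.indicator fun _ => 1)
    (measurable_const.indicator hA) ⟨1, fun ω => by by_cases hω : ω ∈ A <;> simp [hω]⟩
  rw [← integral_indicator (h.le n _ hA), ← h1]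
  refine integral_congr_ae (Eventually.of_forall fun ω => ?_)
  by_cases hω : ω ∈ A <;> simp [hω]

lemma measurable_noiseSum (h : NoiseArray Pr G ξ σ p) (c : ℕ → ℝ) (n : ℕ) :
    Measurable[G (n + 1)] (noiseSum ξ c n) :=
  Finset.measurable_fun_sum _ fun k hk =>
    ((h.measurable_gradNoise (Finset.mem_Icc.1 hk).1).mono
      (h.mono (by have := Finset.mem_Icc.1 hk; omega)) le_rfl).const_smul (c k)

lemma memLp_noiseSum (h : NoiseArray Pr G ξ σ p) (c : ℕ → ℝ) (n : ℕ) :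
    MemLp (noiseSum ξ c n) 2 Pr :=
  memLp_finsetSum _ fun k hk => (h.memLp_gradNoise (Finset.mem_Icc.1 hk).1).const_smul (c k)

lemma integral_inner_gradNoise_of_memLp (h : NoiseArray Pr G ξ σ p) {n : ℕ} (hn : 1 ≤ n)
    {V : Ω → EuclideanSpace ℝ (Fin d)} (hV : Measurable[G n] V) (hV2 : MemLp V 2 Pr) :
    ∫ ω, inner ℝ (V ω) (gradNoise ξ n ω) ∂Pr = 0 := by
  have e : ∀ ω, inner ℝ (V ω) (gradNoise ξ n ω)
      = ∑ i, V ω i * comb ξ n (gradWeight (basisVec i)) ω := fun ω => by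
    conv_lhs => rw [eq_sum_smul_basisVec (V ω)]
    rw [sum_inner]
    refine Finset.sum_congr rfl fun i _ => ?_
    rw [real_inner_smul_left, inner_gradNoise]
  have hVi : ∀ i, Measurable[G n] fun ω => V ω i := fun i =>
    (EuclideanSpace.proj (𝕜 := ℝ) i).measurable.comp hV
  have hi : ∀ i, Integrable (fun ω => V ω i * comb ξ n (gradWeight (basisVec i)) ω) Pr := fun i =>
    MemLp.integrable_mul (f := fun ω => V ω i) ((EuclideanSpace.proj (𝕜 := ℝ) i).comp_memLp' hV2)
      (h.memLp_comb hn _)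
  simp_rw [e]
  rw [integral_finsetSum _ fun i _ => hi i]
  exact Finset.sum_eq_zero fun i _ => h.integral_mul_comb_of_integrable hn _ (hVi i) (hi i)

/-- The increments are orthogonal to the past, and step `k` contributes `c_k²` times `σ²/2` for each
of the `d` coordinates. -/
lemma integral_norm_sq_noiseSum (h : NoiseArray Pr G ξ σ p) (c : ℕ → ℝ) (n : ℕ) :
    ∫ ω, ‖noiseSum ξ c n ω‖ ^ 2 ∂Pr = d * σ ^ 2 / 2 * weightSum c n := by
  induction n with
  | zero => simp [noiseSum, weightSum, partialSum_zero]
  | succ n ih =>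
    have hn : 1 ≤ n + 1 := by omega
    have e : ∀ ω, ‖noiseSum ξ c (n + 1) ω‖ ^ 2 = ‖noiseSum ξ c n ω‖ ^ 2
        + (2 * c (n + 1) * inner ℝ (noiseSum ξ c n ω) (gradNoise ξ (n + 1) ω)
          + c (n + 1) ^ 2 * ‖gradNoise ξ (n + 1) ω‖ ^ 2) := by
      intro ω
      have : noiseSum ξ c (n + 1) ω = noiseSum ξ c n ω + c (n + 1) • gradNoise ξ (n + 1) ω :=
        Finset.sum_Icc_succ_top hn _
      rw [this, norm_add_sq_real, norm_smul, real_inner_smul_right, mul_pow, Real.norm_eq_abs,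
        sq_abs]
      ring
    have hN := h.memLp_noiseSum c n
    have hη := h.memLp_gradNoise hn
    have i1 : Integrable (fun ω => ‖noiseSum ξ c n ω‖ ^ 2) Pr :=
      hN.integrable_norm_pow (by norm_num)
    have i2 : Integrable (fun ω => 2 * c (n + 1)
        * inner ℝ (noiseSum ξ c n ω) (gradNoise ξ (n + 1) ω)) Pr := by
      refine Integrable.const_mul ?_ _
      refine (MemLp.integrable_mul (f := fun ω => ‖noiseSum ξ c n ω‖)
        (g := fun ω => ‖gradNoise ξ (n + 1) ω‖) hN.norm hη.norm).mono'
        (hN.1.inner hη.1) (Eventually.of_forall fun ω => norm_inner_le_norm _ _)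
    have i3 : Integrable (fun ω => c (n + 1) ^ 2 * ‖gradNoise ξ (n + 1) ω‖ ^ 2) Pr :=
      (hη.integrable_norm_pow (by norm_num)).const_mul _
    have i23 : Integrable (fun ω => 2 * c (n + 1)
        * inner ℝ (noiseSum ξ c n ω) (gradNoise ξ (n + 1) ω)
          + c (n + 1) ^ 2 * ‖gradNoise ξ (n + 1) ω‖ ^ 2) Pr := i2.add i3
    simp_rw [e]
    have h1 := h.integral_mul_norm_sq_gradNoise hn (W := fun _ => 1) measurable_const
      ⟨1, fun _ => by simp⟩
    simp only [one_mul, integral_const, probReal_univ, smul_eq_mul, mul_one] at h1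
    rw [integral_add i1 i23, integral_add i2 i3, integral_const_mul, integral_const_mul, ih, h1,
      h.integral_inner_gradNoise_of_memLp hn (h.measurable_noiseSum c n) hN, weightSum, weightSum,
      partialSum_succ]
    ring

end NoiseArray
end Noise

section Average
variable {Ω : Type*} [m0 : MeasurableSpace Ω] {Pr : Measure Ω} [IsProbabilityMeasure Pr]
  {X Y : ℕ → Ω → ℝ} {v : ℕ → ℝ}

lemma LocalMeanBound.probZero_average (hX : LocalMeanBound Pr X v)
    (hX0 : ∀ n, 1 ≤ n → ∀ ω, 0 ≤ X n ω)
    (hv : v =o[atTop] fun n : ℕ => (n : ℝ) ^ (-(1 / 2) : ℝ)) :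
    ProbZero Pr fun n ω => (n : ℝ) ^ (-(1 / 2) : ℝ) * ∑ k ∈ Finset.Icc 1 n, X k ω := by
  have h1 := (hX.sum (w := fun n _ => (n : ℝ) ^ (-(1 / 2) : ℝ)) fun n _ _ => by positivity).probZero
    (fun n _ ω => Finset.sum_nonneg fun k hk =>
      mul_nonneg (by positivity) (hX0 k (Finset.mem_Icc.1 hk).1 ω))
    ((tendsto_rpow_mul_partialSum hv).congr fun n => by rw [partialSum, Finset.mul_sum])
  simpa only [Finset.mul_sum] using h1

lemma LocalMeanBound.succ (hX : LocalMeanBound Pr X v) :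
    LocalMeanBound Pr (fun n => X (n + 1)) (fun n => v (n + 1)) := by
  intro η hη
  obtain ⟨E, K, h1, h2, h3, h4⟩ := hX η hη
  exact ⟨E, K, h1, h2, h3, fun n hn => h4 (n + 1) (by omega)⟩

lemma ProbZero.const_mul (hX : ProbZero Pr X) (C : ℝ) : ProbZero Pr fun n ω => C * X n ω := by
  rw [probZero_iff] at hX ⊢
  intro ε hε
  refine squeeze_zero (fun n => measureReal_nonneg) (fun n => ?_)
    (hX (ε / (|C| + 1)) (by positivity))
  refine measureReal_mono fun ω hω => ?_
  simp only [Set.mem_ofPred_eq, abs_mul] at hω ⊢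
  rw [div_le_iff₀ (by positivity)]
  nlinarith [abs_nonneg (X n ω)]

/-- The square of a weighted sum, by the Cauchy–Schwarz inequality. -/
lemma LocalMeanBound.sq_sum (hX : LocalMeanBound Pr (fun n ω => X n ω ^ 2) v)
    (hXm : ∀ n, 1 ≤ n → Measurable (X n)) (hv : ∀ n, 1 ≤ n → 0 < v n) {u : ℕ → ℝ}
    (hu : ∀ n, 1 ≤ n → 0 ≤ u n) :
    LocalMeanBound Pr (fun n ω => (∑ k ∈ Finset.Icc 1 n, u k * X k ω) ^ 2)
      (fun n => (∑ k ∈ Finset.Icc 1 n, u k * Real.sqrt (v k)) ^ 2) := by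
  -- Cauchy–Schwarz with weights adapted to the rates: `(∑ u X)² ≤ (∑ u √v)(∑ (u/√v) X²)`, and both
  -- factors are of order `∑ u √v`.
  have h0 := (hX.sum (w := fun _ k => u k / Real.sqrt (v k)) fun _ k hk =>
    div_nonneg (hu k hk) (Real.sqrt_nonneg _))
  have h1 := h0.const_mul (u := fun n => ∑ k ∈ Finset.Icc 1 n, u k * Real.sqrt (v k)) fun n _ =>
    Finset.sum_nonneg fun k hk => mul_nonneg (hu k (Finset.mem_Icc.1 hk).1) (Real.sqrt_nonneg _)
  have e : (fun n => (∑ k ∈ Finset.Icc 1 n, u k * Real.sqrt (v k))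
      * ∑ k ∈ Finset.Icc 1 n, u k / Real.sqrt (v k) * v k)
      = fun n => (∑ k ∈ Finset.Icc 1 n, u k * Real.sqrt (v k)) ^ 2 := by
    ext n
    rw [pow_two]
    congr 1
    refine Finset.sum_congr rfl fun k _ => ?_
    rw [div_mul_eq_mul_div, mul_div_assoc, Real.div_sqrt]
  rw [e] at h1
  refine h1.mono (fun n _ => (Finset.measurable_fun_sum _ fun k hk =>
    (hXm k (Finset.mem_Icc.1 hk).1).const_mul _).pow_const 2) fun n _ ω => ?_
  rw [abs_of_nonneg (sq_nonneg _)]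
  refine Finset.sum_sq_le_sum_mul_sum_of_sq_le_mul _
    (fun k hk => mul_nonneg (hu k (Finset.mem_Icc.1 hk).1) (Real.sqrt_nonneg _))
    (fun k hk => mul_nonneg (div_nonneg (hu k (Finset.mem_Icc.1 hk).1) (Real.sqrt_nonneg _))
      (sq_nonneg _)) fun k hk => ?_
  have h0 := Real.sqrt_pos.2 (hv k (Finset.mem_Icc.1 hk).1)
  refine le_of_eq ?_
  field_simp

end Average

section Setting
variable {d δ : ℕ} {Ω : Type*} [m0 : MeasurableSpace Ω]

/-- The basic algorithm, with a regular maximizer, errors as in `NoiseArray` and step sizes as in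
`Rates`, on the assumption that it converges. -/
structure AveragingSetting (Pr : Measure Ω) (a c : ℕ → ℝ)
    (Θ : ℕ → Ω → EuclideanSpace ℝ (Fin d)) (M : ℕ → Ω → ℝ) (Z : ℕ → Label d δ → Ω → ℝ)
    (f : EuclideanSpace ℝ (Fin d) → ℝ) (θ : EuclideanSpace ℝ (Fin d)) (L τ σ p : ℝ) : Prop where
  alg : IsAlgorithm a c Θ M Z
  meas : Measurable f
  max : IsRegularMaximizer f θ L
  noiseArray : NoiseArray Pr (history f c Θ Z) (noise f c Θ Z) σ p
  rates : Rates a c τ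
  conv : ∀ᵐ ω ∂Pr, Tendsto (fun n => Θ n ω) atTop (𝓝 θ)

variable {Pr : Measure Ω} [IsProbabilityMeasure Pr]
  {a c : ℕ → ℝ} {Θ : ℕ → Ω → EuclideanSpace ℝ (Fin d)} {M : ℕ → Ω → ℝ}
  {Z : ℕ → Label d δ → Ω → ℝ} {f : EuclideanSpace ℝ (Fin d) → ℝ} {σ p L τ : ℝ}
  {θ : EuclideanSpace ℝ (Fin d)}

namespace AveragingSetting

lemma bound_sq (h : AveragingSetting Pr a c Θ M Z f θ L τ σ p) :
    LocalMeanBound Pr (fun n ω => ‖Θ n ω - θ‖ ^ 2) (errRate a c) :=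
  localMeanBound_sq h.alg h.meas h.max h.noiseArray h.rates h.conv

lemma measurable_norm (h : AveragingSetting Pr a c Θ M Z f θ L τ σ p) {n : ℕ} (hn : 1 ≤ n) :
    Measurable fun ω => ‖Θ n ω - θ‖ := ((h.alg.measurable_theta hn).sub_const θ).norm

lemma bound (h : AveragingSetting Pr a c Θ M Z f θ L τ σ p) :
    LocalMeanBound Pr (fun n ω => ‖Θ n ω - θ‖) (fun n => Real.sqrt (errRate a c n)) :=
  h.bound_sq.sqrt (fun _ hn => h.measurable_norm hn) fun _ hn => h.rates.errRate_pos hn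

lemma driftSum_inv_nonneg (h : AveragingSetting Pr a c Θ M Z f θ L τ σ p) (n : ℕ) :
    0 ≤ (partialSum (driftRate c) n)⁻¹ :=
  inv_nonneg.2 (partialSum_nonneg (fun _ hk => (h.rates.driftRate_pos hk).le) n)

lemma probZero_inv_driftSum_mul (h : AveragingSetting Pr a c Θ M Z f θ L τ σ p) {X : ℕ → Ω → ℝ}
    {v : ℕ → ℝ} (hX : LocalMeanBound Pr X v) (hX0 : ∀ n, 1 ≤ n → ∀ ω, 0 ≤ X n ω)
    (hv : v =o[atTop] partialSum (driftRate c)) :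
    ProbZero Pr fun n ω => (partialSum (driftRate c) n)⁻¹ * X n ω := by
  refine (hX.const_mul (u := fun n => (partialSum (driftRate c) n)⁻¹)
    fun n _ => h.driftSum_inv_nonneg n).probZero
    (fun n hn ω => mul_nonneg (h.driftSum_inv_nonneg n) (hX0 n hn ω)) ?_
  refine hv.tendsto_div_nhds_zero.congr fun n => ?_
  rw [div_eq_inv_mul]

lemma probZero_last (h : AveragingSetting Pr a c Θ M Z f θ L τ σ p) :
    ProbZero Pr fun n ω =>
      (partialSum (driftRate c) n)⁻¹ * (c n ^ 2 / a n * ‖Θ (n + 1) ω - θ‖) :=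
  h.probZero_inv_driftSum_mul (h.bound.succ.const_mul (u := fun n => c n ^ 2 / a n)
    fun _ hn => (h.rates.gain_pos hn).le)
    (fun _ hn _ => mul_nonneg (h.rates.gain_pos hn).le (norm_nonneg _))
    h.rates.gain_mul_sqrt_succ_isLittleO

lemma drift_weight_nonneg (h : AveragingSetting Pr a c Θ M Z f θ L τ σ p) {n : ℕ} (hn : 1 ≤ n) :
    0 ≤ c n ^ 2 / a n / n := div_nonneg (h.rates.gain_pos hn).le (Nat.cast_nonneg n)

lemma probZero_drift (h : AveragingSetting Pr a c Θ M Z f θ L τ σ p) :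
    ProbZero Pr fun n ω => (partialSum (driftRate c) n)⁻¹
      * ∑ k ∈ Finset.Icc 1 n, c k ^ 2 / a k / k * ‖Θ k ω - θ‖ :=
  h.probZero_inv_driftSum_mul (h.bound.sum (w := fun _ k => c k ^ 2 / a k / k)
    fun _ _ hk => h.drift_weight_nonneg hk)
    (fun _ _ _ => Finset.sum_nonneg fun _ hk =>
      mul_nonneg (h.drift_weight_nonneg (Finset.mem_Icc.1 hk).1) (norm_nonneg _))
    h.rates.driftSum_isLittleO

lemma probZero_quad (h : AveragingSetting Pr a c Θ M Z f θ L τ σ p) :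
    ProbZero Pr fun n ω => (partialSum (driftRate c) n)⁻¹
      * ∑ k ∈ Finset.Icc 1 n, c k ^ 2 * ‖Θ k ω - θ‖ ^ 2 :=
  h.probZero_inv_driftSum_mul (h.bound_sq.sum (w := fun _ k => c k ^ 2)
    fun _ _ _ => sq_nonneg _)
    (fun _ _ _ => Finset.sum_nonneg fun _ _ => mul_nonneg (sq_nonneg _) (sq_nonneg _))
    h.rates.quad_isLittleO

/-- A constant for which the excess of the expansion error is negligible. -/
lemma exists_excess_isLittleO (h : AveragingSetting Pr a c Θ M Z f θ L τ σ p) :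
    ∃ C, 0 ≤ C ∧ ∀ᵐ ω ∂Pr,
      (fun n => c 1 ^ 2 / a 1 * ‖Θ 1 ω - θ‖
        + ∑ k ∈ Finset.Icc 1 n, c k ^ 2 * excess f θ c Θ C k ω)
      =o[atTop] partialSum (driftRate c) := by
  obtain ⟨C, hC, hexp⟩ := h.max.exists_expansion
  refine ⟨C, hC, ?_⟩
  filter_upwards [h.conv] with ω hω
  refine Asymptotics.IsLittleO.add ?_ ?_
  · exact (Asymptotics.isLittleO_const_left.2 (Or.inr
      (tendsto_norm_atTop_atTop.comp h.rates.driftSum_atTop)))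
  · refine isLittleO_partialSum (u := fun k => c k ^ 2 * excess f θ c Θ C k ω) ?_
      (fun n hn => (h.rates.driftRate_pos hn).le) h.rates.driftSum_atTop
    refine Asymptotics.IsLittleO.of_bound fun ε hε => ?_
    obtain ⟨r, hr, hb⟩ := hexp ε hε
    filter_upwards [hω.eventually (Metric.closedBall_mem_nhds θ hr),
      h.rates.c_zero.eventually (ge_mem_nhds hr), eventually_ge_atTop 1] with k hk1 hk2 hk3
    have hc := h.rates.c_pos k hk3
    have h1 := hb (Θ k ω) (by rwa [← dist_eq_norm]) (c k) hc hk2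
    have h2 : excess f θ c Θ C k ω ≤ ε * c k ^ 2 := by
      refine max_le ?_ (by positivity)
      change ‖expansionError f θ c Θ k ω‖ ≤ _ at h1
      linarith
    have h3 : 0 ≤ excess f θ c Θ C k ω := le_max_right _ _
    rw [Real.norm_of_nonneg (by positivity), Real.norm_of_nonneg (h.rates.driftRate_pos hk3).le]
    calc c k ^ 2 * excess f θ c Θ C k ω ≤ c k ^ 2 * (ε * c k ^ 2) := by gcongr
      _ = ε * c k ^ 4 := by ring
      _ ≤ ε * driftRate c k := by
        gcongr
        exact le_add_of_nonneg_left (by positivity)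

lemma exists_gain_diff_le (h : AveragingSetting Pr a c Θ M Z f θ L τ σ p) :
    ∃ K, 0 < K ∧ ∀ n : ℕ, 1 ≤ n →
      |c n ^ 2 / a n - c (n - 1) ^ 2 / a (n - 1)| ≤ K * (c n ^ 2 / a n / n) :=
  exists_forall_le_of_isBigO h.rates.gain_diff fun n hn => by
    have := h.rates.gain_pos hn
    positivity

lemma measurable_excess (h : AveragingSetting Pr a c Θ M Z f θ L τ σ p) (C : ℝ) {n : ℕ}
    (hn : 1 ≤ n) : Measurable (excess f θ c Θ C n) := by
  have hΘ := h.alg.measurable_theta hn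
  have hf := h.meas
  have h1 : Measurable fun ω => diffQuotient f (c n) (Θ n ω) := by
    refine Measurable.const_smul ?_ (1 / (2 * c n))
    exact measurable_toLp_of_coord fun i => (hf.comp (hΘ.add_const _)).sub
      (hf.comp (hΘ.sub_const _))
  have h2 : Measurable fun ω => hessianCLM f θ (Θ n ω - θ) :=
    (hessianCLM f θ).measurable.comp (hΘ.sub_const θ)
  have h3 : Measurable (expansionError f θ c Θ n) := (h1.sub h2).sub_const _
  exact (h3.norm.sub (((h.measurable_norm hn).pow_const 2).const_mul C)).max measurable_const

lemma measurable_drift (h : AveragingSetting Pr a c Θ M Z f θ L τ σ p) (C : ℝ) (n : ℕ) :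
    Measurable fun ω => c 1 ^ 2 / a 1 * ‖Θ 1 ω - θ‖
        + ∑ k ∈ Finset.Icc 1 n, c k ^ 2 * excess f θ c Θ C k ω :=
  ((h.measurable_norm le_rfl).const_mul _).add (Finset.measurable_fun_sum _ fun _ hk =>
    (h.measurable_excess C (Finset.mem_Icc.1 hk).1).const_mul _)

/-- The remainder is negligible. -/
lemma probZero_remainder (h : AveragingSetting Pr a c Θ M Z f θ L τ σ p) :
    ProbZero Pr fun n ω => (partialSum (driftRate c) n)⁻¹ * ‖remainder f θ a c Θ n ω‖ := by
  obtain ⟨C, hC, hexc⟩ := h.exists_excess_isLittleO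
  obtain ⟨K, hK, hgain⟩ := h.exists_gain_diff_le
  have hpath : ProbZero Pr fun n ω => (partialSum (driftRate c) n)⁻¹ * (c 1 ^ 2 / a 1 * ‖Θ 1 ω - θ‖
        + ∑ k ∈ Finset.Icc 1 n, c k ^ 2 * excess f θ c Θ C k ω) := by
    refine ProbZero.of_tendsto_ae
      (fun n => ((h.measurable_drift C n).const_mul _).aestronglyMeasurable) ?_
    filter_upwards [hexc] with ω hω
    exact hω.tendsto_div_nhds_zero.congr fun n => div_eq_inv_mul _ _
  have hsum := ((h.probZero_last.add (h.probZero_drift.const_mul K)).add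
    (h.probZero_quad.const_mul C)).add hpath
  refine hsum.of_abs_le ?_
  filter_upwards [eventually_ge_atTop 1] with n hn ω
  have h1 := norm_remainder_le (f := f) (θ := θ) (Θ := Θ) (C := C) h.rates hgain hn ω
  have h2 := mul_le_mul_of_nonneg_left h1 (h.driftSum_inv_nonneg n)
  rw [abs_of_nonneg (mul_nonneg (h.driftSum_inv_nonneg n) (norm_nonneg _))]
  refine h2.trans (le_trans (le_of_eq ?_) (le_abs_self _))
  ring

end AveragingSetting
end Setting

end

/-! ### Mean squares of the averaged iterates and the bias of the value estimates. -/

section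

section Setting
variable {d δ : ℕ} {Ω : Type*} [m0 : MeasurableSpace Ω]
  {Pr : Measure Ω} [IsProbabilityMeasure Pr]
  {a c : ℕ → ℝ} {Θ : ℕ → Ω → EuclideanSpace ℝ (Fin d)} {M : ℕ → Ω → ℝ}
  {Z : ℕ → Label d δ → Ω → ℝ} {f : EuclideanSpace ℝ (Fin d) → ℝ} {σ p L τ : ℝ}
  {θ : EuclideanSpace ℝ (Fin d)}

/-- The sum of the squares of `y k / weightSum c k`, normalized by `√n`. -/
def meanSq (c : ℕ → ℝ) (y : ℕ → Ω → ℝ) (n : ℕ) (ω : Ω) : ℝ :=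
  (n : ℝ) ^ (-(1 / 2) : ℝ) * ∑ k ∈ Finset.Icc 1 n, (weightSum c k)⁻¹ ^ 2 * y k ω ^ 2

namespace AveragingSetting

lemma probZero_meanSq (_h : AveragingSetting Pr a c Θ M Z f θ L τ σ p) {y : ℕ → Ω → ℝ}
    {v : ℕ → ℝ} (hy : LocalMeanBound Pr (fun n ω => y n ω ^ 2) v)
    (hv : (fun n => (weightSum c n)⁻¹ ^ 2 * v n) =o[atTop] fun n : ℕ => (n : ℝ) ^ (-(1 / 2) : ℝ)) :
    ProbZero Pr (meanSq c y) :=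
  (hy.const_mul (u := fun n => (weightSum c n)⁻¹ ^ 2) fun _ _ => sq_nonneg _).probZero_average
    (fun _ _ _ => mul_nonneg (sq_nonneg _) (sq_nonneg _)) hv

lemma sq_isLittleO (h : AveragingSetting Pr a c Θ M Z f θ L τ σ p) {x : ℕ → ℝ}
    (hx : x =O[atTop] partialSum (driftRate c)) :
    (fun n => (weightSum c n)⁻¹ ^ 2 * x n ^ 2) =o[atTop] fun n : ℕ => (n : ℝ) ^ (-(1 / 2) : ℝ) :=
  (h.rates.sq_div_isLittleO hx).congr_left fun n => by rw [div_eq_inv_mul, mul_pow]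

lemma probZero_meanSq_last (h : AveragingSetting Pr a c Θ M Z f θ L τ σ p) :
    ProbZero Pr (meanSq c fun n ω => c n ^ 2 / a n * ‖Θ (n + 1) ω - θ‖) := by
  have h1 := h.bound_sq.succ.const_mul (u := fun n => (c n ^ 2 / a n) ^ 2) fun _ _ => sq_nonneg _
  simp only [← mul_pow] at h1
  refine h.probZero_meanSq h1 ?_
  refine (h.sq_isLittleO h.rates.gain_mul_sqrt_succ_isLittleO.isBigO).congr' ?_ EventuallyEq.rfl
  filter_upwards with n
  rw [mul_pow _ (Real.sqrt _), Real.sq_sqrt (h.rates.errRate_pos (by omega)).le]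

lemma probZero_meanSq_drift (h : AveragingSetting Pr a c Θ M Z f θ L τ σ p) :
    ProbZero Pr (meanSq c fun n ω =>
      ∑ k ∈ Finset.Icc 1 n, c k ^ 2 / a k / k * ‖Θ k ω - θ‖) :=
  h.probZero_meanSq (h.bound_sq.sq_sum (fun _ hn => h.measurable_norm hn)
    (fun _ hn => h.rates.errRate_pos hn) fun _ hn => h.drift_weight_nonneg hn)
    (h.sq_isLittleO h.rates.driftSum_isLittleO.isBigO)

lemma localMeanBound_noiseSum (h : AveragingSetting Pr a c Θ M Z f θ L τ σ p) :
    LocalMeanBound Pr (fun n ω => ‖noiseSum (noise f c Θ Z) c n ω‖ ^ 2) (weightSum c) := by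
  intro η hη
  refine ⟨Set.univ, d * σ ^ 2 / 2, MeasurableSet.univ, by simpa using hη.le, by positivity,
    fun n _ => ?_⟩
  rw [Measure.restrict_univ, h.noiseArray.integral_norm_sq_noiseSum]
  exact ⟨((h.noiseArray.memLp_noiseSum c n).integrable_norm_pow (by norm_num)).integrableOn, le_rfl⟩

lemma probZero_meanSq_noiseSum (h : AveragingSetting Pr a c Θ M Z f θ L τ σ p) :
    ProbZero Pr (meanSq c fun n ω => ‖noiseSum (noise f c Θ Z) c n ω‖) := by
  refine h.probZero_meanSq h.localMeanBound_noiseSum (h.rates.inv_weightSum.congr' ?_ EventuallyEq.rfl)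
  filter_upwards [eventually_ge_atTop 1] with n hn
  have := (h.rates.weightSum_pos hn).ne'
  field_simp

/-- Taking second moments here would require fourth moments of `θ_k - θ`. Minkowski's inequality
pathwise reduces the square root of the expression to a sum that is linear in `‖θ_k - θ‖²`, for
which first moments and `Rates.smoothing` suffice. -/
lemma probZero_meanSq_quad (h : AveragingSetting Pr a c Θ M Z f θ L τ σ p) :
    ProbZero Pr (meanSq c fun n ω => ∑ k ∈ Finset.Icc 1 n, c k ^ 2 * ‖Θ k ω - θ‖ ^ 2) := by
  set w : ℕ → ℕ → ℝ := fun n j => (n : ℝ) ^ (-(1 / 4) : ℝ)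
    * (c j ^ 2 * Real.sqrt (∑ k ∈ Finset.Icc j n, (weightSum c k ^ 2)⁻¹)) with hw
  have hw0 : ∀ n j, 0 ≤ w n j := fun n j => by positivity
  have h1 := (h.bound_sq.sum (w := w) fun n j _ => hw0 n j).probZero
    (fun n _ ω => Finset.sum_nonneg fun k _ => mul_nonneg (hw0 n k) (sq_nonneg _))
    (h.rates.smoothing.congr fun n => by
      rw [Finset.mul_sum]
      exact Finset.sum_congr rfl fun j _ => by rw [hw]; ring)
  have h2 : ProbZero Pr fun n ω => (∑ k ∈ Finset.Icc 1 n, w n k * ‖Θ k ω - θ‖ ^ 2) ^ 2 := by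
    refine h1.of_pathwise (fun n => ?_) (Eventually.of_forall fun ω φ _ hY => by
      simpa using hY.pow 2)
    exact ((Finset.measurable_fun_sum _ fun k hk => ((h.measurable_norm
      (Finset.mem_Icc.1 hk).1).pow_const 2).const_mul _).pow_const 2).aestronglyMeasurable
  refine h2.of_abs_le (Eventually.of_forall fun n ω => ?_)
  have h3 := sqrt_sum_sq_le (fun j => c j ^ 2 * ‖Θ j ω - θ‖ ^ 2) (fun k => (weightSum c k)⁻¹)
    (fun j => by positivity) n
  have h4 : ∑ k ∈ Finset.Icc 1 n, w n k * ‖Θ k ω - θ‖ ^ 2 = (n : ℝ) ^ (-(1 / 4) : ℝ)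
      * ∑ j ∈ Finset.Icc 1 n, c j ^ 2 * ‖Θ j ω - θ‖ ^ 2
        * Real.sqrt (∑ k ∈ Finset.Icc j n, (weightSum c k)⁻¹ ^ 2) := by
    rw [Finset.mul_sum]
    refine Finset.sum_congr rfl fun j _ => ?_
    simp only [hw, inv_pow]
    ring
  have h5 : ((n : ℝ) ^ (-(1 / 4) : ℝ)) ^ 2 = (n : ℝ) ^ (-(1 / 2) : ℝ) := by
    rw [← Real.rpow_natCast, ← Real.rpow_mul (Nat.cast_nonneg n)]
    norm_num
  set q := ∑ k ∈ Finset.Icc 1 n,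
    ((∑ j ∈ Finset.Icc 1 k, c j ^ 2 * ‖Θ j ω - θ‖ ^ 2) * (weightSum c k)⁻¹) ^ 2 with hq
  have hq0 : 0 ≤ q := Finset.sum_nonneg fun _ _ => sq_nonneg _
  have h6 : meanSq c (fun n ω => ∑ k ∈ Finset.Icc 1 n, c k ^ 2 * ‖Θ k ω - θ‖ ^ 2) n ω
      = (n : ℝ) ^ (-(1 / 2) : ℝ) * q := by
    rw [meanSq, hq]
    congr 1
    exact Finset.sum_congr rfl fun k _ => by rw [mul_pow, mul_comm]
  rw [h6, h4, abs_of_nonneg (by positivity), abs_of_nonneg (sq_nonneg _), mul_pow, h5]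
  refine mul_le_mul_of_nonneg_left ?_ (by positivity)
  calc q = Real.sqrt q ^ 2 := (Real.sq_sqrt hq0).symm
    _ ≤ _ := pow_le_pow_left₀ (Real.sqrt_nonneg _) h3 2

lemma probZero_meanSq_of_isBigO (h : AveragingSetting Pr a c Θ M Z f θ L τ σ p) {y : ℕ → Ω → ℝ}
    (hm : ∀ n, Measurable (y n))
    (hy : ∀ᵐ ω ∂Pr, (fun n => y n ω) =O[atTop] partialSum (driftRate c)) :
    ProbZero Pr (meanSq c y) := by
  refine ProbZero.of_tendsto_ae (fun n => ?_) ?_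
  · exact ((Finset.measurable_fun_sum _ fun k _ =>
      ((hm k).pow_const 2).const_mul _).const_mul _).aestronglyMeasurable
  · filter_upwards [hy] with ω hω
    exact tendsto_rpow_mul_partialSum (h.sq_isLittleO hω)

lemma exists_norm_le_hessianCLM (h : IsRegularMaximizer f θ L) :
    ∃ l, 0 < l ∧ ∀ x, l * ‖x‖ ≤ ‖hessianCLM f θ x‖ := by
  obtain ⟨l, hl, hb⟩ := h.exists_coercive
  refine ⟨l, hl, fun x => ?_⟩
  rcases (norm_nonneg x).eq_or_lt with hx | hx
  · rw [← hx, mul_zero]; exact norm_nonneg _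
  have h1 := hb x
  have h2 := abs_le.1 (abs_real_inner_le_norm x (hessianCLM f θ x))
  have h3 : l * ‖x‖ * ‖x‖ ≤ ‖hessianCLM f θ x‖ * ‖x‖ := by nlinarith [h2.1]
  exact le_of_mul_le_mul_right h3 hx

/-- The averaged iterates are close to `θ` in mean square, at the rate `o(n^(-1/2))`. -/
lemma probZero_average_sq (h : AveragingSetting Pr a c Θ M Z f θ L τ σ p) :
    ProbZero Pr fun n ω =>
      (n : ℝ) ^ (-(1 / 2) : ℝ) * ∑ k ∈ Finset.Icc 1 n, ‖average c Θ k ω - θ‖ ^ 2 := by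
  obtain ⟨l, hl, hH⟩ := exists_norm_le_hessianCLM h.max
  obtain ⟨C, hC, hexc⟩ := h.exists_excess_isLittleO
  obtain ⟨K, hK, hgain⟩ := h.exists_gain_diff_le
  set B := ‖biasVec f θ‖ with hB
  set y₁ : ℕ → Ω → ℝ := fun n ω => c n ^ 2 / a n * ‖Θ (n + 1) ω - θ‖ with hy₁
  set y₂ : ℕ → Ω → ℝ := fun n ω => ∑ k ∈ Finset.Icc 1 n, c k ^ 2 / a k / k * ‖Θ k ω - θ‖ with hy₂
  set y₃ : ℕ → Ω → ℝ := fun n ω => ‖noiseSum (noise f c Θ Z) c n ω‖ with hy₃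
  set y₄ : ℕ → Ω → ℝ := fun n ω => ∑ k ∈ Finset.Icc 1 n, c k ^ 2 * ‖Θ k ω - θ‖ ^ 2 with hy₄
  -- The part bounded for almost every `ω`, together with the deterministic bias, is only `O` of the
  -- partial sums of `driftRate`; this is enough after division by `S_k` and squaring.
  set y₅ : ℕ → Ω → ℝ := fun n ω => (c 1 ^ 2 / a 1 * ‖Θ 1 ω - θ‖
    + ∑ k ∈ Finset.Icc 1 n, c k ^ 2 * excess f θ c Θ C k ω)
    + partialSum (fun k => c k ^ 4) n * B with hy₅
  have p₅ : ProbZero Pr (meanSq c y₅) := by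
    refine h.probZero_meanSq_of_isBigO (fun n => (h.measurable_drift C n).add_const _) ?_
    filter_upwards [hexc] with ω hω
    refine hω.isBigO.add ?_
    simpa [mul_comm] using h.rates.sum_c_four_isBigO.const_mul_left B
  have hsum := (((((h.probZero_meanSq_last).add (h.probZero_meanSq_drift.const_mul (K ^ 2))).add
    h.probZero_meanSq_noiseSum).add (h.probZero_meanSq_quad.const_mul (C ^ 2))).add p₅).const_mul
      (5 * l⁻¹ ^ 2)
  refine hsum.of_abs_le (Eventually.of_forall fun n ω => ?_)
  have hk : ∀ k ∈ Finset.Icc 1 n, ‖average c Θ k ω - θ‖ ^ 2 ≤ 5 * l⁻¹ ^ 2 *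
      ((weightSum c k)⁻¹ ^ 2 * y₁ k ω ^ 2 + K ^ 2 * ((weightSum c k)⁻¹ ^ 2 * y₂ k ω ^ 2)
        + (weightSum c k)⁻¹ ^ 2 * y₃ k ω ^ 2 + C ^ 2 * ((weightSum c k)⁻¹ ^ 2 * y₄ k ω ^ 2)
        + (weightSum c k)⁻¹ ^ 2 * y₅ k ω ^ 2) := by
    intro k hk
    have hk1 := (Finset.mem_Icc.1 hk).1
    have hS := h.rates.weightSum_pos hk1
    have e := hessianCLM_weightSum_smul (f := f) (θ := θ) h.alg h.rates hk1 ω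
    have h1 := hH (weightSum c k • (average c Θ k ω - θ))
    have h2 := norm_remainder_le (f := f) (θ := θ) (Θ := Θ) (C := C) h.rates hgain hk1 ω
    have h3 : ‖partialSum (fun k => c k ^ 4) k • biasVec f θ‖
        = partialSum (fun k => c k ^ 4) k * B := by
      rw [norm_smul, Real.norm_of_nonneg (partialSum_nonneg (fun _ _ => by positivity) _)]
    rw [e, norm_smul, Real.norm_of_nonneg hS.le] at h1
    have h4 : ‖remainder f θ a c Θ k ω - noiseSum (noise f c Θ Z) c k ω
        - partialSum (fun k => c k ^ 4) k • biasVec f θ‖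
        ≤ y₁ k ω + K * y₂ k ω + y₃ k ω + C * y₄ k ω + y₅ k ω := by
      refine (norm_sub_le _ _).trans ?_
      rw [h3]
      have h5 := norm_sub_le (remainder f θ a c Θ k ω) (noiseSum (noise f c Θ Z) c k ω)
      simp only [hy₁, hy₂, hy₃, hy₄, hy₅]
      linarith
    have h6 : ‖average c Θ k ω - θ‖ ≤ l⁻¹ * ((weightSum c k)⁻¹
        * (y₁ k ω + K * y₂ k ω + y₃ k ω + C * y₄ k ω + y₅ k ω)) := by
      rw [← mul_assoc, ← mul_inv, inv_mul_eq_div, le_div_iff₀ (by positivity)]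
      linarith
    have h7 := pow_le_pow_left₀ (norm_nonneg _) h6 2
    refine h7.trans ?_
    have h8 : (y₁ k ω + K * y₂ k ω + y₃ k ω + C * y₄ k ω + y₅ k ω) ^ 2
        ≤ 5 * (y₁ k ω ^ 2 + K ^ 2 * y₂ k ω ^ 2 + y₃ k ω ^ 2 + C ^ 2 * y₄ k ω ^ 2 + y₅ k ω ^ 2) := by
      generalize y₁ k ω = x₁
      generalize y₃ k ω = x₃
      generalize y₅ k ω = x₅
      rw [← mul_pow K, ← mul_pow C]
      generalize K * y₂ k ω = x₂
      generalize C * y₄ k ω = x₄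
      linarith [sq_nonneg (x₁ - x₂), sq_nonneg (x₁ - x₃), sq_nonneg (x₁ - x₄), sq_nonneg (x₁ - x₅),
        sq_nonneg (x₂ - x₃), sq_nonneg (x₂ - x₄), sq_nonneg (x₂ - x₅), sq_nonneg (x₃ - x₄),
        sq_nonneg (x₃ - x₅), sq_nonneg (x₄ - x₅)]
    rw [mul_pow, mul_pow]
    calc l⁻¹ ^ 2 * ((weightSum c k)⁻¹ ^ 2
          * (y₁ k ω + K * y₂ k ω + y₃ k ω + C * y₄ k ω + y₅ k ω) ^ 2)
        ≤ l⁻¹ ^ 2 * ((weightSum c k)⁻¹ ^ 2 * (5 * (y₁ k ω ^ 2 + K ^ 2 * y₂ k ω ^ 2 + y₃ k ω ^ 2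
          + C ^ 2 * y₄ k ω ^ 2 + y₅ k ω ^ 2))) := by gcongr
      _ = _ := by ring
  rw [abs_of_nonneg (mul_nonneg (by positivity) (Finset.sum_nonneg fun _ _ => sq_nonneg _))]
  refine (mul_le_mul_of_nonneg_left (Finset.sum_le_sum hk) (by positivity)).trans
    (le_trans (le_of_eq ?_) (le_abs_self _))
  simp only [meanSq, Finset.mul_sum, ← Finset.sum_add_distrib]
  refine Finset.sum_congr rfl fun k _ => ?_
  ring

/-- Weighted Cesàro means of a convergent sequence, with weights of divergent sum. -/
lemma tendsto_average (h : AveragingSetting Pr a c Θ M Z f θ L τ σ p) :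
    ∀ᵐ ω ∂Pr, Tendsto (fun n => average c Θ n ω) atTop (𝓝 θ) := by
  filter_upwards [h.conv] with ω hω
  have h1 : (fun k => c k ^ 2 * ‖Θ k ω - θ‖) =o[atTop] fun k => c k ^ 2 := by
    have h0 : Tendsto (fun k => ‖Θ k ω - θ‖) atTop (𝓝 0) := by
      simpa using (hω.sub_const θ).norm
    exact (isLittleO_mul_of_tendsto_zero h0).congr_left fun k => mul_comm _ _
  have h2 := (isLittleO_partialSum h1 (fun n _ => sq_nonneg _)
    h.rates.weightSum_atTop).tendsto_div_nhds_zero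
  rw [tendsto_iff_norm_sub_tendsto_zero]
  refine squeeze_zero' (Eventually.of_forall fun _ => norm_nonneg _) ?_ h2
  filter_upwards [eventually_ge_atTop 1] with n hn
  have hS := h.rates.weightSum_pos hn
  change _ ≤ _ / weightSum c n
  rw [le_div_iff₀ hS]
  have e := congrArg norm (weightSum_smul_average_sub (Θ := Θ) (θ := θ) h.rates hn ω)
  rw [norm_smul, Real.norm_of_nonneg hS.le] at e
  rw [mul_comm, e]
  refine (norm_sum_le _ _).trans_eq (Finset.sum_congr rfl fun k _ => ?_)
  rw [norm_smul, Real.norm_of_nonneg (sq_nonneg _)]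

lemma measurable_average (h : AveragingSetting Pr a c Θ M Z f θ L τ σ p) (n : ℕ) :
    Measurable (average c Θ n) :=
  KWB.measurable_average c fun _ hk _ => h.alg.measurable_theta hk

/-- The bias of the estimates of the size of the maximum is negligible. -/
lemma probZero_value_bias (h : AveragingSetting Pr a c Θ M Z f θ L τ σ p) :
    ProbZero Pr fun n ω =>
      (n : ℝ) ^ (-(1 / 2) : ℝ) * ∑ k ∈ Finset.Icc 1 n, |f (average c Θ k ω) - f θ| := by
  obtain ⟨C, r, hC, hr, hb⟩ := h.max.exists_quadratic_bound
  refine h.probZero_average_sq.of_pathwise (fun n => ?_) ?_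
  · exact ((Finset.measurable_fun_sum _ fun k _ =>
      ((h.meas.comp (h.measurable_average k)).sub_const _).norm).const_mul _).aestronglyMeasurable
  filter_upwards [h.tendsto_average] with ω hω φ hφ hY
  -- The quadratic bound holds from an index on that depends on `ω`. The finitely many earlier terms
  -- vanish after normalization, and `ProbZero.of_pathwise` allows this argument for a fixed `ω`
  -- along subsequences.
  obtain ⟨N, hN⟩ := eventually_atTop.1 (hω.eventually (Metric.closedBall_mem_nhds θ hr))
  set A := ∑ k ∈ Finset.Icc 1 N, |f (average c Θ k ω) - f θ| with hA
  have hle : ∀ n, ∑ k ∈ Finset.Icc 1 n, |f (average c Θ k ω) - f θ|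
      ≤ A + C * ∑ k ∈ Finset.Icc 1 n, ‖average c Θ k ω - θ‖ ^ 2 := by
    intro n
    rw [← Finset.sum_filter_add_sum_filter_not (Finset.Icc 1 n) (· ≤ N), Finset.mul_sum]
    refine add_le_add ?_ ?_
    · refine Finset.sum_le_sum_of_subset_of_nonneg (fun k hk => ?_) fun _ _ _ => abs_nonneg _
      simp only [Finset.mem_filter, Finset.mem_Icc] at hk ⊢
      omega
    · refine (Finset.sum_le_sum fun k hk => ?_).trans
        (Finset.sum_le_sum_of_subset_of_nonneg (Finset.filter_subset _ _)
          fun k _ _ => by positivity)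
      have hk' := (Finset.mem_filter.1 hk).2
      refine hb _ ?_
      have := hN k (by omega)
      rwa [← dist_eq_norm]
  have h0 : Tendsto (fun n : ℕ => (n : ℝ) ^ (-(1 / 2) : ℝ) * A) atTop (𝓝 0) := by
    have := ((tendsto_rpow_neg_atTop (show (0 : ℝ) < 1 / 2 by norm_num)).comp
      tendsto_natCast_atTop_atTop).mul_const A
    simpa using this
  have hlim := (h0.comp hφ).add (hY.const_mul C)
  simp only [mul_zero, add_zero] at hlim
  refine squeeze_zero (fun n => mul_nonneg (by positivity)
    (Finset.sum_nonneg fun _ _ => abs_nonneg _)) (fun n => ?_) hlim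
  refine (mul_le_mul_of_nonneg_left (hle (φ n)) (by positivity)).trans (le_of_eq ?_)
  simp only [Function.comp_apply]
  ring

end AveragingSetting
end Setting

end

/-! ### Ingredients of the joint limit: Lévy's theorem, the inverse Hessian and the value recursion.
-/

section

section CharFun
variable {d : ℕ} {Ω : Type*} [m0 : MeasurableSpace Ω] {Pr : Measure Ω} [IsProbabilityMeasure Pr]

/-- Lévy's continuity theorem for pairs, the limit being a product measure. -/
lemma tendstoInDistribution_prod_of_charFun {X : ℕ → Ω → EuclideanSpace ℝ (Fin d)}
    {Y : ℕ → Ω → ℝ} (hX : ∀ n, Measurable (X n)) (hY : ∀ n, Measurable (Y n))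
    (μ : Measure (EuclideanSpace ℝ (Fin d))) [IsProbabilityMeasure μ]
    (ν : Measure ℝ) [IsProbabilityMeasure ν]
    (h : ∀ s t, Tendsto (fun n => ∫ ω, Complex.exp ((inner ℝ (X n ω) s + Y n ω * t : ℝ) * Complex.I)
      ∂Pr) atTop (𝓝 (charFun μ s * charFun ν t))) :
    TendstoInDistribution (fun n ω => (X n ω, Y n ω)) atTop id (fun _ => Pr) (μ.prod ν) := by
  -- Characteristic functions are taken on an inner product space, so the pair is first placed in
  -- the `ℓ²` product and the convergence is carried back by continuity.
  have hm : ∀ n, Measurable fun ω => (WithLp.toLp 2 (X n ω, Y n ω) :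
      WithLp 2 (EuclideanSpace ℝ (Fin d) × ℝ)) := fun n =>
    (WithLp.measurable_toLp 2 _).comp ((hX n).prodMk (hY n))
  have h1 : TendstoInDistribution (fun n ω => (WithLp.toLp 2 (X n ω, Y n ω) :
      WithLp 2 (EuclideanSpace ℝ (Fin d) × ℝ))) atTop (WithLp.toLp 2) (fun _ => Pr)
      (μ.prod ν) := by
    refine ⟨fun n => (hm n).aemeasurable, (WithLp.measurable_toLp 2 _).aemeasurable, ?_⟩
    refine ProbabilityMeasure.tendsto_iff_tendsto_charFun.2 fun t => ?_
    have h2 := h (WithLp.ofLp t).1 (WithLp.ofLp t).2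
    rw [← charFun_prod] at h2
    refine h2.congr fun n => ?_
    change _ = charFun (Pr.map _) t
    rw [charFun_apply, integral_map (hm n).aemeasurable (by fun_prop)]
    refine integral_congr_ae (Eventually.of_forall fun ω => ?_)
    simp [WithLp.prod_inner_apply, mul_comm]
  exact h1.continuous_comp (g := WithLp.ofLp) (WithLp.prod_continuous_ofLp 2 _ _)

end CharFun

section Hessian
variable {d : ℕ} {f : EuclideanSpace ℝ (Fin d) → ℝ} {θ : EuclideanSpace ℝ (Fin d)} {L : ℝ}

/-- The linear map given by the inverse of the Hessian matrix. -/
def invHessianCLM (f : EuclideanSpace ℝ (Fin d) → ℝ) (x : EuclideanSpace ℝ (Fin d)) :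
    EuclideanSpace ℝ (Fin d) →L[ℝ] EuclideanSpace ℝ (Fin d) :=
  Matrix.toEuclideanCLM (𝕜 := ℝ) (hessian f x)⁻¹

namespace IsRegularMaximizer

lemma invHessianCLM_hessianCLM (h : IsRegularMaximizer f θ L) (x : EuclideanSpace ℝ (Fin d)) :
    invHessianCLM f θ (hessianCLM f θ x) = x := by
  have hu : IsUnit (hessian f θ).det := by
    have := h.negDef.isUnit
    rw [IsUnit.neg_iff] at this
    exact (Matrix.isUnit_iff_isUnit_det _).1 this
  rw [invHessianCLM, hessianCLM, ← mul_apply_eq_comp, ← map_mul,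
    Matrix.nonsing_inv_mul _ hu, map_one, one_apply_eq_self]

lemma isHermitian_inv (h : IsRegularMaximizer f θ L) : ((hessian f θ)⁻¹).IsHermitian := by
  have h1 : (hessian f θ).IsHermitian := by
    have := h.negDef.isHermitian.neg
    rwa [neg_neg] at this
  exact h1.inv

lemma inner_invHessianCLM (h : IsRegularMaximizer f θ L) (x y : EuclideanSpace ℝ (Fin d)) :
    inner ℝ (invHessianCLM f θ x) y = inner ℝ x (invHessianCLM f θ y) := by
  rw [real_inner_comm, invHessianCLM, Matrix.inner_toEuclideanCLM, Matrix.inner_toEuclideanCLM]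
  have h1 : Matrix.transpose (hessian f θ)⁻¹ = (hessian f θ)⁻¹ := by
    have := h.isHermitian_inv
    rwa [Matrix.IsHermitian, Matrix.conjTranspose_eq_transpose_of_trivial] at this
  rw [Matrix.dotProduct_mulVec, ← Matrix.mulVec_transpose, h1, dotProduct_comm]

end IsRegularMaximizer
end Hessian

section Value
variable {d δ : ℕ} {Ω : Type*}

/-- The weights that express the error of `valueEstimate`. -/
def valueWeight : Label d δ → ℝ
  | Sum.inl _ => 0
  | Sum.inr (Sum.inl _) => 0
  | Sum.inr (Sum.inr _) => 1 / δ

lemma abs_valueWeight_le (j : Label d δ) : |valueWeight j| ≤ 1 := by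
  rcases j with i | i | k
  · simp [valueWeight]
  · simp [valueWeight]
  · have : (1 : ℝ) ≤ δ := by
      have := k.pos
      exact_mod_cast this
    rw [valueWeight, abs_of_nonneg (by positivity)]
    exact div_le_one_of_le₀ this (by positivity)

lemma valueEstimate_eq (hδ : 1 ≤ δ) (f : EuclideanSpace ℝ (Fin d) → ℝ) (c : ℕ → ℝ)
    (Θ : ℕ → Ω → EuclideanSpace ℝ (Fin d)) (Z : ℕ → Label d δ → Ω → ℝ) (n : ℕ) (ω : Ω) :
    valueEstimate Z n ω
      = f (average c Θ n ω) + NoiseArray.comb (noise f c Θ Z) n valueWeight ω := by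
  have : (δ : ℝ) ≠ 0 := by
    have : 0 < δ := hδ
    positivity
  simp only [valueEstimate, NoiseArray.comb, Fintype.sum_sum_type, valueWeight, zero_mul,
    Finset.sum_const_zero, zero_add, noise, queryPoint, ← Finset.mul_sum, Finset.sum_sub_distrib,
    Finset.sum_const, Finset.card_univ, Fintype.card_fin, nsmul_eq_mul]
  field_simp
  ring

/-- The two weights live on disjoint sets of labels, so no cross term appears. This is the source of
the asymptotic independence. -/
lemma sum_sq_weight (hδ : 1 ≤ δ) (v : EuclideanSpace ℝ (Fin d)) (x y : ℝ) :
    ∑ j : Label d δ, (x * gradWeight v j + y * valueWeight j) ^ 2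
      = x ^ 2 * (‖v‖ ^ 2 / 2) + y ^ 2 / δ := by
  have hδ0 : (δ : ℝ) ≠ 0 := by
    have : 0 < δ := hδ
    positivity
  have h1 := sum_gradWeight_mul (δ := δ) v v
  rw [real_inner_self_eq_norm_sq] at h1
  rw [← h1, Finset.mul_sum]
  simp only [Fintype.sum_sum_type, gradWeight, valueWeight]
  simp only [mul_zero, add_zero, zero_add, Finset.sum_const_zero, Finset.sum_const,
    Finset.card_univ, Fintype.card_fin, nsmul_eq_mul]
  have e1 : (δ : ℝ) * (y * (1 / δ)) ^ 2 = y ^ 2 / δ := by field_simp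
  rw [e1, add_assoc]
  simp only [← pow_two, mul_pow]

variable [MeasurableSpace Ω] {a c : ℕ → ℝ} {Θ : ℕ → Ω → EuclideanSpace ℝ (Fin d)}
  {M : ℕ → Ω → ℝ} {Z : ℕ → Label d δ → Ω → ℝ}

/-- The starting value is forgotten at once, because the factor `1 - 1/n` vanishes for `n = 1`. -/
lemma IsAlgorithm.mul_eq_sum (h : IsAlgorithm a c Θ M Z) {n : ℕ} (hn : 1 ≤ n) (ω : Ω) :
    (n : ℝ) * M (n + 1) ω = ∑ k ∈ Finset.Icc 1 n, valueEstimate Z k ω := by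
  induction n, hn using Nat.le_induction with
  | base => simp [h.step' 1 le_rfl ω]
  | succ n hn ih =>
    rw [Finset.sum_Icc_succ_top (by omega), ← ih, h.step' (n + 1) (by omega) ω]
    have : ((n : ℝ) + 1) ≠ 0 := by positivity
    push_cast
    field_simp
    ring

lemma IsAlgorithm.measurable_value (h : IsAlgorithm a c Θ M Z) {n : ℕ} (hn : 1 ≤ n) :
    Measurable (M n) := by
  induction n, hn using Nat.le_induction with
  | base => exact h.measurable_init'
  | succ n hn ih =>
    rw [funext (h.step' n hn)]
    refine (ih.const_mul _).add (Measurable.const_mul ?_ _)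
    exact (Finset.measurable_fun_sum _ fun k _ => h.measurable_obs n _).const_mul _

end Value

/-- The factor `√n / (n - 1)` of the sums of the errors in the estimate of the maximum. -/
def valueScale (n : ℕ) : ℝ := Real.sqrt n / ((n : ℝ) - 1)

lemma valueScale_nonneg (n : ℕ) : 0 ≤ valueScale n := by
  rcases Nat.eq_zero_or_pos n with rfl | hn
  · simp [valueScale]
  · have : (1 : ℝ) ≤ n := by exact_mod_cast hn
    exact div_nonneg (Real.sqrt_nonneg _) (by linarith)

lemma valueScale_le {n : ℕ} (hn : 2 ≤ n) : valueScale n ≤ 2 * (n : ℝ) ^ (-(1 / 2) : ℝ) := by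
  have h2 : (2 : ℝ) ≤ n := by exact_mod_cast hn
  have hs : 0 < Real.sqrt n := Real.sqrt_pos.2 (by linarith)
  rw [valueScale, rpow_neg_half_eq, div_le_iff₀ (by linarith)]
  have := Real.mul_self_sqrt (show (0 : ℝ) ≤ n by linarith)
  have e : 2 * (Real.sqrt n)⁻¹ * ((n : ℝ) - 1) = (2 * n - 2) / Real.sqrt n := by field_simp
  rw [e, le_div_iff₀ hs]
  linarith

lemma tendsto_valueScale : Tendsto valueScale atTop (𝓝 0) := by
  have h1 : Tendsto (fun n : ℕ => 2 * (n : ℝ) ^ (-(1 / 2) : ℝ)) atTop (𝓝 0) := by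
    have := ((tendsto_rpow_neg_atTop (show (0 : ℝ) < 1 / 2 by norm_num)).comp
      tendsto_natCast_atTop_atTop).const_mul 2
    simpa using this
  refine squeeze_zero' (Eventually.of_forall valueScale_nonneg) ?_ h1
  filter_upwards [eventually_ge_atTop 2] with n hn using valueScale_le hn

lemma tendsto_mul_valueScale_sq :
    Tendsto (fun n : ℕ => ((n : ℝ) - 1) * valueScale n ^ 2) atTop (𝓝 1) := by
  have h1 : Tendsto (fun n : ℕ => 1 + ((n : ℝ) - 1)⁻¹) atTop (𝓝 (1 + 0)) :=
    ((tendsto_atTop_add_const_right _ (-1 : ℝ)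
      tendsto_natCast_atTop_atTop).inv_tendsto_atTop).const_add 1
  rw [add_zero] at h1
  refine h1.congr' ?_
  filter_upwards [eventually_ge_atTop 2] with n hn
  have h2 : (2 : ℝ) ≤ n := by exact_mod_cast hn
  have h3 : (n : ℝ) - 1 ≠ 0 := by linarith
  rw [valueScale, div_pow, Real.sq_sqrt (by linarith)]
  field_simp
  ring

end

/-! ### The joint limit theorem for a general normalization. -/

section

variable {d δ : ℕ} {Ω : Type*} [m0 : MeasurableSpace Ω]
  {Pr : Measure Ω} [IsProbabilityMeasure Pr]
  {a c : ℕ → ℝ} {Θ : ℕ → Ω → EuclideanSpace ℝ (Fin d)} {M : ℕ → Ω → ℝ}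
  {Z : ℕ → Label d δ → Ω → ℝ} {f : EuclideanSpace ℝ (Fin d) → ℝ} {σ p L τ : ℝ}
  {θ : EuclideanSpace ℝ (Fin d)}

/-- The normalized sum of the errors of `valueEstimate` at the steps before `n`. -/
def valueNoise (ξ : ℕ → Label d δ → Ω → ℝ) (n : ℕ) (ω : Ω) : ℝ :=
  ∑ k ∈ Finset.Icc 1 n, (if k < n then valueScale n else 0) * NoiseArray.comb ξ k valueWeight ω

lemma NoiseArray.measurable_valueNoise {G : ℕ → MeasurableSpace Ω} {ξ : ℕ → Label d δ → Ω → ℝ}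
    (h : NoiseArray Pr G ξ σ p) (n : ℕ) : Measurable (valueNoise ξ n) :=
  Finset.measurable_fun_sum _ fun _ hk =>
    ((h.measurable_comb (Finset.mem_Icc.1 hk).1 _).mono (h.le _) le_rfl).const_mul _

/-- The joint central limit theorem for the sums of the errors. -/
lemma NoiseArray.tendsto_integral_cexp_joint {G : ℕ → MeasurableSpace Ω}
    {ξ : ℕ → Label d δ → Ω → ℝ} (h : NoiseArray Pr G ξ σ p) (hR : Rates a c τ) (hδ : 1 ≤ δ)
    {κ : ℕ → ℝ} {V : ℝ} (hV : Tendsto (fun n => κ n ^ 2 / weightSum c n) atTop (𝓝 V))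
    (s : EuclideanSpace ℝ (Fin d)) (t : ℝ) :
    Tendsto (fun n => ∫ ω, Complex.exp (((κ n / weightSum c n) * inner ℝ s (noiseSum ξ c n ω)
      + valueNoise ξ n ω * t : ℝ) * Complex.I) ∂Pr) atTop
      (𝓝 (Complex.exp (-(σ ^ 2 * (V * (‖s‖ ^ 2 / 2) + t ^ 2 / δ) / 2 : ℝ)))) := by
  set q : ℕ → ℝ := fun n => κ n / weightSum c n with hq
  -- The value estimate at time `n` contains only the errors of the steps before `n`, hence the case
  -- distinction; both sums can then run over `1, …, n`.
  set w : ℕ → ℕ → Label d δ → ℝ := fun n k j =>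
    (q n * c k) * gradWeight s j + ((if k < n then valueScale n else 0) * t) * valueWeight j with hw
  -- The square of `q n` is the convergent sequence `κ n ^ 2 / weightSum c n` divided once more by
  -- `weightSum c n`.
  have hq0 : Tendsto q atTop (𝓝 0) := by
    have h1 : Tendsto (fun n => q n ^ 2) atTop (𝓝 0) := by
      have := hV.mul hR.weightSum_atTop.inv_tendsto_atTop
      rw [mul_zero] at this
      refine this.congr fun n => ?_
      simp only [hq, Pi.inv_apply, div_pow]
      ring
    have h2 := (Real.continuous_sqrt.tendsto 0).comp h1
    rw [Real.sqrt_zero] at h2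
    refine tendsto_zero_iff_abs_tendsto_zero _ |>.2 (h2.congr fun n => ?_)
    simp [Real.sqrt_sq_eq_abs]
  obtain ⟨C, hC⟩ := hR.c_zero.norm.bddAbove_range
  have hC' : ∀ k, |c k| ≤ C := fun k => hC ⟨k, rfl⟩
  set b : ℕ → ℝ := fun n => |q n| * C * ‖s‖ + valueScale n * |t| with hb
  have hC0 : 0 ≤ C := (abs_nonneg _).trans (hC' 0)
  have hb0 : ∀ n, 0 ≤ b n := fun n => by
    have := valueScale_nonneg n
    positivity
  have hbz : Tendsto b atTop (𝓝 0) := by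
    have h1 := ((hq0.abs.mul_const C).mul_const ‖s‖).add (tendsto_valueScale.mul_const |t|)
    simpa using h1
  have hwb : ∀ n k, 1 ≤ k → k ≤ n → ∀ j, |w n k j| ≤ b n := by
    intro n k _ _ j
    refine (abs_add_le _ _).trans (add_le_add ?_ ?_)
    · rw [abs_mul, abs_mul]
      exact mul_le_mul (mul_le_mul_of_nonneg_left (hC' k) (abs_nonneg _)) (abs_gradWeight_le s j)
        (abs_nonneg _) (by positivity)
    · have hv := valueScale_nonneg n
      rw [abs_mul, abs_mul]
      have h1 : |if k < n then valueScale n else 0| ≤ valueScale n := by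
        split_ifs
        · rw [abs_of_nonneg hv]
        · simpa using hv
      calc |if k < n then valueScale n else 0| * |t| * |valueWeight j|
          ≤ valueScale n * |t| * 1 := by
            gcongr
            exact abs_valueWeight_le j
        _ = _ := mul_one _
  have hvar : Tendsto (fun n => ∑ k ∈ Finset.Icc 1 n, ∑ j, w n k j ^ 2) atTop
      (𝓝 (V * (‖s‖ ^ 2 / 2) + t ^ 2 / δ)) := by
    have h1 := (hV.mul_const (‖s‖ ^ 2 / 2)).add (tendsto_mul_valueScale_sq.mul_const (t ^ 2 / δ))
    rw [one_mul] at h1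
    refine h1.congr' ?_
    filter_upwards [eventually_ge_atTop 1] with n hn
    have hS := (hR.weightSum_pos hn).ne'
    have e1 : ∀ k, ∑ j, w n k j ^ 2 = q n ^ 2 * (‖s‖ ^ 2 / 2) * c k ^ 2
        + (if k < n then valueScale n ^ 2 * (t ^ 2 / δ) else 0) := fun k => by
      rw [sum_sq_weight hδ]
      split_ifs <;> ring
    simp_rw [e1]
    rw [Finset.sum_add_distrib, ← Finset.mul_sum, ← Finset.sum_filter]
    have e2 : ((Finset.Icc 1 n).filter (· < n)) = Finset.Icc 1 (n - 1) := by
      ext k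
      simp only [Finset.mem_filter, Finset.mem_Icc]
      omega
    rw [e2, Finset.sum_const, Nat.card_Icc, nsmul_eq_mul, Nat.add_sub_cancel, Nat.cast_sub hn,
      Nat.cast_one]
    change _ = q n ^ 2 * (‖s‖ ^ 2 / 2) * weightSum c n + _
    simp only [hq]
    field_simp
  refine (h.tendsto_integral_cexp_sum hb0 hwb hbz hvar).congr fun n => ?_
  refine integral_congr_ae (Eventually.of_forall fun ω => ?_)
  have e : ∑ k ∈ Finset.Icc 1 n, comb ξ k (w n k) ω
      = q n * inner ℝ s (noiseSum ξ c n ω) + valueNoise ξ n ω * t := by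
    rw [noiseSum, inner_sum, valueNoise, Finset.mul_sum, Finset.sum_mul, ← Finset.sum_add_distrib]
    refine Finset.sum_congr rfl fun k _ => ?_
    rw [real_inner_smul_right, inner_gradNoise]
    simp only [comb, Finset.mul_sum, Finset.sum_mul, ← Finset.sum_add_distrib, hw]
    refine Finset.sum_congr rfl fun j _ => ?_
    ring
  simp only [e, hq]

namespace AveragingSetting

/-- The identity for `H S_n (θ̄_n - θ)` is inverted and multiplied by `κ_n / S_n`; the remainder is
measured in units of the partial sums of `driftRate`, and the bias coefficient against its limit
`B`. -/
lemma norm_scaled_error_le (h : AveragingSetting Pr a c Θ M Z f θ L τ σ p) (κ : ℕ → ℝ) (B : ℝ)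
    {n : ℕ} (hn : 1 ≤ n) (ω : Ω) :
    ‖κ n • (average c Θ n ω - θ)
      - (-(κ n / weightSum c n) • invHessianCLM f θ (noiseSum (noise f c Θ Z) c n ω)
        + -B • invHessianCLM f θ (biasVec f θ))‖
      ≤ ‖invHessianCLM f θ‖ * |κ n * partialSum (driftRate c) n / weightSum c n|
          * ((partialSum (driftRate c) n)⁻¹ * ‖remainder f θ a c Θ n ω‖)
        + |κ n * partialSum (fun k => c k ^ 4) n / weightSum c n - B|
          * ‖invHessianCLM f θ (biasVec f θ)‖ := by
  have hS := h.rates.weightSum_pos hn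
  have hG := h.rates.driftSum_pos hn
  have e1 : average c Θ n ω - θ = (weightSum c n)⁻¹ • (invHessianCLM f θ
      (remainder f θ a c Θ n ω) - invHessianCLM f θ (noiseSum (noise f c Θ Z) c n ω)
        - partialSum (fun k => c k ^ 4) n • invHessianCLM f θ (biasVec f θ)) := by
    rw [← map_smul, ← map_sub, ← map_sub,
      ← hessianCLM_weightSum_smul (f := f) (θ := θ) h.alg h.rates hn ω,
      h.max.invHessianCLM_hessianCLM, smul_smul, inv_mul_cancel₀ hS.ne', one_smul]
  have e2 : κ n • (average c Θ n ω - θ)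
      - (-(κ n / weightSum c n) • invHessianCLM f θ (noiseSum (noise f c Θ Z) c n ω)
        + -B • invHessianCLM f θ (biasVec f θ))
      = (κ n / weightSum c n) • invHessianCLM f θ (remainder f θ a c Θ n ω)
        - (κ n * partialSum (fun k => c k ^ 4) n / weightSum c n - B)
          • invHessianCLM f θ (biasVec f θ) := by
    rw [e1]
    module
  rw [e2]
  refine (norm_sub_le _ _).trans (add_le_add ?_ ?_)
  · rw [norm_smul, Real.norm_eq_abs]
    have e3 : |κ n * partialSum (driftRate c) n / weightSum c n|
        = |κ n / weightSum c n| * partialSum (driftRate c) n := by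
      rw [mul_div_right_comm, abs_mul, abs_of_pos hG]
    rw [e3]
    calc |κ n / weightSum c n| * ‖invHessianCLM f θ (remainder f θ a c Θ n ω)‖
        ≤ |κ n / weightSum c n| * (‖invHessianCLM f θ‖ * ‖remainder f θ a c Θ n ω‖) := by
          gcongr
          exact (invHessianCLM f θ).le_opNorm _
      _ = _ := by
        field_simp
  · rw [norm_smul, Real.norm_eq_abs]

lemma probZero_scaled_error (h : AveragingSetting Pr a c Θ M Z f θ L τ σ p) {κ : ℕ → ℝ} {B : ℝ}
    (hB : Tendsto (fun n => κ n * partialSum (fun k => c k ^ 4) n / weightSum c n) atTop (𝓝 B))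
    (hG : (fun n => κ n * partialSum (driftRate c) n / weightSum c n)
      =O[atTop] fun _ => (1 : ℝ)) :
    ProbZero Pr fun n ω => ‖κ n • (average c Θ n ω - θ)
      - (-(κ n / weightSum c n) • invHessianCLM f θ (noiseSum (noise f c Θ Z) c n ω)
        + -B • invHessianCLM f θ (biasVec f θ))‖ := by
  obtain ⟨C, hC⟩ := hG.bound
  have h1 : ProbZero Pr fun n _ => |κ n * partialSum (fun k => c k ^ 4) n / weightSum c n - B|
      * ‖invHessianCLM f θ (biasVec f θ)‖ := by
    refine ProbZero.of_tendsto_ae (fun n => aestronglyMeasurable_const)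
      (Eventually.of_forall fun ω => ?_)
    have := ((hB.sub_const B).abs).mul_const ‖invHessianCLM f θ (biasVec f θ)‖
    simpa using this
  have h2 := (h.probZero_remainder.const_mul (‖invHessianCLM f θ‖ * C)).add h1
  refine h2.of_abs_le ?_
  filter_upwards [hC, eventually_ge_atTop 1] with n hn hn1 ω
  rw [abs_of_nonneg (norm_nonneg _)]
  refine (h.norm_scaled_error_le κ B hn1 ω).trans (le_trans ?_ (le_abs_self _))
  refine add_le_add ?_ le_rfl
  refine mul_le_mul_of_nonneg_right ?_ (mul_nonneg (h.driftSum_inv_nonneg n) (norm_nonneg _))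
  refine mul_le_mul_of_nonneg_left ?_ (norm_nonneg _)
  rwa [norm_one, mul_one, Real.norm_eq_abs] at hn

/-- After the noise is removed, `√n/(n - 1)` times the sum of `f(θ̄_k) - f(θ)` over `k < n` is left,
and the scale is at most `2 n^{-1/2}`. -/
lemma probZero_value_error (h : AveragingSetting Pr a c Θ M Z f θ L τ σ p) (hδ : 1 ≤ δ) :
    ProbZero Pr fun n ω =>
      |Real.sqrt n * (M n ω - f θ) - valueNoise (noise f c Θ Z) n ω| := by
  refine (h.probZero_value_bias.const_mul 2).of_abs_le ?_
  filter_upwards [eventually_ge_atTop 2] with n hn ω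
  obtain ⟨m, rfl⟩ : ∃ m, n = m + 1 := ⟨n - 1, by omega⟩
  have hm : 1 ≤ m := by omega
  have hm0 : (0 : ℝ) < m := by positivity
  have e1 := h.alg.mul_eq_sum hm ω
  simp_rw [valueEstimate_eq hδ f c Θ Z] at e1
  rw [Finset.sum_add_distrib] at e1
  have e2 : valueNoise (noise f c Θ Z) (m + 1) ω = valueScale (m + 1)
      * ∑ k ∈ Finset.Icc 1 m, NoiseArray.comb (noise f c Θ Z) k valueWeight ω := by
    rw [valueNoise, Finset.sum_Icc_succ_top (by omega), if_neg (lt_irrefl _), zero_mul, add_zero,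
      Finset.mul_sum]
    refine Finset.sum_congr rfl fun k hk => ?_
    rw [if_pos (by have := Finset.mem_Icc.1 hk; omega)]
  have e3 : valueScale (m + 1) = Real.sqrt ((m + 1 : ℕ) : ℝ) / m := by
    rw [valueScale]; push_cast; ring_nf
  have e4 : Real.sqrt ((m + 1 : ℕ) : ℝ) * (M (m + 1) ω - f θ) - valueNoise (noise f c Θ Z) (m + 1) ω
      = valueScale (m + 1) * ∑ k ∈ Finset.Icc 1 m, (f (average c Θ k ω) - f θ) := by
    rw [e2, Finset.sum_sub_distrib, Finset.sum_const, Nat.card_Icc, nsmul_eq_mul,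
      Nat.add_sub_cancel, e3]
    have : M (m + 1) ω = (∑ k ∈ Finset.Icc 1 m, f (average c Θ k ω)
        + ∑ k ∈ Finset.Icc 1 m, NoiseArray.comb (noise f c Θ Z) k valueWeight ω) / m := by
      rw [eq_div_iff hm0.ne', mul_comm, e1]
    rw [this]
    field_simp
    ring
  rw [abs_abs, e4, abs_mul, abs_of_nonneg (valueScale_nonneg _)]
  refine le_trans ?_ (le_abs_self _)
  rw [← mul_assoc]
  refine mul_le_mul (valueScale_le hn) ?_ (abs_nonneg _) (by positivity)
  refine (Finset.abs_sum_le_sum_abs _ _).trans ?_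
  exact Finset.sum_le_sum_of_subset_of_nonneg (Finset.Icc_subset_Icc_right (by omega))
    fun _ _ _ => abs_nonneg _

lemma measurable_linear (h : AveragingSetting Pr a c Θ M Z f θ L τ σ p) (r : ℝ)
    (b : EuclideanSpace ℝ (Fin d)) (n : ℕ) :
    Measurable fun ω => r • invHessianCLM f θ (noiseSum (noise f c Θ Z) c n ω) + b := by
  have h1 : Measurable (noiseSum (noise f c Θ Z) c n) :=
    (h.noiseArray.measurable_noiseSum c n).mono (h.noiseArray.le _) le_rfl
  have h2 : Measurable fun ω => invHessianCLM f θ (noiseSum (noise f c Θ Z) c n ω) :=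
    (invHessianCLM f θ).measurable.comp h1
  exact (h2.const_smul r).add_const b

lemma tendstoInDistribution_linear (h : AveragingSetting Pr a c Θ M Z f θ L τ σ p) (hδ : 1 ≤ δ)
    {κ : ℕ → ℝ} {V : ℝ} (hV : Tendsto (fun n => κ n ^ 2 / weightSum c n) atTop (𝓝 V))
    (b : EuclideanSpace ℝ (Fin d))
    (μ : Measure (EuclideanSpace ℝ (Fin d))) [IsProbabilityMeasure μ]
    (hμ : ∀ s, charFun μ s = Complex.exp ((inner ℝ s b : ℝ) * Complex.I
        - (σ ^ 2 * V / 2 * ‖invHessianCLM f θ s‖ ^ 2 : ℝ) / 2)) :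
    TendstoInDistribution (fun (n : ℕ) ω =>
        (-(κ n / weightSum c n) • invHessianCLM f θ (noiseSum (noise f c Θ Z) c n ω) + b,
          valueNoise (noise f c Θ Z) n ω))
      atTop id (fun _ => Pr) (μ.prod (gaussianReal 0 (σ ^ 2 / δ).toNNReal)) := by
  refine tendstoInDistribution_prod_of_charFun (fun n => h.measurable_linear _ b n)
    h.noiseArray.measurable_valueNoise μ
    (gaussianReal 0 (σ ^ 2 / δ).toNNReal) fun s t => ?_
  -- The inverse Hessian is symmetric and can be moved, with the sign, onto the test vector `s`.
  have h1 := h.noiseArray.tendsto_integral_cexp_joint h.rates hδ hV (-invHessianCLM f θ s) t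
  have h2 := h1.const_mul (Complex.exp ((inner ℝ s b : ℝ) * Complex.I))
  have e : Complex.exp ((inner ℝ s b : ℝ) * Complex.I)
      * Complex.exp (-(σ ^ 2 * (V * (‖-invHessianCLM f θ s‖ ^ 2 / 2) + t ^ 2 / δ) / 2 : ℝ))
      = charFun μ s * charFun (gaussianReal 0 (σ ^ 2 / δ).toNNReal) t := by
    rw [hμ, charFun_gaussianReal, ← Complex.exp_add, ← Complex.exp_add, norm_neg,
      Real.coe_toNNReal _ (by positivity)]
    congr 1
    push_cast
    ring
  rw [e] at h2
  refine h2.congr fun n => ?_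
  rw [← integral_const_mul]
  refine integral_congr_ae (Eventually.of_forall fun ω => ?_)
  have e1 : inner ℝ (-(κ n / weightSum c n) • invHessianCLM f θ
        (noiseSum (noise f c Θ Z) c n ω) + b) s
      = inner ℝ s b + (κ n / weightSum c n)
        * inner ℝ (-invHessianCLM f θ s) (noiseSum (noise f c Θ Z) c n ω) := by
    rw [real_inner_comm, inner_add_right, real_inner_smul_right, inner_neg_left,
      h.max.inner_invHessianCLM]
    ring
  simp only [e1]
  rw [← Complex.exp_add, ← add_mul, ← Complex.ofReal_add, add_assoc]

end AveragingSetting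

/-- Slutsky's lemma for pairs; the norm of the product is a maximum, hence at most the sum of the
two errors. -/
lemma tendstoInDistribution_prodMk_of_probZero {E Ω' : Type*} [NormedAddCommGroup E]
    [MeasurableSpace E] [BorelSpace E] [SecondCountableTopology E] [MeasurableSpace Ω']
    {μ : Measure Ω'} [IsProbabilityMeasure μ] {X X' : ℕ → Ω → E} {Y Y' : ℕ → Ω → ℝ}
    {W : Ω' → E × ℝ}
    (h : TendstoInDistribution (fun n ω => (X n ω, Y n ω)) atTop W (fun _ => Pr) μ)
    (hX : ProbZero Pr fun n ω => ‖X' n ω - X n ω‖) (hY : ProbZero Pr fun n ω => |Y' n ω - Y n ω|)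
    (hXm : ∀ n, Measurable (X' n)) (hYm : ∀ n, Measurable (Y' n)) :
    TendstoInDistribution (fun n ω => (X' n ω, Y' n ω)) atTop W (fun _ => Pr) μ := by
  refine tendstoInDistribution_of_tendstoInMeasure_sub _ W h ?_ fun n =>
    ((hXm n).prodMk (hYm n)).aemeasurable
  have h1 := hX.add hY
  rw [tendstoInMeasure_iff_norm]
  intro ε hε
  have h2 := tendstoInMeasure_iff_norm.1 h1 ε hε
  refine tendsto_of_tendsto_of_tendsto_of_le_of_le tendsto_const_nhds h2 (fun _ => zero_le)
    fun n => measure_mono fun ω hω => ?_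
  simp only [Set.mem_ofPred_eq, Pi.sub_apply, Pi.zero_apply, sub_zero, Prod.mk_sub_mk,
    Prod.norm_mk, Real.norm_eq_abs] at hω ⊢
  refine hω.trans (le_trans ?_ (le_abs_self _))
  exact max_le (le_add_of_nonneg_right (abs_nonneg _)) (le_add_of_nonneg_left (norm_nonneg _))

namespace AveragingSetting

/-- The joint limit of the averaged iterates and the estimates of the maximum, for a general
normalization of the averaged iterates. -/
theorem tendstoInDistribution (h : AveragingSetting Pr a c Θ M Z f θ L τ σ p) (hδ : 1 ≤ δ)
    {κ : ℕ → ℝ} {V B : ℝ} (hV : Tendsto (fun n => κ n ^ 2 / weightSum c n) atTop (𝓝 V))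
    (hB : Tendsto (fun n => κ n * partialSum (fun k => c k ^ 4) n / weightSum c n) atTop (𝓝 B))
    (hG : (fun n => κ n * partialSum (driftRate c) n / weightSum c n)
      =O[atTop] fun _ => (1 : ℝ))
    (μ : Measure (EuclideanSpace ℝ (Fin d))) [IsProbabilityMeasure μ]
    (hμ : ∀ s, charFun μ s = Complex.exp
      ((inner ℝ s (-B • invHessianCLM f θ (biasVec f θ)) : ℝ) * Complex.I
        - (σ ^ 2 * V / 2 * ‖invHessianCLM f θ s‖ ^ 2 : ℝ) / 2)) :
    TendstoInDistribution (fun (n : ℕ) ω =>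
        (κ n • (average c Θ n ω - θ), Real.sqrt n * (M n ω - f θ)))
      atTop id (fun _ => Pr) (μ.prod (gaussianReal 0 (σ ^ 2 / δ).toNNReal)) := by
  have hm : ∀ n, Measurable fun ω => average c Θ n ω - θ := fun n =>
    (h.measurable_average n).sub_const θ
  have hm' : ∀ n, Measurable fun ω => κ n • (average c Θ n ω - θ) := fun n =>
    (hm n).const_smul (κ n)
  refine tendstoInDistribution_prodMk_of_probZero (h.tendstoInDistribution_linear hδ hV _ μ hμ)
    (h.probZero_scaled_error hB hG) (h.probZero_value_error hδ)
    hm' fun n => ?_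
  rcases Nat.eq_zero_or_pos n with rfl | hn
  · simp
  · exact ((h.alg.measurable_value hn).sub_const _).const_mul _

end AveragingSetting

end

/-! ### The normalizations in the three regimes and the Gaussian limits. -/

section

section Rates
variable {a c : ℕ → ℝ} {τ : ℝ}

namespace Rates

lemma tendsto_sum_four (h : Rates a c τ) (hτ : τ < 1 / 4) :
    Tendsto (fun n : ℕ => partialSum (fun k => c k ^ 4) n / (n * c n ^ 4)) atTop
      (𝓝 (1 / (1 - 4 * τ))) := by
  have h1 := (h.c_mem.pow 4).tendsto_mul_div_partialSum (by push_cast; linarith)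
  have h2 := h1.inv₀ (by push_cast; linarith)
  rw [show (((4 : ℕ) : ℝ) * -τ + 1)⁻¹ = 1 / (1 - 4 * τ) by push_cast; rw [one_div]; ring_nf] at h2
  exact h2.congr fun n => inv_div _ _

lemma gs_mul_pow_six (h : Rates a c τ) : GS (1 - 6 * τ) fun n : ℕ => (n : ℝ) * c n ^ 6 := by
  have := GS.nat.mul (h.c_mem.pow 6)
  rwa [show 1 + ((6 : ℕ) : ℝ) * -τ = 1 - 6 * τ by push_cast; ring] at this

lemma tau_le_of_tendsto_atTop (h : Rates a c τ)
    (hc : Tendsto (fun n : ℕ => (n : ℝ) * c n ^ 6) atTop atTop) : τ ≤ 1 / 6 := by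
  by_contra! hlt
  exact not_tendsto_nhds_of_tendsto_atTop hc _ (h.gs_mul_pow_six.tendsto_zero (by linarith))

/-- A sequence of index `1 - 6τ` tends to infinity or to `0` unless the index is `0`. -/
lemma tau_eq_of_tendsto (h : Rates a c τ) {γ : ℝ} (hγ : 0 < γ)
    (hc : Tendsto (fun n : ℕ => (n : ℝ) * c n ^ 6) atTop (𝓝 γ)) : τ = 1 / 6 := by
  rcases lt_trichotomy τ (1 / 6) with hlt | heq | hgt
  · exact absurd hc (not_tendsto_nhds_of_tendsto_atTop
      (h.gs_mul_pow_six.tendsto_atTop (by linarith)) _)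
  · exact heq
  · exact absurd (tendsto_nhds_unique hc (h.gs_mul_pow_six.tendsto_zero (by linarith))) hγ.ne'

lemma sqrt_mul_sq (h : Rates a c τ) {n : ℕ} (hn : 1 ≤ n) :
    Real.sqrt (n * c n ^ 2) = Real.sqrt n * c n := by
  rw [Real.sqrt_mul (Nat.cast_nonneg n), Real.sqrt_sq (h.c_pos n hn).le]

lemma sqrt_mul_pow_six (h : Rates a c τ) {n : ℕ} (hn : 1 ≤ n) :
    Real.sqrt (n * c n ^ 6) = Real.sqrt n * c n ^ 3 := by
  have := h.c_pos n hn
  rw [Real.sqrt_mul (Nat.cast_nonneg n), show c n ^ 6 = (c n ^ 3) ^ 2 by ring,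
    Real.sqrt_sq (by positivity)]

/-- This identity decides which of the two terms of `driftRate` dominates: their ratio is `√(n
c_n⁶)`. -/
lemma pow_four_eq (h : Rates a c τ) {n : ℕ} (hn : 1 ≤ n) :
    c n ^ 4 = Real.sqrt (n * c n ^ 6) * (c n * (n : ℝ) ^ (-(1 / 2) : ℝ)) := by
  have hn0 : (0 : ℝ) < n := by positivity
  rw [h.sqrt_mul_pow_six hn, rpow_neg_half_eq]
  have := (Real.sqrt_pos.2 hn0).ne'
  field_simp

lemma gs_mul_rpow (h : Rates a c τ) :
    GS (-τ + -(1 / 2)) fun n : ℕ => c n * (n : ℝ) ^ (-(1 / 2) : ℝ) :=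
  h.c_mem.mul (GS.rpow_nat _)

lemma isBigO_sqrt_mul (h : Rates a c τ) :
    partialSum (fun n => c n * (n : ℝ) ^ (-(1 / 2) : ℝ))
      =O[atTop] fun n : ℕ => Real.sqrt (n * c n ^ 2) := by
  have hτ := h.tau_le
  have h1 := (h.gs_mul_rpow.tendsto_mul_div_partialSum (by linarith)).inv₀ (by linarith)
  have h2 := (h1.isBigO_one ℝ).mul
    (Asymptotics.isBigO_refl (fun n : ℕ => (n : ℝ) * (c n * (n : ℝ) ^ (-(1 / 2) : ℝ))) atTop)
  refine h2.congr' ?_ ?_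
  · filter_upwards [eventually_ge_atTop 1] with n hn
    have := (h.gs_mul_rpow.pos hn).ne'
    have hn0 : (n : ℝ) ≠ 0 := by positivity
    rw [inv_div, div_mul_cancel₀ _ (mul_ne_zero hn0 this)]
  · filter_upwards [eventually_ge_atTop 1] with n hn
    have hn0 : (0 : ℝ) < n := by positivity
    have h3 := Real.sqrt_pos.2 hn0
    rw [h.sqrt_mul_sq hn, rpow_neg_half_eq, one_mul]
    nth_rewrite 1 [← Real.mul_self_sqrt hn0.le]
    field_simp

lemma tendsto_sq_sqrt_div (h : Rates a c τ) :
    Tendsto (fun n : ℕ => Real.sqrt (n * c n ^ 2) ^ 2 / weightSum c n) atTop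
      (𝓝 (1 - 2 * τ)) :=
  h.weightSum_equiv.congr fun n => by rw [Real.sq_sqrt (by positivity)]

lemma sqrt_mul_driftSum_isBigO (h : Rates a c τ)
    (hc : (fun n : ℕ => (n : ℝ) * c n ^ 6) =O[atTop] fun _ => (1 : ℝ)) :
    (fun n : ℕ => Real.sqrt (n * c n ^ 2) * partialSum (driftRate c) n / weightSum c n)
      =O[atTop] fun _ => (1 : ℝ) := by
  obtain ⟨C, hC⟩ := hc.bound
  have h1 : (fun n => c n ^ 4) =O[atTop] fun n : ℕ => c n * (n : ℝ) ^ (-(1 / 2) : ℝ) := by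
    refine Asymptotics.IsBigO.of_bound (Real.sqrt C) ?_
    filter_upwards [hC, eventually_ge_atTop 1] with n hn hn1
    rw [h.pow_four_eq hn1, norm_mul, Real.norm_eq_abs, abs_of_nonneg (Real.sqrt_nonneg _)]
    refine mul_le_mul_of_nonneg_right (Real.sqrt_le_sqrt ?_) (norm_nonneg _)
    rw [norm_one, mul_one] at hn
    exact (le_abs_self _).trans hn
  have h2 : driftRate c =O[atTop] fun n : ℕ => c n * (n : ℝ) ^ (-(1 / 2) : ℝ) :=
    (Asymptotics.isBigO_refl _ _).add h1
  have h3 := (partialSum_isBigO h2 fun n hn => h.gs_mul_rpow.pos hn).trans h.isBigO_sqrt_mul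
  have h4 := ((Asymptotics.isBigO_refl (fun n : ℕ => Real.sqrt (n * c n ^ 2)
    * (weightSum c n)⁻¹) atTop).mul h3).trans
      ((h.tendsto_sq_sqrt_div.congr fun n => by ring).isBigO_one ℝ)
  exact h4.congr_left fun n => by ring

/-- Here `τ` may equal `1/4`, where Karamata's theorem fails for `c_k⁴`; the sum is compared with
that of `c_k k^{-1/2}` instead. -/
lemma tendsto_sqrt_mul_sum_four_zero (h : Rates a c τ)
    (hc : Tendsto (fun n : ℕ => (n : ℝ) * c n ^ 6) atTop (𝓝 0)) :
    Tendsto (fun n : ℕ => Real.sqrt (n * c n ^ 2) * partialSum (fun k => c k ^ 4) n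
      / weightSum c n) atTop (𝓝 0) := by
  have hτ := h.tau_le
  have h0 : Tendsto (fun n : ℕ => Real.sqrt (n * c n ^ 6)) atTop (𝓝 0) := by
    have := (Real.continuous_sqrt.tendsto 0).comp hc
    rwa [Real.sqrt_zero] at this
  have h1 : (fun n => c n ^ 4) =o[atTop] fun n : ℕ => c n * (n : ℝ) ^ (-(1 / 2) : ℝ) := by
    have := ((Asymptotics.isLittleO_one_iff ℝ).2 h0).mul_isBigO
      (Asymptotics.isBigO_refl (fun n : ℕ => c n * (n : ℝ) ^ (-(1 / 2) : ℝ)) atTop)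
    refine this.congr' ?_ (by simp)
    filter_upwards [eventually_ge_atTop 1] with n hn using (h.pow_four_eq hn).symm
  have h3 := (isLittleO_partialSum h1 (fun n hn => (h.gs_mul_rpow.pos hn).le)
    (h.gs_mul_rpow.tendsto_partialSum_atTop (by linarith))).trans_isBigO h.isBigO_sqrt_mul
  have h4 := ((Asymptotics.isBigO_refl (fun n : ℕ => Real.sqrt (n * c n ^ 2)
    * (weightSum c n)⁻¹) atTop).mul_isLittleO h3).trans_isBigO
      ((h.tendsto_sq_sqrt_div.congr fun n => by ring).isBigO_one ℝ)
  exact ((Asymptotics.isLittleO_one_iff ℝ).1 h4).congr fun n => by ring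

lemma tendsto_sqrt_mul_sum_four (h : Rates a c τ) {γ : ℝ} (hγ : 0 < γ)
    (hc : Tendsto (fun n : ℕ => (n : ℝ) * c n ^ 6) atTop (𝓝 γ)) :
    Tendsto (fun n : ℕ => Real.sqrt (n * c n ^ 2) * partialSum (fun k => c k ^ 4) n
      / weightSum c n) atTop (𝓝 (2 * Real.sqrt γ)) := by
  have hτ := h.tau_eq_of_tendsto hγ hc
  have h1 := (((Real.continuous_sqrt.tendsto γ).comp hc).mul
    (h.tendsto_sum_four (by rw [hτ]; norm_num))).mul h.weightSum_equiv
  have e : Real.sqrt γ * (1 / (1 - 4 * τ)) * (1 - 2 * τ) = 2 * Real.sqrt γ := by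
    rw [hτ]; ring
  rw [e] at h1
  refine h1.congr' ?_
  filter_upwards [eventually_ge_atTop 1] with n hn
  have := h.c_pos n hn
  have hn0 : (0 : ℝ) < n := by positivity
  simp only [Function.comp]
  rw [h.sqrt_mul_pow_six hn, h.sqrt_mul_sq hn]
  field_simp

lemma tendsto_inv_sq_mul_sum_four (h : Rates a c τ) (hτ : τ ≤ 1 / 6) :
    Tendsto (fun n : ℕ => (c n ^ 2)⁻¹ * partialSum (fun k => c k ^ 4) n / weightSum c n) atTop
      (𝓝 ((1 - 2 * τ) / (1 - 4 * τ))) := by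
  have h1 := (h.tendsto_sum_four (by linarith)).mul h.weightSum_equiv
  rw [one_div_mul_eq_div] at h1
  refine h1.congr' ?_
  filter_upwards [eventually_ge_atTop 1] with n hn
  have := h.c_pos n hn
  have hn0 : (0 : ℝ) < n := by positivity
  field_simp

lemma tendsto_inv_sq_sq_div (h : Rates a c τ)
    (hc : Tendsto (fun n : ℕ => (n : ℝ) * c n ^ 6) atTop atTop) :
    Tendsto (fun n : ℕ => (c n ^ 2)⁻¹ ^ 2 / weightSum c n) atTop (𝓝 0) := by
  have h1 := h.weightSum_equiv.mul hc.inv_tendsto_atTop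
  rw [mul_zero] at h1
  refine h1.congr' ?_
  filter_upwards [eventually_ge_atTop 1] with n hn
  have := h.c_pos n hn
  have hn0 : (0 : ℝ) < n := by positivity
  simp only [Pi.inv_apply]
  field_simp

lemma inv_sq_mul_driftSum_isBigO (h : Rates a c τ)
    (hc : Tendsto (fun n : ℕ => (n : ℝ) * c n ^ 6) atTop atTop) :
    (fun n : ℕ => (c n ^ 2)⁻¹ * partialSum (driftRate c) n / weightSum c n)
      =O[atTop] fun _ => (1 : ℝ) := by
  have h1 : (fun n : ℕ => c n * (n : ℝ) ^ (-(1 / 2) : ℝ)) =O[atTop] fun n => c n ^ 4 := by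
    refine Asymptotics.IsBigO.of_bound 1 ?_
    filter_upwards [hc.eventually_ge_atTop 1, eventually_ge_atTop 1] with n hn hn1
    rw [h.pow_four_eq hn1, norm_mul (Real.sqrt _), Real.norm_eq_abs (Real.sqrt _),
      abs_of_nonneg (Real.sqrt_nonneg _), one_mul]
    exact le_mul_of_one_le_left (norm_nonneg _) (Real.one_le_sqrt.2 hn)
  have h2 : driftRate c =O[atTop] fun n => c n ^ 4 := h1.add (Asymptotics.isBigO_refl _ _)
  have h3 := partialSum_isBigO h2 fun n hn => (h.c_mem.pow 4).pos hn
  have h4 := ((Asymptotics.isBigO_refl (fun n : ℕ => (c n ^ 2)⁻¹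
    * (weightSum c n)⁻¹) atTop).mul h3).trans
      (((h.tendsto_inv_sq_mul_sum_four (h.tau_le_of_tendsto_atTop hc)).congr fun n => by
        ring).isBigO_one ℝ)
  exact h4.congr_left fun n => by ring

end Rates
end Rates

section Gaussian
variable {d : ℕ} {f : EuclideanSpace ℝ (Fin d) → ℝ} {θ : EuclideanSpace ℝ (Fin d)} {L : ℝ}

namespace IsRegularMaximizer

/-- As `H⁻¹` is symmetric, `H⁻²` is positive semidefinite and its quadratic form at `s` is `‖H⁻¹
s‖²`. -/
lemma charFun_multivariateGaussian_inv_sq (h : IsRegularMaximizer f θ L) {r : ℝ} (hr : 0 ≤ r)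
    (b s : EuclideanSpace ℝ (Fin d)) :
    charFun (multivariateGaussian b (r • (hessian f θ)⁻¹ ^ 2)) s
      = Complex.exp ((inner ℝ s b : ℝ) * Complex.I
        - (r * ‖invHessianCLM f θ s‖ ^ 2 : ℝ) / 2) := by
  have hpos : (r • (hessian f θ)⁻¹ ^ 2).PosSemidef := by
    refine Matrix.PosSemidef.smul ?_ hr
    have := Matrix.posSemidef_conjTranspose_mul_self (hessian f θ)⁻¹
    rwa [h.isHermitian_inv.eq, ← pow_two] at this
  rw [charFun_multivariateGaussian hpos]
  congr 3
  have e : inner ℝ s (Matrix.toEuclideanCLM (𝕜 := ℝ) (r • (hessian f θ)⁻¹ ^ 2) s)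
      = r * ‖invHessianCLM f θ s‖ ^ 2 := by
    rw [map_smul, map_pow, pow_two]
    change inner ℝ s (r • invHessianCLM f θ (invHessianCLM f θ s)) = _
    rw [real_inner_smul_right, ← h.inner_invHessianCLM, real_inner_self_eq_norm_sq]
  rw [← e, Matrix.inner_toEuclideanCLM]

end IsRegularMaximizer
end Gaussian

end

end KWB

end

/-! ### The theorem: choice of the normalization in each regime. -/

theorem theorem3 {d δ : ℕ} (hδ : 1 ≤ δ)
    {Ω : Type*} [MeasurableSpace Ω] (Pr : Measure Ω) [IsProbabilityMeasure Pr]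
    (P : Kernel (EuclideanSpace ℝ (Fin d)) ℝ) [IsMarkovKernel P]
    (θ : EuclideanSpace ℝ (Fin d)) (L σ m α τ : ℝ) (a c : ℕ → ℝ)
    (Θ : ℕ → Ω → EuclideanSpace ℝ (Fin d)) (M : ℕ → Ω → ℝ)
    (Z : ℕ → KWB.Label d δ → Ω → ℝ)
    (hAlg : KWB.IsAlgorithm a c Θ M Z)
    (hConv : ∀ᵐ ω ∂Pr, Tendsto (fun n => Θ n ω) atTop (𝓝 θ))
    (hMax : KWB.IsRegularMaximizer (KWB.regression P) θ L)
    (hNoise : KWB.HasUniformNoise P σ m)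
    (hSampling : KWB.IsSampling Pr P c Θ Z)
    (hStep : KWB.StepConditions a c m L α τ)
    (hAvg : KWB.AveragingConditions a c) :
    let f := KWB.regression P
    let H := KWB.hessian f θ
    let R := KWB.thirdOrderBias f θ
    let νμ : Measure ℝ := gaussianReal 0 (σ ^ 2 / δ).toNNReal
    (Tendsto (fun n : ℕ => (n : ℝ) * c n ^ 6) atTop atTop →
      TendstoInDistribution
        (fun (n : ℕ) (ω : Ω) =>
          ((c n ^ 2)⁻¹ • (KWB.average c Θ n ω - θ), Real.sqrt n * (M n ω - f θ)))
        atTop id (fun _ => Pr)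
        ((Measure.dirac
          (WithLp.toLp 2 (-((1 - 2 * τ) / (1 - 4 * τ)) • H⁻¹.mulVec R) :
            EuclideanSpace ℝ (Fin d))).prod νμ)) ∧
    (Tendsto (fun n : ℕ => (n : ℝ) * c n ^ 6) atTop (𝓝 0) →
      TendstoInDistribution
        (fun (n : ℕ) (ω : Ω) =>
          (Real.sqrt (n * c n ^ 2) • (KWB.average c Θ n ω - θ), Real.sqrt n * (M n ω - f θ)))
        atTop id (fun _ => Pr)
        ((multivariateGaussian 0 (((1 - 2 * τ) * σ ^ 2 / 2) • (H⁻¹) ^ 2)).prod νμ)) ∧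
    (∀ γ₁ : ℝ, 0 < γ₁ → Tendsto (fun n : ℕ => (n : ℝ) * c n ^ 6) atTop (𝓝 γ₁) →
      TendstoInDistribution
        (fun (n : ℕ) (ω : Ω) =>
          (Real.sqrt (n * c n ^ 2) • (KWB.average c Θ n ω - θ), Real.sqrt n * (M n ω - f θ)))
        atTop id (fun _ => Pr)
        ((multivariateGaussian (WithLp.toLp 2 ((-2 * Real.sqrt γ₁) • H⁻¹.mulVec R))
          ((σ ^ 2 / 3) • (H⁻¹) ^ 2)).prod νμ)) := by
  intro f H R νμ
  have hR := hStep.rates hAvg hMax.L_pos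
  have hS : KWB.AveragingSetting Pr a c Θ M Z f θ L τ σ (min m 3) :=
    ⟨hAlg, KWB.measurable_regression P, hMax, KWB.noiseArray hAlg hNoise hSampling, hR, hConv⟩
  have hτ := hR.tau_le
  have hb : ∀ r : ℝ, (WithLp.toLp 2 (r • H⁻¹.mulVec R) : EuclideanSpace ℝ (Fin d))
      = r • KWB.invHessianCLM f θ (KWB.biasVec f θ) := fun r => rfl
  refine ⟨fun hc => ?_, fun hc => ?_, fun γ hγ hc => ?_⟩
  -- Normalization `c_n⁻²`: the variance vanishes, only the bias remains, and the limit is a point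
  -- mass.
  · refine hS.tendstoInDistribution hδ (hR.tendsto_inv_sq_sq_div hc)
      (hR.tendsto_inv_sq_mul_sum_four (hR.tau_le_of_tendsto_atTop hc))
      (hR.inv_sq_mul_driftSum_isBigO hc) _ fun s => ?_
    rw [charFun_dirac, real_inner_comm, hb]
    simp
  -- Normalization `√(n c_n²)`: the bias coefficient is `0` and `V = 1 - 2τ`.
  · refine hS.tendstoInDistribution hδ hR.tendsto_sq_sqrt_div
      (hR.tendsto_sqrt_mul_sum_four_zero hc) (hR.sqrt_mul_driftSum_isBigO (hc.isBigO_one ℝ)) _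
      fun s => ?_
    have h1 : 0 ≤ (1 - 2 * τ) * σ ^ 2 / 2 := by
      have : 0 ≤ 1 - 2 * τ := by linarith
      positivity
    rw [hMax.charFun_multivariateGaussian_inv_sq h1, neg_zero, zero_smul,
      show (1 - 2 * τ) * σ ^ 2 / 2 = σ ^ 2 * (1 - 2 * τ) / 2 by ring]
  -- Now `τ = 1/6`, so that `(1 - 2τ)/(1 - 4τ) = 2` and `(1 - 2τ)/2 = 1/3`.
  · refine hS.tendstoInDistribution hδ hR.tendsto_sq_sqrt_div
      (hR.tendsto_sqrt_mul_sum_four hγ hc) (hR.sqrt_mul_driftSum_isBigO (hc.isBigO_one ℝ)) _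
      fun s => ?_
    rw [hMax.charFun_multivariateGaussian_inv_sq (by positivity), hb, hR.tau_eq_of_tendsto hγ hc,
      neg_mul, show σ ^ 2 * (1 - 2 * (1 / 6)) / 2 = σ ^ 2 / 3 by ring]
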